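/- Let $R$ be a commutative noetherian ring. **Notation.** Write $V(I)$ for the set of primes containing an ideal $I$ and $\mathrm D(I)=\operatorname{Spec}R\setminus V(I)$. For a specialization-closed subset $\Phi\subseteq\operatorname{Spec}R$ let $\Gamma_\Phi(M)=\{x\in M\mid \operatorname{Supp}(Rx)\subseteq\Phi\}$, let $\mathrm H^i_\Phi$ be its $i$-th right derived functor, and put $\operatorname{cd}\Phi=\sup\{i\mid \mathrm H^i_\Phi(M)\neq0\text{ for some }R\text{-module }M\}\in\mathbb N\cup\{\pm\infty\}$; for an ideal $I$ put $\mathrm H^i_I=\mathrm H^i_{V(I)}$ and $\operatorname{cd}I=\operatorname{cd}V(I)$. The small support of an $R$-module $M$ is $\operatorname{supp}M=\{\mathfrak p\mid M\otimes^{\mathbf L}_R\kappa(\mathfrak p)\not\cong0\}=\{\mathfrak p\mid \operatorname{Tor}^R_i(M,\kappa(\mathfrak p))\ne0\text{ for some }i\}$, and $\operatorname{supp}^{-1}\Psi$ is the full subcategory of all $R$-modules $M$ with $\operatorname{supp}M\subseteq\Psi$. For $n\ge0$, a full subcategory $\mathcal X$ of $\operatorname{Mod}R$ is called $n$-wide if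 it is closed under extensions and, for every exact sequence $0\to M\to X^0\to\cdots\to X^n\to N\to0$ of $R$-modules with all $X^i\in\mathcal X$, both $M$ and $N$ are in $\mathcal X$. 1. Let $1\le r\le s$ be integers, let $\mathfrak a,\mathfrak b$ be ideals of $R$ generated by $r$ and $s$ elements respectively, and put $I=\mathfrak a\cap\mathfrak b$, $J=\mathfrak a+\mathfrak b$. If $\mathrm H_J^{r+s}(R)\ne0$, then $\operatorname{cd}I=r+s-1$ and $\operatorname{supp}^{-1}\mathrm D(I)$ is $s$-wide. 2. Let $x_1,\dots,x_t\in R$ with $\operatorname{ht}(x_1,\dots,x_t)=t\ge4$, let $s$ be an integer with $\frac t2\le s\le t-2$, and put $I=(x_1,\dots,x_{t-s})\cap(x_{t-s+1},\dots,x_t)$. Then $\operatorname{supp}^{-1}\mathrm D(I)$ is $s$-wide, but $\operatorname{cd}I=t-1>s$. 3. For every integer $n$ with $2\le n\le\dim R-2$ there is a specialization-closed (indeed closed) subset $\Phi\subseteq\operatorname{Spec}R$ such that $\operatorname{supp}^{-1}(\operatorname{Spec}R\setminus\Phi)$ is $n$-wide but $\operatorname{cd}\Phi>n$. That is, for each such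 $n$ the converse of the implication "$\operatorname{cd}\Phi\le n$ implies that $\operatorname{supp}^{-1}(\operatorname{Spec}R\setminus\Phi)$ is $n$-wide" fails. -/

import Mathlib

open CategoryTheory

universe u

namespace SpClosed

variable {R : Type u} [CommRing R]

/-- The submodule `Γ_Φ(M) = {x ∈ M | Supp (R x) ⊆ Φ}`. -/
def torsionSubmodule (Φ : Set (PrimeSpectrum R)) (M : Type u) [AddCommGroup M] [Module R M] :
    Submodule R M where
  carrier := {x | Module.support R (Submodule.span R {x}) ⊆ Φ}
  zero_mem' := by
    have : Subsingleton (Submodule.span R {(0 : M)}) := by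
      rw [Submodule.span_zero_singleton]; infer_instance
    simp [Module.support_eq_empty]
  add_mem' := by
    intro x y hx hy p hp
    by_contra hpΦ
    have h1 := fun h => hpΦ (hx h)
    have h2 := fun h => hpΦ (hy h)
    rw [Module.support_eq_zeroLocus] at h1 h2 hp
    simp only [Submodule.annihilator_span_singleton, PrimeSpectrum.mem_zeroLocus] at h1 h2 hp
    obtain ⟨a, ha, hap⟩ := Set.not_subset.1 h1
    obtain ⟨b, hb, hbp⟩ := Set.not_subset.1 h2
    have ha' : a • x = 0 := by simpa using ha
    have hb' : b • y = 0 := by simpa using hb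
    have hab : a * b ∈ p.asIdeal := hp (by
      simp only [SetLike.mem_coe, LinearMap.mem_ker, LinearMap.toSpanSingleton_apply]
      rw [smul_add, mul_comm, mul_smul, ha', mul_comm, mul_smul, hb', smul_zero, smul_zero,
        add_zero])
    exact (p.2.mem_or_mem hab).elim hap hbp
  smul_mem' := by
    intro c x hx
    have hle : Submodule.span R {c • x} ≤ Submodule.span R {x} :=
      Submodule.span_singleton_smul_le R c x
    exact (Module.support_subset_of_injective _ (Submodule.inclusion_injective hle)).trans hx

lemma mem_torsionSubmodule {Φ : Set (PrimeSpectrum R)} {M : Type u} [AddCommGroup M] [Module R M]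
    {x : M} : x ∈ torsionSubmodule Φ M ↔ Module.support R (Submodule.span R {x}) ⊆ Φ :=
  Iff.rfl

/-- Linear maps send `Γ_Φ(M)` to `Γ_Φ(N)`. -/
lemma map_mem_torsionSubmodule (Φ : Set (PrimeSpectrum R)) {M N : Type u} [AddCommGroup M]
    [Module R M] [AddCommGroup N] [Module R N] (f : M →ₗ[R] N) (x : M)
    (hx : x ∈ torsionSubmodule Φ M) : f x ∈ torsionSubmodule Φ N := by
  intro p hp
  apply hx
  rw [Module.support_eq_zeroLocus] at hp ⊢
  refine PrimeSpectrum.zeroLocus_anti_mono ?_ hp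
  intro a ha
  have ha' : a • x = 0 := by simpa [Submodule.annihilator_span_singleton] using ha
  simp [← map_smul, ha']

/-- The torsion functor `Γ_Φ : Mod R ⥤ Mod R`. -/
def torsionFunctor (Φ : Set (PrimeSpectrum R)) : ModuleCat.{u} R ⥤ ModuleCat.{u} R where
  obj M := ModuleCat.of R (torsionSubmodule Φ M)
  map f := ModuleCat.ofHom (f.hom.restrict (map_mem_torsionSubmodule Φ f.hom))

instance torsionFunctor_additive (Φ : Set (PrimeSpectrum R)) : (torsionFunctor Φ).Additive where

/-- The local cohomology functor `H^n_Φ`, the `n`-th right derived functor of `Γ_Φ`.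
For an ideal `J`, `H^n_J` is `H^n_{V(J)}`. -/
noncomputable def localCohomology (Φ : Set (PrimeSpectrum R)) (n : ℕ) :
    ModuleCat.{u} R ⥤ ModuleCat.{u} R :=
  (torsionFunctor Φ).rightDerived n

/-- For `R` noetherian and `Φ = V(J)`, `Γ_Φ` is the classical `J`-torsion functor. -/
lemma mem_torsionSubmodule_zeroLocus [IsNoetherianRing R] (J : Ideal R) (M : Type u)
    [AddCommGroup M] [Module R M] (x : M) :
    x ∈ torsionSubmodule (PrimeSpectrum.zeroLocus (J : Set R)) M ↔
      ∃ k : ℕ, ∀ a ∈ J ^ k, a • x = 0 := by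
  rw [mem_torsionSubmodule, Module.support_eq_zeroLocus,
    PrimeSpectrum.zeroLocus_subset_zeroLocus_iff]
  have key : ∀ a, a ∈ Module.annihilator R (Submodule.span R {x}) ↔ a • x = 0 := by
    intro a
    refine (Submodule.mem_annihilator_span_singleton x a)
  constructor
  · intro h
    obtain ⟨k, hk⟩ := Ideal.exists_pow_le_of_le_radical_of_fg h (IsNoetherian.noetherian J)
    exact ⟨k, fun a ha => (key a).1 (hk ha)⟩
  · rintro ⟨k, hk⟩ a ha
    exact ⟨k, (key _).2 (hk _ (Ideal.pow_mem_pow ha k))⟩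

/-- `cd Φ = sup {i | H^i_Φ(M) ≠ 0 for some R-module M}`, with `⊥` (that is, `-∞`) as the supremum
of the empty set. -/
noncomputable def cd (Φ : Set (PrimeSpectrum R)) : WithBot ℕ∞ :=
  ⨆ (n : ℕ) (_ : ∃ M : ModuleCat.{u} R, ¬ Limits.IsZero ((localCohomology Φ n).obj M)),
    (n : WithBot ℕ∞)

/-- `cd I = cd V(I)` for an ideal `I`. -/
noncomputable def cdIdeal (I : Ideal R) : WithBot ℕ∞ :=
  cd (PrimeSpectrum.zeroLocus (I : Set R))

/-- The small support of a module: the primes `p` with `M ⊗ᴸ κ(p) ≇ 0`, that is, such that one of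
the homology modules `Tor_i(M, κ(p))` of `M ⊗ᴸ κ(p)` is nonzero. -/
def smallSupport (M : ModuleCat.{u} R) : Set (PrimeSpectrum R) :=
  {p | ∃ i : ℕ, ¬ Limits.IsZero
    (((Tor (ModuleCat.{u} R) i).obj M).obj (ModuleCat.of R p.asIdeal.ResidueField))}

/-- `supp⁻¹(Φ)`: the full subcategory of modules whose small support lies in `Φ`. -/
def suppInv (Φ : Set (PrimeSpectrum R)) : ObjectProperty (ModuleCat.{u} R) :=
  fun M => smallSupport M ⊆ Φ

/-- `D(I)`: the set of prime ideals not containing `I`. -/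
def D (I : Ideal R) : Set (PrimeSpectrum R) := {p | ¬ I ≤ p.asIdeal}

/-- `0 → M → X⁰ → ⋯ → Xⁿ → N → 0` is an exact sequence with all `Xⁱ` in `P`. Here `M`, `Xⁱ`, `N` are
the objects of `S` at the places `0`, `i + 1`, `n + 2`. -/
structure IsExactThrough (P : ObjectProperty (ModuleCat.{u} R)) (n : ℕ)
    (S : ComposableArrows (ModuleCat.{u} R) (n + 2)) : Prop where
  mono : Mono (S.map' 0 1)
  exact : S.Exact
  epi : Epi (S.map' (n + 1) (n + 2))
  mem : ∀ (i : ℕ) (hi : i ≤ n), P (S.obj' (i + 1))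

/-- Closed under extensions, `n`-kernels and `n`-cokernels. -/
structure IsNWide (n : ℕ) (P : ObjectProperty (ModuleCat.{u} R)) : Prop where
  closedUnderExtensions : P.IsClosedUnderExtensions
  closedUnderNKernels : ∀ S : ComposableArrows (ModuleCat.{u} R) (n + 2),
    IsExactThrough P n S → P (S.obj' 0)
  closedUnderNCokernels : ∀ S : ComposableArrows (ModuleCat.{u} R) (n + 2),
    IsExactThrough P n S → P (S.obj' (n + 2))

end SpClosed

/-! The proof runs through the Čech complex `cech xs`, obtained by iterating the fibre of `K → K_x`.
Over a noetherian ring its cohomology `CH` vanishes in a given positive degree exactly when local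
cohomology at the ideal of the list does (`isZero_localCohomology_iff`), and it is zero above the
length of the list.

Cohomological dimension. Let `a`, `b` have r, s ≥ 1 generators, I = a ∩ b and J = a + b. In the
Mayer–Vietoris sequence H^k_a ⊕ H^k_b → H^k_I → H^{k+1}_J the outer terms are zero for k ≥ r + s. In
H^{r+s-1}_I → H^{r+s}_J → H^{r+s}_a ⊕ H^{r+s}_b the last term is zero, so nonvanishing at J forces
nonvanishing at I. This is `cdIdeal_inf_eq`.

Wideness. A module has small support in D(a) exactly when all its `CH` along generators of a vanish
(`suppInv_D_iff`). For an exact sequence 0 → M → X⁰ → ⋯ → Xⁿ → N → 0 of such X^i, dimension shifting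
turns H^k(M), k ≤ n, into H^0 of a submodule of X^k, and H^k(N) into H^{k+n+1}(M). Everything
vanishes if there are at most n generators (`subsingleton_CH_ends`). As D(a ∩ b) = D(a) ∩ D(b),
wideness for I depends only on the larger of r and s, whereas the cohomological dimension is r + s -
1; this gap refutes the converse.

Small support. If the Čech complex of M is exact, then M inherits the vanishing of Tor with κ(p), p
∈ V(a), from the other terms, which are products of localizations at elements that kill κ(p).
Conversely, vanishing of Tor with these κ(p) gives vanishing with all a-torsion modules by
dévissage, and the Čech complex of R is bounded and flat with torsion cohomology, so it becomes
exact after tensoring with M.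

Examples. If t ≥ 1 elements generate an ideal of height t, the top cohomology of R is nonzero
(`nontrivial_CH_of_height`): localize at a prime of height t and use Grothendieck nonvanishing,
proved from artinianness of local cohomology. -/

namespace SpClosed

/-! ### Localization at one element -/

section Localization

variable {R : Type u} [CommRing R]

/-- Localization of a module at the powers of one element. -/
abbrev Away (x : R) (M : Type u) [AddCommGroup M] [Module R M] : Type u :=
  LocalizedModule (Submonoid.powers x) M

/-- The localization map `M → M_x`. -/
noncomputable def awayMk (x : R) (M : Type u) [AddCommGroup M] [Module R M] :
    M →ₗ[R] Away x M :=
  LocalizedModule.mkLinearMap (Submonoid.powers x) M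

instance (x : R) (M : Type u) [AddCommGroup M] [Module R M] :
    IsLocalizedModule (Submonoid.powers x) (awayMk x M) :=
  inferInstanceAs (IsLocalizedModule _ (LocalizedModule.mkLinearMap (Submonoid.powers x) M))

/-- The localization of a linear map. -/
noncomputable def awayMap (x : R) {M N : Type u} [AddCommGroup M] [Module R M] [AddCommGroup N]
    [Module R N] (f : M →ₗ[R] N) : Away x M →ₗ[R] Away x N :=
  IsLocalizedModule.map (Submonoid.powers x) (awayMk x M) (awayMk x N) f

variable (x : R) {M N P : Type u} [AddCommGroup M] [Module R M] [AddCommGroup N]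
    [Module R N] [AddCommGroup P] [Module R P]

@[simp] lemma awayMap_mk (f : M →ₗ[R] N) (m : M) : awayMap x f (awayMk x M m) = awayMk x N (f m) :=
  IsLocalizedModule.map_apply _ _ _ _ _

lemma awayMk_surj (b : Away x M) : ∃ (k : ℕ) (a : M), x ^ k • b = awayMk x M a := by
  obtain ⟨⟨a, ⟨_, k, rfl⟩⟩, h⟩ := IsLocalizedModule.surj (Submonoid.powers x) (awayMk x M) b
  exact ⟨k, a, h⟩

lemma awayMk_eq_zero {a : M} (h : awayMk x M a = 0) : ∃ k : ℕ, x ^ k • a = 0 := by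
  obtain ⟨⟨_, k, rfl⟩, h⟩ :=
    (IsLocalizedModule.eq_zero_iff (Submonoid.powers x) (awayMk x M)).1 h
  exact ⟨k, h⟩

lemma awayMk_eq_zero_iff {a : M} : awayMk x M a = 0 ↔ ∃ k : ℕ, x ^ k • a = 0 := by
  refine ⟨awayMk_eq_zero x, fun ⟨k, h⟩ => ?_⟩
  exact (IsLocalizedModule.eq_zero_iff (Submonoid.powers x) (awayMk x M)).2 ⟨⟨_, k, rfl⟩, h⟩

lemma away_pow_smul_bijective (k : ℕ) : Function.Bijective (fun b : Away x M => x ^ k • b) :=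
  (Module.End.isUnit_iff _).1
    (IsLocalizedModule.map_units (awayMk x M) (⟨x ^ k, k, rfl⟩ : Submonoid.powers x))

lemma away_pow_smul_cancel (k : ℕ) {b c : Away x M} (h : x ^ k • b = x ^ k • c) : b = c :=
  (away_pow_smul_bijective x k).1 h

lemma away_hom_ext {f g : Away x M →ₗ[R] Away x N}
    (h : ∀ m, f (awayMk x M m) = g (awayMk x M m)) : f = g := by
  ext b
  obtain ⟨k, a, ha⟩ := awayMk_surj x b
  apply away_pow_smul_cancel x k
  simp only [← map_smul, ha, h]

lemma awayMap_id : awayMap x (LinearMap.id : M →ₗ[R] M) = LinearMap.id :=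
  away_hom_ext x fun m => by simp

lemma awayMap_comp_apply (f : M →ₗ[R] N) (g : N →ₗ[R] P) (b : Away x M) :
    awayMap x g (awayMap x f b) = awayMap x (g ∘ₗ f) b := by
  have : awayMap x g ∘ₗ awayMap x f = awayMap x (g ∘ₗ f) := away_hom_ext x fun m => by simp
  exact LinearMap.congr_fun this b

lemma awayMap_zero : awayMap x (0 : M →ₗ[R] N) = 0 :=
  away_hom_ext x fun m => by simp

lemma awayMap_smul_id (r : R) : awayMap x (r • LinearMap.id : M →ₗ[R] M) = r • LinearMap.id :=
  away_hom_ext x fun m => by simp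

lemma awayMap_injective {f : M →ₗ[R] N} (hf : Function.Injective f) :
    Function.Injective (awayMap x f) :=
  IsLocalizedModule.map_injective _ _ _ _ hf

lemma awayMap_surjective {f : M →ₗ[R] N} (hf : Function.Surjective f) :
    Function.Surjective (awayMap x f) :=
  IsLocalizedModule.map_surjective _ _ _ _ hf

lemma awayMap_exact {f : M →ₗ[R] N} {g : N →ₗ[R] P} (h : Function.Exact f g) :
    Function.Exact (awayMap x f) (awayMap x g) :=
  IsLocalizedModule.map_exact _ _ _ _ _ _ h

lemma subsingleton_away_of_smul_eq_zero (h : ∀ m : M, x • m = 0) : Subsingleton (Away x M) := by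
  refine ⟨fun b c => ?_⟩
  suffices ∀ b : Away x M, b = 0 by rw [this b, this c]
  intro b
  obtain ⟨k, a, ha⟩ := awayMk_surj x b
  apply away_pow_smul_cancel x (k + 1)
  rw [pow_succ', mul_smul, ha, ← map_smul, h, map_zero, smul_zero]

end Localization

/-! ### The fibre of `K → K_x` and the Čech complex -/

section Fib

variable {R : Type u} [CommRing R]

lemma isZero_homology_iff {ι : Type*} {c : ComplexShape ι}
    (K : HomologicalComplex (ModuleCat.{u} R) c) (i j k : ι) (hi : c.prev j = i)
    (hk : c.next j = k) :
    Limits.IsZero (K.homology j) ↔ ∀ z : K.X j, K.d j k z = 0 → ∃ y, K.d i j y = z := by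
  rw [← HomologicalComplex.exactAt_iff_isZero_homology, K.exactAt_iff' i j k hi hk,
    ShortComplex.moduleCat_exact_iff]
  rfl

lemma isZero_homology_succ_iff (K : CochainComplex (ModuleCat.{u} R) ℕ) (n : ℕ) :
    Limits.IsZero (K.homology (n + 1)) ↔
      ∀ z : K.X (n + 1), K.d (n + 1) (n + 2) z = 0 → ∃ y, K.d n (n + 1) y = z :=
  isZero_homology_iff K n (n + 1) (n + 2) (by simp) (by simp)

lemma isZero_homology_zero_iff (K : CochainComplex (ModuleCat.{u} R) ℕ) :
    Limits.IsZero (K.homology 0) ↔ ∀ z : K.X 0, K.d 0 1 z = 0 → z = 0 := by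
  rw [isZero_homology_iff K 0 0 1 (by simp) (by simp)]
  refine forall₂_congr fun z _ => ?_
  simp [eq_comm]

lemma d_d_apply {ι : Type*} {c : ComplexShape ι} (K : HomologicalComplex (ModuleCat.{u} R) c)
    (i j k : ι) (z : K.X i) : K.d j k (K.d i j z) = 0 := by
  have := K.d_comp_d i j k
  exact congrArg (fun f => f.hom z) this

lemma comm_apply {ι : Type*} {c : ComplexShape ι} {K L : HomologicalComplex (ModuleCat.{u} R) c}
    (f : K ⟶ L) (i j : ι) (z : K.X i) : L.d i j (f.f i z) = f.f j (K.d i j z) := by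
  have := f.comm i j
  exact congrArg (fun f => f.hom z) this

variable (x : R)

/-- The objects of the fibre of `K → K_x`. -/
noncomputable def fibX (K : CochainComplex (ModuleCat.{u} R) ℕ) : ℕ → ModuleCat.{u} R
  | 0 => K.X 0
  | n + 1 => ModuleCat.of R (K.X (n + 1) × Away x (K.X n))

/-- The differentials of the fibre of `K → K_x`. -/
noncomputable def fibD (K : CochainComplex (ModuleCat.{u} R) ℕ) :
    ∀ n, fibX x K n ⟶ fibX x K (n + 1)
  | 0 => ModuleCat.ofHom ((K.d 0 1).hom.prod (awayMk x (K.X 0)))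
  | n + 1 => ModuleCat.ofHom (((K.d (n + 1) (n + 2)).hom ∘ₗ LinearMap.fst R _ _).prod
      (awayMk x (K.X (n + 1)) ∘ₗ LinearMap.fst R _ _ -
        awayMap x (K.d n (n + 1)).hom ∘ₗ LinearMap.snd R _ _))

lemma fibD_succ_apply (K : CochainComplex (ModuleCat.{u} R) ℕ) (n : ℕ) (a : K.X (n + 1))
    (b : Away x (K.X n)) : (fibD x K (n + 1)).hom (a, b) =
      ((K.d (n + 1) (n + 2)).hom a, awayMk x (K.X (n + 1)) a - awayMap x (K.d n (n + 1)).hom b) :=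
  rfl

lemma awayMap_d_comp_d (K : CochainComplex (ModuleCat.{u} R) ℕ) (i j k : ℕ)
    (b : Away x (K.X i)) : awayMap x (K.d j k).hom (awayMap x (K.d i j).hom b) = 0 := by
  rw [awayMap_comp_apply, ← ModuleCat.hom_comp, K.d_comp_d, ModuleCat.hom_zero, awayMap_zero]
  rfl

/-- The fibre of `K → K_x`, for a cochain complex `K`. -/
noncomputable def fibObj (K : CochainComplex (ModuleCat.{u} R) ℕ) :
    CochainComplex (ModuleCat.{u} R) ℕ :=
  CochainComplex.of (fibX x K) (fibD x K) (by
    intro n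
    ext z
    cases n with
    | zero =>
      change K.X 0 at z
      exact Prod.ext (d_d_apply K 0 1 2 z)
        (sub_eq_zero.2 (awayMap_mk x (K.d 0 1).hom z).symm)
    | succ n =>
      obtain ⟨a, b⟩ := z
      change (fibD x K (n + 2)).hom ((fibD x K (n + 1)).hom (a, b)) = 0
      rw [fibD_succ_apply, fibD_succ_apply, map_sub, awayMap_mk, awayMap_d_comp_d, sub_zero]
      exact Prod.ext (d_d_apply K _ _ _ a) (sub_self _))

lemma fibObj_d (K : CochainComplex (ModuleCat.{u} R) ℕ) (n : ℕ) :
    (fibObj x K).d n (n + 1) = fibD x K n :=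
  CochainComplex.of_d _ _ _

/-- The components of the map induced on fibres of `K → K_x`. -/
noncomputable def fibMapF {K L : CochainComplex (ModuleCat.{u} R) ℕ} (f : K ⟶ L) :
    ∀ n, fibX x K n ⟶ fibX x L n
  | 0 => f.f 0
  | n + 1 => ModuleCat.ofHom ((f.f (n + 1)).hom.prodMap (awayMap x (f.f n).hom))

lemma fibMapF_succ_apply {K L : CochainComplex (ModuleCat.{u} R) ℕ} (f : K ⟶ L) (n : ℕ)
    (a : K.X (n + 1)) (b : Away x (K.X n)) :
    (fibMapF x f (n + 1)).hom (a, b) = ((f.f (n + 1)).hom a, awayMap x (f.f n).hom b) := rfl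

lemma fibMapF_comm {K L : CochainComplex (ModuleCat.{u} R) ℕ} (f : K ⟶ L) (n : ℕ) :
    fibMapF x f n ≫ fibD x L n = fibD x K n ≫ fibMapF x f (n + 1) := by
  ext z
  cases n with
  | zero =>
    change K.X 0 at z
    exact Prod.ext (comm_apply f 0 1 z) (awayMap_mk x (f.f 0).hom z).symm
  | succ n =>
    obtain ⟨a, b⟩ := z
    change (fibD x L (n + 1)).hom ((fibMapF x f (n + 1)).hom (a, b)) =
      (fibMapF x f (n + 2)).hom ((fibD x K (n + 1)).hom (a, b))
    rw [fibD_succ_apply, fibMapF_succ_apply, fibMapF_succ_apply, fibD_succ_apply, map_sub,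
      awayMap_mk, awayMap_comp_apply, awayMap_comp_apply, ← ModuleCat.hom_comp,
      ← ModuleCat.hom_comp, f.comm]
    exact Prod.ext (comm_apply f _ _ a) rfl

/-- The map induced on fibres of `K → K_x`. -/
noncomputable def fibMap {K L : CochainComplex (ModuleCat.{u} R) ℕ} (f : K ⟶ L) :
    fibObj x K ⟶ fibObj x L where
  f := fibMapF x f
  comm' i j hij := by
    obtain rfl : i + 1 = j := hij
    rw [fibObj_d, fibObj_d]
    exact fibMapF_comm x f i

/-- The fibre of `K → K_x` as a functor. -/
noncomputable def fib : CochainComplex (ModuleCat.{u} R) ℕ ⥤ CochainComplex (ModuleCat.{u} R) ℕ where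
  obj := fibObj x
  map f := fibMap x f
  map_id K := by
    ext n z
    cases n with
    | zero => rfl
    | succ n =>
      obtain ⟨a, b⟩ := z
      change (fibMapF x (𝟙 K) (n + 1)).hom (a, b) = (a, b)
      rw [fibMapF_succ_apply]
      exact Prod.ext rfl (LinearMap.congr_fun (awayMap_id x) b)
  map_comp {K L P} f g := by
    ext n z
    cases n with
    | zero => rfl
    | succ n =>
      obtain ⟨a, b⟩ := z
      change (fibMapF x (f ≫ g) (n + 1)).hom (a, b) =
        (fibMapF x g (n + 1)).hom ((fibMapF x f (n + 1)).hom (a, b))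
      rw [fibMapF_succ_apply, fibMapF_succ_apply, fibMapF_succ_apply, awayMap_comp_apply]
      rfl

/-- The Čech complex of a list of elements, as a functor in the module. -/
noncomputable def cech : List R → (ModuleCat.{u} R ⥤ CochainComplex (ModuleCat.{u} R) ℕ)
  | [] => CochainComplex.single₀ _
  | x :: xs => cech xs ⋙ fib x

end Fib

/-! ### Torsion and exactness of the fibre -/

section FibElements

variable {R : Type u} [CommRing R] (x : R)

lemma fibObj_d_zero (K : CochainComplex (ModuleCat.{u} R) ℕ) (a : K.X 0) :
    ((fibObj x K).d 0 1).hom a = ((K.d 0 1).hom a, awayMk x (K.X 0) a) := by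
  rw [fibObj_d]; rfl

lemma fibObj_d_succ (K : CochainComplex (ModuleCat.{u} R) ℕ) (n : ℕ) (a : K.X (n + 1))
    (b : Away x (K.X n)) : ((fibObj x K).d (n + 1) (n + 2)).hom (a, b) =
      ((K.d (n + 1) (n + 2)).hom a, awayMk x (K.X (n + 1)) a - awayMap x (K.d n (n + 1)).hom b) := by
  rw [fibObj_d]; rfl

/-- Every cycle of `K` becomes a boundary after multiplication with a power of `y`. -/
def CyclesTorsion (K : CochainComplex (ModuleCat.{u} R) ℕ) (y : R) : Prop :=
  (∀ z : K.X 0, K.d 0 1 z = 0 → ∃ k : ℕ, y ^ k • z = 0) ∧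
    ∀ n, ∀ z : K.X (n + 1), K.d (n + 1) (n + 2) z = 0 →
      ∃ (k : ℕ) (w : K.X n), y ^ k • z = K.d n (n + 1) w

/-- Inverting `x` turns `K → K_x` into an isomorphism and its fibre into an acyclic complex. The
bounding element is a numerator of the component in `K_x`. -/
lemma cyclesTorsion_fibObj_self (K : CochainComplex (ModuleCat.{u} R) ℕ) :
    CyclesTorsion (fibObj x K) x := by
  refine ⟨fun z hz => ?_, fun n z hz => ?_⟩
  · change K.X 0 at z
    have := (fibObj_d_zero x K z).symm.trans hz
    exact awayMk_eq_zero x (congrArg Prod.snd this)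
  · obtain ⟨a, b⟩ := z
    have h := (fibObj_d_succ x K n a b).symm.trans hz
    have h1 : (K.d (n + 1) (n + 2)).hom a = 0 := congrArg Prod.fst h
    have h2 : awayMk x (K.X (n + 1)) a = awayMap x (K.d n (n + 1)).hom b :=
      sub_eq_zero.1 (congrArg Prod.snd h)
    obtain ⟨k, c, hc⟩ := awayMk_surj x b
    have h3 : awayMk x _ (x ^ k • a - (K.d n (n + 1)).hom c) = 0 := by
      rw [map_sub, map_smul, h2, ← map_smul, hc, awayMap_mk, sub_self]
    obtain ⟨j, hj⟩ := awayMk_eq_zero x h3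
    rw [smul_sub, sub_eq_zero, smul_smul, ← pow_add] at hj
    have hb : x ^ (j + k) • b = awayMk x _ (x ^ j • c) := by
      rw [pow_add, mul_smul, hc, map_smul]
    cases n with
    | zero =>
      refine ⟨j + k, x ^ j • c, ?_⟩
      refine Eq.trans ?_ (fibObj_d_zero x K _).symm
      refine Prod.ext ?_ hb
      rw [map_smul]; exact hj
    | succ n =>
      refine ⟨j + k, (x ^ j • c, 0), ?_⟩
      refine Eq.trans ?_ (fibObj_d_succ x K _ _ _).symm
      rw [map_zero, sub_zero]
      refine Prod.ext ?_ hb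
      rw [map_smul]; exact hj

/-- Torsion cohomology of `K` passes to `K_x`, hence to the fibre. After subtracting the boundary of
an element `w` bounding `y ^ k • a`, torsion one degree lower is applied to a numerator of what
remains in `K_x`. -/
lemma cyclesTorsion_fibObj {K : CochainComplex (ModuleCat.{u} R) ℕ} {y : R}
    (hK : CyclesTorsion K y) : CyclesTorsion (fibObj x K) y := by
  refine ⟨fun z hz => ?_, fun n z hz => ?_⟩
  · change K.X 0 at z
    have := (fibObj_d_zero x K z).symm.trans hz
    exact hK.1 z (congrArg Prod.fst this)
  · obtain ⟨a, b⟩ := z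
    have h := (fibObj_d_succ x K n a b).symm.trans hz
    have h1 : (K.d (n + 1) (n + 2)).hom a = 0 := congrArg Prod.fst h
    have h2 : awayMk x (K.X (n + 1)) a = awayMap x (K.d n (n + 1)).hom b :=
      sub_eq_zero.1 (congrArg Prod.snd h)
    obtain ⟨k, w, hw⟩ := hK.2 n a h1
    change y ^ k • a = (K.d n (n + 1)).hom w at hw
    -- the second component after subtracting the boundary of `w`
    have h3 : awayMap x (K.d n (n + 1)).hom (y ^ k • b - awayMk x _ w) = 0 := by
      rw [map_sub, map_smul, ← h2, awayMap_mk, ← map_smul, hw, sub_self]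
    obtain ⟨i, c, hc⟩ := awayMk_surj x (y ^ k • b - awayMk x _ w)
    have h4 : awayMk x _ ((K.d n (n + 1)).hom c) = 0 := by
      rw [← awayMap_mk, ← hc, map_smul, h3, smul_zero]
    obtain ⟨j, hj⟩ := awayMk_eq_zero x h4
    rw [← map_smul] at hj
    cases n with
    | zero =>
      obtain ⟨l, hl⟩ := hK.1 _ hj
      have h5 : y ^ l • (y ^ k • b - awayMk x _ w) = 0 := by
        apply away_pow_smul_cancel x (j + i)
        rw [smul_zero, smul_comm, pow_add, mul_smul, hc, ← map_smul, ← map_smul, hl, map_zero]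
      rw [smul_sub, smul_smul, ← pow_add, ← map_smul, sub_eq_zero] at h5
      have h6 : y ^ (l + k) • a = (K.d 0 1).hom (y ^ l • w) := by
        rw [map_smul, pow_add, mul_smul, hw]
      exact ⟨l + k, y ^ l • w, (Prod.ext h6 h5 : _ = (_, _)).trans (fibObj_d_zero x K _).symm⟩
    | succ n =>
      obtain ⟨l, v, hv⟩ := hK.2 _ _ hj
      obtain ⟨v', hv'⟩ : ∃ v', x ^ (j + i) • v' = awayMk x _ v :=
      (away_pow_smul_bijective x (j + i)).2 _
      have h5 : y ^ l • (y ^ k • b - awayMk x _ w) = awayMap x (K.d n (n + 1)).hom v' := by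
        apply away_pow_smul_cancel x (j + i)
        rw [← map_smul, hv', awayMap_mk]
        change _ = awayMk x _ ((K.d n (n + 1)) v)
        rw [← hv, map_smul, map_smul, ← hc, smul_comm, pow_add, mul_smul]
      rw [smul_sub, smul_smul, ← pow_add, ← map_smul] at h5
      have h6 : y ^ (l + k) • a = (K.d (n + 1) (n + 2)).hom (y ^ l • w) := by
        rw [map_smul, pow_add, mul_smul, hw]
      have h7 : y ^ (l + k) • b =
          awayMk x _ (y ^ l • w) - awayMap x (K.d n (n + 1)).hom (-v') := by
        rw [map_neg, ← h5]; abel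
      exact ⟨l + k, (y ^ l • w, -v'),
        (Prod.ext h6 h7 : _ = (_, _)).trans (fibObj_d_succ x K _ _ _).symm⟩

/-- By the long exact sequence of the fibre, the only obstruction is the cokernel of `H^0(K) →
H^0(K)_x`, in degree one. By `h0` every zero-cycle becomes `x` times a zero-cycle in the
localization, so this map is onto. -/
lemma fibObj_exact_succ {K : CochainComplex (ModuleCat.{u} R) ℕ}
    (hK : ∀ n, Limits.IsZero (K.homology (n + 1)))
    (h0 : ∀ z : K.X 0, K.d 0 1 z = 0 → ∃ (k : ℕ) (w : K.X 0), K.d 0 1 w = 0 ∧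
      x ^ k • z = x ^ (k + 1) • w) (n : ℕ) :
    Limits.IsZero ((fibObj x K).homology (n + 1)) := by
  simp only [isZero_homology_succ_iff] at hK ⊢
  rintro ⟨a, b⟩ hz
  have h := (fibObj_d_succ x K n a b).symm.trans hz
  have h1 : (K.d (n + 1) (n + 2)).hom a = 0 := congrArg Prod.fst h
  have h2 : awayMk x (K.X (n + 1)) a = awayMap x (K.d n (n + 1)).hom b :=
    sub_eq_zero.1 (congrArg Prod.snd h)
  obtain ⟨a', ha'⟩ := hK n a h1
  change (K.d n (n + 1)).hom a' = a at ha'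
  have h3 : awayMap x (K.d n (n + 1)).hom (b - awayMk x _ a') = 0 := by
    rw [map_sub, ← h2, awayMap_mk, ha', sub_self]
  obtain ⟨i, c, hc⟩ := awayMk_surj x (b - awayMk x _ a')
  have h4 : awayMk x _ ((K.d n (n + 1)).hom c) = 0 := by
    rw [← awayMap_mk, ← hc, map_smul, h3, smul_zero]
  obtain ⟨j, hj⟩ := awayMk_eq_zero x h4
  rw [← map_smul] at hj
  have hc' : x ^ (j + i) • (b - awayMk x _ a') = awayMk x _ (x ^ j • c) := by
    rw [pow_add, mul_smul, hc, map_smul]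
  cases n with
  | zero =>
    -- Iterating `h0` divides a cycle by any power of `x` inside `K_x`.
    have key : ∀ (m : ℕ) (z : K.X 0), K.d 0 1 z = 0 →
        ∃ w : K.X 0, K.d 0 1 w = 0 ∧ awayMk x _ z = x ^ m • awayMk x _ w := by
      intro m
      induction m with
      | zero => exact fun z hz => ⟨z, hz, by simp⟩
      | succ m ih =>
        intro z hz
        obtain ⟨w, hw, hzw⟩ := ih z hz
        obtain ⟨k, v, hv, hwv⟩ := h0 w hw
        refine ⟨v, hv, ?_⟩
        rw [hzw, pow_succ, mul_smul]
        congr 1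
        apply away_pow_smul_cancel x k
        rw [← map_smul, hwv, map_smul, pow_succ, mul_smul]
    obtain ⟨w, hw, h⟩ := key (j + i) _ hj
    rw [h] at hc'
    have h5 := away_pow_smul_cancel x _ hc'
    refine ⟨a' + w, ?_⟩
    have h6 : (K.d 0 1).hom (a' + w) = a := by
      rw [map_add, ha']
      exact (congrArg _ hw).trans (add_zero _)
    have h7 : awayMk x _ (a' + w) = b := by
      rw [map_add, ← h5]; exact add_sub_cancel _ _
    exact (fibObj_d_zero x K _).trans (Prod.ext h6 h7)
  | succ n =>
    obtain ⟨v, hv⟩ := hK _ _ hj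
    obtain ⟨v', hv'⟩ : ∃ v', x ^ (j + i) • v' = awayMk x _ v :=
      (away_pow_smul_bijective x (j + i)).2 _
    have h5 : b - awayMk x _ a' = awayMap x (K.d n (n + 1)).hom v' := by
      apply away_pow_smul_cancel x (j + i)
      rw [← map_smul, hv', awayMap_mk, hc', ← hv]
    refine ⟨(a', - v'), ?_⟩
    refine (fibObj_d_succ x K _ _ _).trans (Prod.ext ha' ?_)
    rw [map_neg, ← h5, sub_neg_eq_add]; exact add_sub_cancel _ _

lemma fibMap_smul_id (K : CochainComplex (ModuleCat.{u} R) ℕ) (r : R) :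
    (fib x).map (r • 𝟙 K) = r • 𝟙 ((fib x).obj K) := by
  ext n z
  cases n with
  | zero => rfl
  | succ n =>
    obtain ⟨a, b⟩ := z
    exact Prod.ext rfl (LinearMap.congr_fun (awayMap_smul_id x r) b)

end FibElements

/-! ### Čech complexes: length, torsion, scalars, degree zero -/

section Cech

variable {R : Type u} [CommRing R]

lemma cech_cons (x : R) (xs : List R) (M : ModuleCat.{u} R) :
    (cech (x :: xs)).obj M = fibObj x ((cech xs).obj M) := rfl

/-- Terms of the Čech complex above the length of the list vanish. -/
lemma subsingleton_cech (xs : List R) (M : ModuleCat.{u} R) (n : ℕ) (hn : xs.length < n) :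
    Subsingleton (((cech xs).obj M).X n) := by
  induction xs generalizing n with
  | nil =>
    have : Limits.IsZero ((HomologicalComplex.single (ModuleCat.{u} R) (ComplexShape.up ℕ) 0).obj M
      |>.X n) := HomologicalComplex.isZero_single_obj_X _ _ _ _ (by simpa using hn.ne')
    exact ModuleCat.subsingleton_of_isZero this
  | cons x xs ih =>
    obtain ⟨n, rfl⟩ : ∃ m, n = m + 1 := ⟨n - 1, by omega⟩
    have h1 := ih (n + 1) (by simp at hn; omega)
    have h2 := ih n (by simpa using hn)
    have : Subsingleton (Away x (((cech xs).obj M).X n)) :=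
      subsingleton_away_of_smul_eq_zero x fun m => Subsingleton.elim _ _
    exact inferInstanceAs (Subsingleton (_ × _))

lemma isZero_cech_homology_of_length_lt (xs : List R) (M : ModuleCat.{u} R) (n : ℕ)
    (hn : xs.length < n) : Limits.IsZero (((cech xs).obj M).homology n) := by
  obtain ⟨n, rfl⟩ : ∃ m, n = m + 1 := ⟨n - 1, by omega⟩
  rw [isZero_homology_succ_iff]
  have := subsingleton_cech xs M _ hn
  exact fun z _ => ⟨0, Subsingleton.elim _ _⟩

lemma cyclesTorsion_cech (xs : List R) (M : ModuleCat.{u} R) (y : R) (hy : y ∈ xs) :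
    CyclesTorsion ((cech xs).obj M) y := by
  induction xs with
  | nil => simp at hy
  | cons x xs ih =>
    rw [cech_cons]
    rcases List.mem_cons.1 hy with rfl | h
    · exact cyclesTorsion_fibObj_self _ _
    · exact cyclesTorsion_fibObj _ (ih h)

/-- Identifies the map that multiplication by `r` on a module induces on cohomology; the torsion
arguments on `S ⧸ p` rest on this. -/
lemma cech_map_smul_id (xs : List R) (M : ModuleCat.{u} R) (r : R) :
    (cech xs).map (r • 𝟙 M) = r • 𝟙 ((cech xs).obj M) := by
  induction xs with
  | nil =>
    change (CochainComplex.single₀ _).map (r • 𝟙 M) = r • 𝟙 ((CochainComplex.single₀ _).obj M)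
    refine HomologicalComplex.from_single_hom_ext ?_
    rw [HomologicalComplex.single_map_f_self]
    simp
    rfl
  | cons x xs ih =>
    change (fib x).map ((cech xs).map (r • 𝟙 M)) = _
    rw [ih, fibMap_smul_id]
    rfl

/-- The identification of the zeroth term of the Čech complex. -/
noncomputable def cechZero (M : ModuleCat.{u} R) : ∀ xs : List R, ((cech xs).obj M).X 0 ≅ M
  | [] => HomologicalComplex.singleObjXSelf (ComplexShape.up ℕ) 0 M
  | _ :: xs => cechZero M xs

lemma cechZero_naturality {M N : ModuleCat.{u} R} (f : M ⟶ N) (xs : List R) :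
    ((cech xs).map f).f 0 ≫ (cechZero N xs).hom = (cechZero M xs).hom ≫ f := by
  induction xs with
  | nil =>
    change ((HomologicalComplex.single (ModuleCat.{u} R) (ComplexShape.up ℕ) 0).map f).f 0 ≫
      (HomologicalComplex.singleObjXSelf (ComplexShape.up ℕ) 0 N).hom =
      (HomologicalComplex.singleObjXSelf (ComplexShape.up ℕ) 0 M).hom ≫ f
    rw [HomologicalComplex.single_map_f_self]
    simp
  | cons x xs ih => exact ih

lemma cech_d_zero_eq_zero_iff (xs : List R) (M : ModuleCat.{u} R)
    (z : ((cech xs).obj M).X 0) : ((cech xs).obj M).d 0 1 z = 0 ↔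
      ∀ x ∈ xs, ∃ k : ℕ, x ^ k • (cechZero M xs).hom z = 0 := by
  induction xs with
  | nil =>
    have : ((cech ([] : List R)).obj M).d 0 1 = 0 := HomologicalComplex.single_obj_d _ _ _ _ _
    refine ⟨fun _ x hx => absurd hx (by simp), fun _ => ?_⟩
    rw [this]
    rfl
  | cons x xs ih =>
    change ((cech xs).obj M).X 0 at z
    have h := ih z
    have h2 : ((cech (x :: xs)).obj M).d 0 1 z = 0 ↔ ((cech xs).obj M).d 0 1 z = 0 ∧
        awayMk x _ z = 0 := by
      have := fibObj_d_zero x ((cech xs).obj M) z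
      change ((fibObj x ((cech xs).obj M)).d 0 1).hom z = 0 ↔ _
      rw [this]
      exact Prod.ext_iff
    rw [h2, h, List.forall_mem_cons, and_comm, awayMk_eq_zero_iff]
    refine and_congr (exists_congr fun k => ?_) Iff.rfl
    change _ ↔ x ^ k • (cechZero M xs).hom z = 0
    rw [← LinearMap.map_smul (cechZero M xs).hom.hom]
    exact ((cechZero M xs).toLinearEquiv.map_eq_zero_iff).symm

end Cech

/-! ### Čech cohomology and its long exact sequences -/

section CechExact

variable {R : Type u} [CommRing R]

instance (xs : List R) : (cech xs).PreservesZeroMorphisms where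
  map_zero M N := by
    -- The zero map factors through `0 • 𝟙 M`, so compatibility with scalars suffices.
    have h : (0 : M ⟶ N) = ((0 : R) • 𝟙 M) ≫ 0 := by simp
    rw [h, Functor.map_comp, cech_map_smul_id, zero_smul, Limits.zero_comp]

/-- A sequence of modules that is short exact. -/
structure IsSES {A B C : Type*} [AddCommGroup A] [AddCommGroup B] [AddCommGroup C] [Module R A]
    [Module R B] [Module R C] (f : A →ₗ[R] B) (g : B →ₗ[R] C) : Prop where
  inj : Function.Injective f
  exact : Function.Exact f g
  surj : Function.Surjective g

lemma IsSES.prodMap {A B C A' B' C' : Type*} [AddCommGroup A] [AddCommGroup B] [AddCommGroup C]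
    [Module R A] [Module R B] [Module R C] [AddCommGroup A'] [AddCommGroup B'] [AddCommGroup C']
    [Module R A'] [Module R B'] [Module R C'] {f : A →ₗ[R] B} {g : B →ₗ[R] C} {f' : A' →ₗ[R] B'}
    {g' : B' →ₗ[R] C'} (h : IsSES f g) (h' : IsSES f' g') :
    IsSES (f.prodMap f') (g.prodMap g') where
  inj := h.inj.prodMap h'.inj
  surj := h.surj.prodMap h'.surj
  exact := by
    rintro ⟨b, b'⟩
    constructor
    · intro hb
      obtain ⟨a, rfl⟩ := (h.exact b).1 (congrArg Prod.fst hb)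
      obtain ⟨a', rfl⟩ := (h'.exact b').1 (congrArg Prod.snd hb)
      exact ⟨(a, a'), rfl⟩
    · rintro ⟨⟨a, a'⟩, h2⟩
      rw [← h2]
      exact Prod.ext (h.exact.apply_apply_eq_zero a) (h'.exact.apply_apply_eq_zero a')

lemma IsSES.away (x : R) {A B C : Type u} [AddCommGroup A] [AddCommGroup B] [AddCommGroup C]
    [Module R A] [Module R B] [Module R C] {f : A →ₗ[R] B} {g : B →ₗ[R] C} (h : IsSES f g) :
    IsSES (awayMap x f) (awayMap x g) :=
  ⟨awayMap_injective x h.inj, awayMap_exact x h.exact, awayMap_surjective x h.surj⟩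

lemma isSES_of_subsingleton {A B C : Type*} [AddCommGroup A] [AddCommGroup B] [AddCommGroup C]
    [Module R A] [Module R B] [Module R C] [Subsingleton A] [Subsingleton B] [Subsingleton C]
    (f : A →ₗ[R] B) (g : B →ₗ[R] C) : IsSES f g :=
  ⟨fun _ _ _ => Subsingleton.elim _ _,
    fun _ => ⟨fun _ => ⟨0, Subsingleton.elim _ _⟩, fun _ => Subsingleton.elim _ _⟩,
    fun _ => ⟨0, Subsingleton.elim _ _⟩⟩

lemma IsSES.of_iso {A B C A' B' C' : ModuleCat.{u} R} {f : A ⟶ B} {g : B ⟶ C} {f' : A' ⟶ B'}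
    {g' : B' ⟶ C'} (h : IsSES f.hom g.hom) (a : A' ≅ A) (b : B' ≅ B) (c : C' ≅ C)
    (hf : f' ≫ b.hom = a.hom ≫ f) (hg : g' ≫ c.hom = b.hom ≫ g) : IsSES f'.hom g'.hom := by
  have hf' : ∀ z, b.hom (f' z) = f (a.hom z) := fun z => congrArg (fun q => q.hom z) hf
  have hg' : ∀ z, c.hom (g' z) = g (b.hom z) := fun z => congrArg (fun q => q.hom z) hg
  have ia : Function.Bijective a.hom := ConcreteCategory.bijective_of_isIso a.hom
  have ib : Function.Bijective b.hom := ConcreteCategory.bijective_of_isIso b.hom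
  have ic : Function.Bijective c.hom := ConcreteCategory.bijective_of_isIso c.hom
  refine ⟨fun x y hxy => ia.1 (h.inj ?_), fun z => ⟨fun hz => ?_, ?_⟩, fun z => ?_⟩
  · exact (hf' x).symm.trans ((congrArg _ hxy).trans (hf' y))
  · have : g (b.hom z) = 0 := (hg' z).symm.trans ((congrArg _ hz).trans (map_zero _))
    obtain ⟨y, hy⟩ := (h.exact (b.hom z)).1 this
    obtain ⟨w, rfl⟩ := ia.2 y
    exact ⟨w, ib.1 ((hf' w).trans hy)⟩
  · rintro ⟨w, rfl⟩
    apply ic.1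
    refine (hg' _).trans ?_
    rw [map_zero]
    exact (congrArg _ (hf' w)).trans (h.exact.apply_apply_eq_zero _)
  · obtain ⟨y, hy⟩ := h.surj (c.hom z)
    obtain ⟨w, rfl⟩ := ib.2 y
    exact ⟨w, ic.1 ((hg' w).trans hy)⟩

/-- Localization is exact, so each passage to the fibre preserves degreewise exactness; the long
exact sequences of `CH` follow. -/
lemma IsSES.cech {A B C : ModuleCat.{u} R} {f : A ⟶ B} {g : B ⟶ C} (h : IsSES f.hom g.hom)
    (xs : List R) (n : ℕ) : IsSES (((cech xs).map f).f n).hom (((cech xs).map g).f n).hom := by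
  induction xs generalizing n with
  | nil =>
    cases n with
    | zero =>
      exact h.of_iso (cechZero A []) (cechZero B []) (cechZero C []) (cechZero_naturality f [])
        (cechZero_naturality g [])
    | succ n =>
      have h0 : ∀ M : ModuleCat.{u} R, Subsingleton (((SpClosed.cech ([] : List R)).obj M).X (n + 1)) :=
        fun M => subsingleton_cech [] M (n + 1) (by simp)
      have := h0 A
      have := h0 B
      have := h0 C
      exact isSES_of_subsingleton _ _
  | cons x xs ih =>
    cases n with
    | zero => exact ih 0
    | succ n => exact (ih (n + 1)).prodMap ((ih n).away x)

lemma shortExact_of_isSES (S : ShortComplex (ModuleCat.{u} R)) (h : IsSES S.f.hom S.g.hom) :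
    S.ShortExact where
  exact := (ShortComplex.ShortExact.moduleCat_exact_iff_function_exact S).2 h.exact
  mono_f := (ModuleCat.mono_iff_injective _).2 h.inj
  epi_g := (ModuleCat.epi_iff_surjective _).2 h.surj

/-- The `n`-th Čech cohomology functor of a list of elements. -/
noncomputable def cechH (xs : List R) (n : ℕ) : ModuleCat.{u} R ⥤ ModuleCat.{u} R :=
  cech xs ⋙ HomologicalComplex.homologyFunctor _ _ n

variable {A B C : Type u} [AddCommGroup A] [AddCommGroup B] [AddCommGroup C] [Module R A]
  [Module R B] [Module R C]

/-- The `n`-th Čech cohomology of a module. -/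
noncomputable abbrev CH (xs : List R) (n : ℕ) (A : Type u) [AddCommGroup A] [Module R A] :
    ModuleCat.{u} R :=
  (cechH xs n).obj (ModuleCat.of R A)

/-- The map induced on Čech cohomology. -/
noncomputable abbrev CHmap (xs : List R) (n : ℕ) (f : A →ₗ[R] B) : CH xs n A →ₗ[R] CH xs n B :=
  ((cechH xs n).map (ModuleCat.ofHom f)).hom

lemma CHmap_smul_id (xs : List R) (n : ℕ) (r : R) :
    CHmap xs n (r • LinearMap.id : A →ₗ[R] A) = r • LinearMap.id := by
  have h : ModuleCat.ofHom (r • LinearMap.id : A →ₗ[R] A) = r • 𝟙 (ModuleCat.of R A) := rfl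
  have h2 : (cechH xs n).map (r • 𝟙 (ModuleCat.of R A)) = r • 𝟙 (CH xs n A) := by
    change HomologicalComplex.homologyMap ((cech xs).map (r • 𝟙 _)) n = _
    rw [cech_map_smul_id]
    exact (ShortComplex.homologyMap_smul (𝟙 (((cech xs).obj (ModuleCat.of R A)).sc n)) r).trans
      (by rw [ShortComplex.homologyMap_id]; rfl)
  rw [CHmap, h, h2]
  rfl

lemma shortExact_cech {f : A →ₗ[R] B} {g : B →ₗ[R] C} (h : IsSES f g) (xs : List R) :
    ((ShortComplex.mk (ModuleCat.ofHom f) (ModuleCat.ofHom g)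
      (by rw [← ModuleCat.ofHom_comp, h.exact.linearMap_comp_eq_zero]; rfl)).map
        (cech xs)).ShortExact :=
  HomologicalComplex.shortExact_of_degreewise_shortExact _ fun n => by
    apply shortExact_of_isSES
    exact IsSES.cech (f := ModuleCat.ofHom f) (g := ModuleCat.ofHom g) h xs n

lemma CHmap_exact {f : A →ₗ[R] B} {g : B →ₗ[R] C} (h : IsSES f g) (xs : List R) (n : ℕ) :
    Function.Exact (CHmap xs n f) (CHmap xs n g) :=
  (ShortComplex.ShortExact.moduleCat_exact_iff_function_exact _).1
    ((shortExact_cech h xs).homology_exact₂ n)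

lemma exists_CH_δ {f : A →ₗ[R] B} {g : B →ₗ[R] C} (h : IsSES f g) (xs : List R) (n : ℕ) :
    ∃ δ : CH xs n C →ₗ[R] CH xs (n + 1) A, Function.Exact (CHmap xs n g) δ ∧
      Function.Exact δ (CHmap xs (n + 1) f) :=
  ⟨((shortExact_cech h xs).δ n (n + 1) rfl).hom,
    (ShortComplex.ShortExact.moduleCat_exact_iff_function_exact _).1
      ((shortExact_cech h xs).homology_exact₃ n (n + 1) rfl),
    (ShortComplex.ShortExact.moduleCat_exact_iff_function_exact _).1
      ((shortExact_cech h xs).homology_exact₁ n (n + 1) rfl)⟩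

lemma CHmap_zero_injective {f : A →ₗ[R] B} {g : B →ₗ[R] C} (h : IsSES f g) (xs : List R) :
    Function.Injective (CHmap xs 0 f) := by
  have : Mono (((cech xs).map (ModuleCat.ofHom f)).f 0) :=
    (ModuleCat.mono_iff_injective _).2
      (IsSES.cech (f := ModuleCat.ofHom f) (g := ModuleCat.ofHom g) h xs 0).inj
  exact (ModuleCat.mono_iff_injective _).1
    (HomologicalComplex.mono_homologyMap_of_mono_of_not_rel _ 0 (by simp))

lemma isZero_CH_iff (xs : List R) (n : ℕ) :
    Limits.IsZero (CH xs n A) ↔ Subsingleton (CH xs n A) :=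
  ModuleCat.isZero_iff_subsingleton

/-- Annihilation of a class can be tested on one representing cycle. The source degree `i` is left
free so that degree zero, into which nothing maps, is covered by `i = 0` and `w = 0`. -/
lemma exists_cycle_rep (K : CochainComplex (ModuleCat.{u} R) ℕ) (n : ℕ) (h : K.homology n) :
    ∃ z : K.X n, K.d n (n + 1) z = 0 ∧
      ∀ (r : R) (i : ℕ) (w : K.X i), r • z = K.d i n w → r • h = 0 := by
  obtain ⟨c, hc⟩ := (ModuleCat.epi_iff_surjective (K.homologyπ n)).1 inferInstance h
  refine ⟨K.iCycles n c, ?_, fun r i w hw => ?_⟩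
  · exact congrArg (fun q => q.hom c) (K.iCycles_d n (n + 1))
  · have h1 : r • c = K.toCycles i n w := by
      apply (ModuleCat.mono_iff_injective (K.iCycles n)).1 inferInstance
      refine (map_smul (K.iCycles n).hom r c).trans (hw.trans ?_)
      exact (congrArg (fun q => q.hom w) (K.toCycles_i i n)).symm
    have h2 : r • h = K.homologyπ n (r • c) := by
      rw [← hc]
      exact (map_smul (K.homologyπ n).hom r c).symm
    rw [h2, h1]
    exact congrArg (fun q => q.hom w) (K.toCycles_comp_homologyπ i n)

lemma CH_torsion (xs : List R) (n : ℕ) (y : R) (hy : y ∈ xs) (h : CH xs n A) :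
    ∃ k : ℕ, y ^ k • h = 0 := by
  obtain ⟨z, hz, hr⟩ := exists_cycle_rep ((cech xs).obj (ModuleCat.of R A)) n h
  have ht := cyclesTorsion_cech xs (ModuleCat.of R A) y hy
  cases n with
  | zero =>
    obtain ⟨k, hk⟩ := ht.1 z hz
    exact ⟨k, hr _ 0 0 (hk.trans (map_zero _).symm)⟩
  | succ n =>
    obtain ⟨k, w, hk⟩ := ht.2 n z hz
    exact ⟨k, hr _ n w hk⟩

lemma CH_torsion_of_mem_radical (xs : List R) (n : ℕ) (y : R)
    (hy : y ∈ (Ideal.span {x | x ∈ xs}).radical) (h : CH xs n A) : ∃ k : ℕ, y ^ k • h = 0 := by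
  have h1 : Ideal.span {x | x ∈ xs} ≤
      Ideal.radical (LinearMap.ker (LinearMap.toSpanSingleton R (CH xs n A) h)) := by
    rw [Ideal.span_le]
    intro x hx
    obtain ⟨k, hk⟩ := CH_torsion xs n x hx h
    exact ⟨k, hk⟩
  obtain ⟨k, hk⟩ := (Ideal.radical_le_radical_iff.2 h1) hy
  exact ⟨k, hk⟩

lemma subsingleton_CH_of_length_lt (xs : List R) (n : ℕ) (hn : xs.length < n) :
    Subsingleton (CH xs n A) :=
  ModuleCat.subsingleton_of_isZero (isZero_cech_homology_of_length_lt xs _ n hn)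

/-- The long exact sequence embeds the cokernel in the cohomology of the kernel one degree higher.
-/
lemma CHmap_surjective_of_length (xs : List R) {f : A →ₗ[R] B} (hf : Function.Surjective f)
    (n : ℕ) (hn : ∀ K : Submodule R A, K = LinearMap.ker f → Subsingleton (CH xs (n + 1) K)) :
    Function.Surjective (CHmap xs n f) := by
  have h : IsSES (LinearMap.ker f).subtype f :=
    ⟨Subtype.val_injective, LinearMap.exact_subtype_ker_map f, hf⟩
  obtain ⟨δ, h1, -⟩ := exists_CH_δ h xs n
  have := hn _ rfl
  exact fun z => (h1 z).1 (Subsingleton.elim _ _)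

lemma subsingleton_CH_congr (xs : List R) (n : ℕ) (e : A ≃ₗ[R] B) :
    Subsingleton (CH xs n A) ↔ Subsingleton (CH xs n B) :=
  ((cechH xs n).mapIso e.toModuleIso).toLinearEquiv.toEquiv.subsingleton_congr

/-- If all elements of the list annihilate the module, the Čech complex is concentrated in degree
zero. -/
lemma subsingleton_cech_of_smul_eq_zero (xs : List R) (h : ∀ x ∈ xs, ∀ a : A, x • a = 0) (n : ℕ) :
    Subsingleton (((cech xs).obj (ModuleCat.of R A)).X (n + 1)) := by
  induction xs with
  | nil => exact subsingleton_cech [] _ _ (by simp)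
  | cons x xs ih =>
    have h1 := ih fun y hy => h y (List.mem_cons_of_mem _ hy)
    have h2 : Subsingleton (Away x (((cech xs).obj (ModuleCat.of R A)).X n)) := by
      refine subsingleton_away_of_smul_eq_zero x fun m => ?_
      have h3 : x • 𝟙 (ModuleCat.of R A) = 0 := by
        ext a
        exact h x (by simp) a
      have h4 := cech_map_smul_id xs (ModuleCat.of R A) x
      rw [h3, Functor.map_zero] at h4
      exact (congrArg (fun q => (q.f n).hom m) h4).symm
    exact inferInstanceAs (Subsingleton (_ × _))

lemma subsingleton_CH_succ_of_smul_eq_zero (xs : List R) (h : ∀ x ∈ xs, ∀ a : A, x • a = 0)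
    (n : ℕ) : Subsingleton (CH xs (n + 1) A) := by
  apply ModuleCat.subsingleton_of_isZero
  refine (isZero_homology_succ_iff ((cech xs).obj (ModuleCat.of R A)) n).2 fun z _ => ?_
  have := subsingleton_cech_of_smul_eq_zero xs h n
  exact ⟨0, Subsingleton.elim _ _⟩

/-- The inclusion of the zeroth Čech cohomology into the module. -/
noncomputable def CHzero (xs : List R) (A : Type u) [AddCommGroup A] [Module R A] :
    CH xs 0 A →ₗ[R] A :=
  (((cech xs).obj (ModuleCat.of R A)).isoHomologyπ₀.inv ≫
    ((cech xs).obj (ModuleCat.of R A)).iCycles 0 ≫ (cechZero (ModuleCat.of R A) xs).hom).hom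

lemma CHzero_injective (xs : List R) : Function.Injective (CHzero xs A) :=
  (ModuleCat.mono_iff_injective (((cech xs).obj (ModuleCat.of R A)).isoHomologyπ₀.inv ≫
    ((cech xs).obj (ModuleCat.of R A)).iCycles 0 ≫ (cechZero (ModuleCat.of R A) xs).hom)).1
    inferInstance

lemma CHzero_naturality (xs : List R) (f : A →ₗ[R] B) (h : CH xs 0 A) :
    CHzero xs B (CHmap xs 0 f h) = f (CHzero xs A h) := by
  have h1 : HomologicalComplex.homologyMap ((cech xs).map (ModuleCat.ofHom f)) 0 ≫
      ((cech xs).obj (ModuleCat.of R B)).isoHomologyπ₀.inv ≫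
        ((cech xs).obj (ModuleCat.of R B)).iCycles 0 ≫ (cechZero (ModuleCat.of R B) xs).hom =
      (((cech xs).obj (ModuleCat.of R A)).isoHomologyπ₀.inv ≫
        ((cech xs).obj (ModuleCat.of R A)).iCycles 0 ≫ (cechZero (ModuleCat.of R A) xs).hom) ≫
          ModuleCat.ofHom f := by
    rw [CochainComplex.isoHomologyπ₀_inv_naturality_assoc]
    simp only [Category.assoc]
    rw [← cechZero_naturality, HomologicalComplex.cyclesMap_i_assoc]
  exact congrArg (fun q => q.hom h) h1

lemma mem_range_CHzero (xs : List R) (a : A) :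
    a ∈ LinearMap.range (CHzero xs A) ↔ ∀ x ∈ xs, ∃ k : ℕ, x ^ k • a = 0 := by
  have hb : Function.Bijective (cechZero (ModuleCat.of R A) xs).hom :=
    ConcreteCategory.bijective_of_isIso (cechZero (ModuleCat.of R A) xs).hom
  obtain ⟨z, rfl⟩ := hb.2 a
  refine Iff.trans ?_ (cech_d_zero_eq_zero_iff xs (ModuleCat.of R A) z)
  constructor
  · rintro ⟨h, hh⟩
    rw [← hb.1 hh]
    exact congrArg (fun q => q.hom (((cech xs).obj (ModuleCat.of R A)).isoHomologyπ₀.inv h))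
      (((cech xs).obj (ModuleCat.of R A)).iCycles_d 0 1)
  · intro hz
    -- The element `z` is viewed as a map from `R`, so that the universal property of the cycles
    -- lifts it.
    let φ : ModuleCat.of R R ⟶ ((cech xs).obj (ModuleCat.of R A)).X 0 :=
      ModuleCat.ofHom (LinearMap.toSpanSingleton R _ z)
    have hφ : φ ≫ ((cech xs).obj (ModuleCat.of R A)).d 0 1 = 0 := by
      ext
      change ((cech xs).obj (ModuleCat.of R A)).d 0 1 ((1 : R) • z) = 0
      rw [one_smul, hz]
    let c := ((cech xs).obj (ModuleCat.of R A)).liftCycles φ 1 (by simp) hφ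
    refine ⟨((cech xs).obj (ModuleCat.of R A)).isoHomologyπ₀.hom (c (1 : R)), ?_⟩
    refine congrArg (cechZero (ModuleCat.of R A) xs).hom ?_
    have h1 : c ≫ ((cech xs).obj (ModuleCat.of R A)).isoHomologyπ₀.hom ≫
        ((cech xs).obj (ModuleCat.of R A)).isoHomologyπ₀.inv ≫
          ((cech xs).obj (ModuleCat.of R A)).iCycles 0 = φ := by
      simp [c]
    refine (congrArg (fun q => q.hom (1 : R)) h1).trans ?_
    exact one_smul R z

lemma subsingleton_CH_zero_iff (xs : List R) : Subsingleton (CH xs 0 A) ↔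
    ∀ a : A, (∀ x ∈ xs, ∃ k : ℕ, x ^ k • a = 0) → a = 0 := by
  simp only [← mem_range_CHzero]
  constructor
  · rintro h _ ⟨h, rfl⟩
    rw [Subsingleton.elim h 0, map_zero]
  · intro h
    refine ⟨fun a b => CHzero_injective xs ?_⟩
    rw [h _ ⟨a, rfl⟩, h _ ⟨b, rfl⟩]

end CechExact

/-! ### A criterion for torsion modules to be artinian -/

section Artinian

variable {R N : Type*} [CommRing R] [AddCommGroup N] [Module R N]

/-- An `x`-power torsion module is artinian if the kernel of `x` is. -/
lemma isArtinian_of_torsion (x : R) (ht : ∀ z : N, ∃ k : ℕ, x ^ k • z = 0)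
    [IsArtinian R (LinearMap.ker (x • LinearMap.id : N →ₗ[R] N))] : IsArtinian R N := by
  set K := LinearMap.ker (x • LinearMap.id : N →ₗ[R] N)
  -- `B A j` is `x ^ j A ∩ ker x`, a submodule of the artinian module `ker x`. It decreases with
  -- `j`, and by `key` the family over all `j` detects equality of nested submodules of `N`.
  let B : Submodule R N → ℕ → Submodule R K := fun A j =>
    (A.map (x ^ j • LinearMap.id)).comap K.subtype
  have mem_B : ∀ (A : Submodule R N) (j : ℕ) (z : K), z ∈ B A j ↔ ∃ a ∈ A, x ^ j • a = z := by
    intro A j z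
    simp [B]
  have B_mono : ∀ {A A' : Submodule R N} (j : ℕ), A ≤ A' → B A j ≤ B A' j := by
    intro A A' j h z hz
    obtain ⟨a, ha, hz⟩ := (mem_B _ _ _).1 hz
    exact (mem_B _ _ _).2 ⟨a, h ha, hz⟩
  have B_anti : ∀ (A : Submodule R N), Antitone (B A) := by
    intro A
    refine antitone_nat_of_succ_le fun j z hz => ?_
    obtain ⟨a, ha, hz⟩ := (mem_B _ _ _).1 hz
    exact (mem_B _ _ _).2 ⟨x • a, A.smul_mem _ ha, by rw [← hz, pow_succ, mul_smul]⟩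
  have key : ∀ A A' : Submodule R N, A' ≤ A → (∀ j, B A j ≤ B A' j) → A ≤ A' := by
    intro A A' hA hB
    have : ∀ k : ℕ, ∀ a ∈ A, x ^ k • a = 0 → a ∈ A' := by
      intro k
      induction k with
      | zero => intro a _ h; rw [pow_zero, one_smul] at h; rw [h]; exact A'.zero_mem
      | succ k ih =>
        intro a ha h
        have hk : x ^ k • a ∈ K := by
          simp only [K, LinearMap.mem_ker, LinearMap.smul_apply, LinearMap.id_apply, smul_smul,
            ← pow_succ', h]
        obtain ⟨a', ha', h'⟩ := (mem_B _ _ _).1 (hB k ((mem_B A k ⟨_, hk⟩).2 ⟨a, ha, rfl⟩))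
        have h2 := ih (a - a') (A.sub_mem ha (hA ha')) (by rw [smul_sub, h', sub_self])
        simpa using A'.add_mem h2 ha'
    intro a ha
    obtain ⟨k, hk⟩ := ht a
    exact this k a ha hk
  rw [← monotone_stabilizes_iff_artinian]
  intro f
  set g : ℕ → Submodule R N := fun i => OrderDual.ofDual (f i) with hg
  have g_anti : Antitone g := fun i j h => f.monotone h
  -- The diagonal `B (g k) k` is constant from `k0` on. This controls all rows `j ≥ k0` at once; the
  -- finitely many rows `j < k0` stabilize separately.
  obtain ⟨k0, hk0⟩ := IsArtinian.monotone_stabilizes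
    (⟨fun k => OrderDual.toDual (B (g k) k), fun i j h =>
      OrderDual.toDual_le_toDual.2 ((B_mono j (g_anti h)).trans (B_anti _ h))⟩ :
      ℕ →o (Submodule R K)ᵒᵈ)
  have hk0' : ∀ m, k0 ≤ m → B (g k0) k0 = B (g m) m := hk0
  have hrow : ∀ j, ∃ i0, ∀ i, i0 ≤ i → B (g i0) j = B (g i) j := fun j =>
    IsArtinian.monotone_stabilizes
      (⟨fun k => OrderDual.toDual (B (g k) j), fun i j' h =>
        OrderDual.toDual_le_toDual.2 (B_mono j (g_anti h))⟩ : ℕ →o (Submodule R K)ᵒᵈ)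
  choose r hr using hrow
  set n0 := max k0 ((Finset.range k0).sup r)
  refine ⟨n0, fun i hi => ?_⟩
  suffices h : g n0 = g i from h
  refine le_antisymm ?_ (g_anti hi)
  refine key _ _ (g_anti hi) fun j => ?_
  rcases lt_or_ge j k0 with hj | hj
  · have h1 : r j ≤ n0 :=
      (Finset.le_sup (f := r) (Finset.mem_range.2 hj)).trans (le_max_right _ _)
    rw [← hr j n0 h1, hr j i (h1.trans hi)]
  · have h1 : B (g n0) j ≤ B (g k0) k0 :=
      (B_mono j (g_anti (le_max_left _ _))).trans (B_anti _ hj)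
    have h2 : B (g (max i j)) (max i j) ≤ B (g i) j :=
      (B_mono _ (g_anti (le_max_left _ _))).trans (B_anti _ (le_max_right _ _))
    rw [hk0' _ (hj.trans (le_max_right i j))] at h1
    exact h1.trans h2

end Artinian

/-! ### Primes of prescribed coheight avoiding an element -/

section PrimeChains

variable {S : Type u} [CommRing S]

open IsLocalRing Order

lemma coheight_lt_of_lt {p q : PrimeSpectrum S} (h : p < q) {n : ℕ}
    (hp : coheight p < ((n + 1 : ℕ) : ℕ∞)) : coheight q < (n : ℕ∞) := by
  have h1 := lt_of_le_of_lt (coheight_add_one_le h) hp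
  push_cast at h1
  exact (ENat.add_lt_add_iff_right ENat.one_ne_top).1 h1

variable [IsLocalRing S] [IsNoetherianRing S]

/-- A prime of positive codimension in the closure of `p` that avoids a given element. -/
lemma exists_lt_coheight_eq_notMem (p : PrimeSpectrum S) (e : ℕ) (he : 1 ≤ e)
    (hp : coheight p = ((e + 1 : ℕ) : ℕ∞)) (f : S) (hf : f ∉ p.asIdeal) :
    ∃ q : PrimeSpectrum S, p < q ∧ coheight q = (e : ℕ∞) ∧ f ∉ q.asIdeal := by
  -- Prime avoidance will give `r` in the maximal ideal, outside `p` and the minimal primes of `p +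
  -- (f)` as far as these are not maximal. A prime of coheight `e ≥ 1` containing `r` is then none
  -- of these minimal primes.
  have hfin : (p.asIdeal ⊔ Ideal.span {f}).minimalPrimes.Finite :=
    Ideal.finite_minimalPrimes_of_isNoetherianRing _ _
  have hFfin : {I : Ideal S | (I ∈ (p.asIdeal ⊔ Ideal.span {f}).minimalPrimes ∨ I = p.asIdeal) ∧
      I ≠ maximalIdeal S}.Finite :=
    (hfin.union (Set.finite_singleton p.asIdeal)).subset fun I hI => hI.1
  have hFprime : ∀ I ∈ hFfin.toFinset, I.IsPrime := by
    intro I hI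
    rcases ((Set.Finite.mem_toFinset _).1 hI).1 with h | rfl
    · exact h.1.1
    · exact p.2
  have havoid : ¬ ((maximalIdeal S : Set S) ⊆ ⋃ I ∈ (hFfin.toFinset : Set (Ideal S)), ((id I : Ideal S) : Set S)) := by
    rw [Ideal.subset_union_prime (f := id) (⊤ : Ideal S) ⊤ (fun I hI _ _ => hFprime I hI)]
    rintro ⟨I, hI, hle⟩
    have hI' := hFprime I hI
    exact ((Set.Finite.mem_toFinset _).1 hI).2 (le_antisymm (le_maximalIdeal hI'.ne_top) hle)
  obtain ⟨r, hrm, hr⟩ := Set.not_subset.1 havoid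
  simp only [Set.mem_iUnion, not_exists] at hr
  have hr' : ∀ I : Ideal S, (I ∈ (p.asIdeal ⊔ Ideal.span {f}).minimalPrimes ∨ I = p.asIdeal) →
      I ≠ maximalIdeal S → r ∉ I := fun I h1 h2 => hr I (by simpa using ⟨h1, h2⟩)
  -- A longest chain from `p` ends at the maximal ideal, which contains `r`; it can be rerouted,
  -- with the same length and head, so that the prime following `p` contains `r`.
  obtain ⟨l, hl, hlen⟩ := exists_series_of_coheight_eq_coe p hp
  have hlast : r ∈ l.last.asIdeal := by
    by_contra hcon
    have hlt : l.last < closedPoint S := by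
      refine lt_of_le_of_ne (le_maximalIdeal l.last.2.ne_top) ?_
      rintro h
      rw [h] at hcon
      exact hcon hrm
    have := length_le_coheight_head (p := l.snoc _ hlt)
    rw [RelSeries.head_snoc, hl, hp, RelSeries.snoc_length, hlen] at this
    exact absurd (ENat.natCast_le_natCast.1 this) (by omega)
  obtain ⟨l', h1, hlen', hhead, -⟩ := PrimeSpectrum.exist_ltSeries_mem_one_of_mem_last l hlast
  rw [hl] at hhead
  rw [hlen] at hlen'
  have hpq : p < l' 1 := by
    rw [hhead]
    refine l'.strictMono ?_
    have : NeZero l'.length := ⟨by omega⟩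
    rw [Fin.lt_def]
    simp [Nat.mod_eq_of_lt (show 1 < l'.length + 1 by omega)]
  have hqe : coheight (l' 1) = (e : ℕ∞) := by
    apply le_antisymm
    · have := coheight_add_one_le hpq
      rw [hp] at this
      push_cast at this
      exact (ENat.add_le_add_iff_right ENat.one_ne_top).1 this
    · have := rev_index_le_coheight l' 1
      refine le_trans ?_ this
      rw [ENat.natCast_le_natCast, Fin.val_rev]
      simp [Nat.mod_eq_of_lt (show 1 < l'.length + 1 by omega)]
      omega
  refine ⟨l' 1, hpq, hqe, fun hfq => ?_⟩
  have hle : p.asIdeal ⊔ Ideal.span {f} ≤ (l' 1).asIdeal :=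
    sup_le hpq.le ((Ideal.span_singleton_le_iff_mem _).2 hfq)
  obtain ⟨q', hq', hq'le⟩ := Ideal.exists_minimalPrimes_le hle
  have hfq' : f ∈ q' := hq'.1.2 (Ideal.mem_sup_right (Ideal.mem_span_singleton_self f))
  have hq'prime := hq'.1.1
  let Q : PrimeSpectrum S := ⟨q', hq'prime⟩
  have hpQ : p < Q := by
    refine lt_of_le_of_ne (le_sup_left.trans hq'.1.2) ?_
    rintro rfl
    exact hf hfq'
  -- If `f` lay in `l' 1`, a minimal prime `Q` of `p + (f)` would lie below it. Equality contradicts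
  -- the choice of `r`; strict inclusion makes a chain from `p` that is too long.
  rcases eq_or_lt_of_le (show Q ≤ l' 1 from hq'le) with h | h
  · refine hr' (l' 1).asIdeal (Or.inl (h ▸ hq')) (fun hm => ?_) h1
    have : l' 1 = closedPoint S := PrimeSpectrum.ext hm
    have h0 : coheight (l' 1) = 0 := by
      rw [this, coheight_eq_zero]
      exact fun q _ => le_maximalIdeal q.2.ne_top
    rw [hqe] at h0
    have : e = 0 := by exact_mod_cast h0
    omega
  · have h2 := coheight_add_one_le h
    have h3 := coheight_add_one_le hpQ
    have h4 : (((e + 1) + 1 : ℕ) : ℕ∞) ≤ ((e + 1 : ℕ) : ℕ∞) := by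
      rw [← hp]
      refine le_trans ?_ h3
      rw [hqe] at h2
      push_cast
      gcongr
    exact absurd (ENat.natCast_le_natCast.1 h4) (by omega)

end PrimeChains

/-! ### Dévissage to quotients by primes -/

section Devissage

variable {S : Type u} [CommRing S]

lemma subsingleton_CH_of_subsingleton (xs : List S) (n : ℕ) (M : Type u) [AddCommGroup M]
    [Module S M] [Subsingleton M] : Subsingleton (CH xs n M) := by
  have h : (LinearMap.id : M →ₗ[S] M) = (0 : S) • LinearMap.id := by
    ext m; exact Subsingleton.elim _ _
  have h1 := CHmap_smul_id (A := M) xs n 0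
  rw [← h, zero_smul] at h1
  have h2 : CHmap xs n (LinearMap.id : M →ₗ[S] M) = LinearMap.id := by
    have := CHmap_smul_id (A := M) xs n 1
    rwa [one_smul, one_smul] at this
  rw [h2] at h1
  exact ⟨fun a b => (LinearMap.congr_fun h1 a).trans (LinearMap.congr_fun h1 b).symm⟩

lemma CH_subsingleton_middle (xs : List S) (n : ℕ) {A B C : Type u} [AddCommGroup A]
    [AddCommGroup B] [AddCommGroup C] [Module S A] [Module S B] [Module S C] {f : A →ₗ[S] B}
    {g : B →ₗ[S] C} (h : IsSES f g) (hA : Subsingleton (CH xs n A))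
    (hC : Subsingleton (CH xs n C)) : Subsingleton (CH xs n B) := by
  refine ⟨fun a b => ?_⟩
  suffices ∀ b : CH xs n B, b = 0 by rw [this a, this b]
  intro b
  obtain ⟨a, rfl⟩ := (CHmap_exact h xs n b).1 (Subsingleton.elim _ _)
  rw [Subsingleton.elim a 0, map_zero]

lemma mem_support_quotient_iff (I : Ideal S) (q : PrimeSpectrum S) :
    q ∈ Module.support S (S ⧸ I) ↔ I ≤ q.asIdeal := by
  rw [Module.support_eq_zeroLocus, Ideal.annihilator_quotient]
  rfl

/-- Multiplication by an element outside a prime ideal on the quotient ring. -/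
lemma isSES_quotient_prime (p : Ideal S) [p.IsPrime] (x : S) (hx : x ∉ p) :
    IsSES (x • LinearMap.id : (S ⧸ p) →ₗ[S] (S ⧸ p))
      (Submodule.factor (le_sup_left : p ≤ p ⊔ Ideal.span {x})) where
  inj := by
    rw [← LinearMap.ker_eq_bot, LinearMap.ker_eq_bot']
    intro m hm
    obtain ⟨a, rfl⟩ := Submodule.Quotient.mk_surjective _ m
    have h1 : x * a ∈ p := (Submodule.Quotient.mk_eq_zero p).1 hm
    exact (Submodule.Quotient.mk_eq_zero p).2
      (((Ideal.IsPrime.mem_or_mem ‹_› h1)).resolve_left hx)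
  exact := by
    intro m
    obtain ⟨a, rfl⟩ := Submodule.Quotient.mk_surjective _ m
    constructor
    · intro h
      have h1 : a ∈ p ⊔ Ideal.span {x} := (Submodule.Quotient.mk_eq_zero _).1 h
      obtain ⟨b, hb, c, hc, rfl⟩ := Submodule.mem_sup.1 h1
      obtain ⟨d, rfl⟩ := Ideal.mem_span_singleton'.1 hc
      refine ⟨Submodule.Quotient.mk d, ?_⟩
      change Submodule.Quotient.mk (x * d) = _
      rw [Submodule.Quotient.eq]
      have : x * d - (b + d * x) = - b := by ring
      rw [this]
      exact p.neg_mem hb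
    · rintro ⟨m, h⟩
      obtain ⟨d, rfl⟩ := Submodule.Quotient.mk_surjective _ m
      rw [← h]
      exact (Submodule.Quotient.mk_eq_zero _).2
        (Ideal.mem_sup_right (Ideal.mul_mem_right _ _ (Ideal.mem_span_singleton_self x)))
  surj := Submodule.factor_surjective _

variable [IsNoetherianRing S]

/-- A finite module has a filtration whose factors are `S ⧸ p` with `p` in the support, and
vanishing in a fixed degree passes through extensions. -/
lemma subsingleton_CH_of_support (xs : List S) (n : ℕ) (Z : Set (PrimeSpectrum S))
    (hZ : ∀ p ∈ Z, Subsingleton (CH xs n (S ⧸ p.asIdeal))) (M : Type u) [AddCommGroup M]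
    [Module S M] [hM : Module.Finite S M] (h : Module.support S M ⊆ Z) :
    Subsingleton (CH xs n M) := by
  induction hM using IsNoetherianRing.induction_on_isQuotientEquivQuotientPrime S with
  | subsingleton N => exact subsingleton_CH_of_subsingleton xs n N
  | quotient N p f =>
    refine (subsingleton_CH_congr xs n f).2 (hZ p (h ?_))
    rw [f.support_eq, mem_support_quotient_iff]
  | exact N₁ N₂ N₃ f g hf hg hfg h₁ h₃ =>
    exact CH_subsingleton_middle xs n ⟨hf, hfg, hg⟩
      (h₁ ((Module.support_subset_of_injective f hf).trans h))
      (h₃ ((Module.support_subset_of_surjective g hg).trans h))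

end Devissage

/-! ### Grothendieck vanishing and nonvanishing over local rings -/

section Nonvanishing

variable {S : Type u} [CommRing S]

open IsLocalRing Order

lemma eq_zero_of_torsion_of_injective {N : Type*} [AddCommGroup N] [Module S N] (x : S)
    (hx : ∀ z : N, x • z = 0 → z = 0) (ht : ∀ z : N, ∃ k : ℕ, x ^ k • z = 0) (z : N) : z = 0 := by
  obtain ⟨k, hk⟩ := ht z
  induction k with
  | zero => simpa using hk
  | succ k ih =>
    rw [pow_succ', mul_smul] at hk
    exact ih (hx _ hk)

lemma subsingleton_of_torsion_of_injective {N : Type*} [AddCommGroup N] [Module S N] (x : S)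
    (hx : ∀ z : N, x • z = 0 → z = 0) (ht : ∀ z : N, ∃ k : ℕ, x ^ k • z = 0) : Subsingleton N :=
  ⟨fun a b => (eq_zero_of_torsion_of_injective x hx ht a).trans
    (eq_zero_of_torsion_of_injective x hx ht b).symm⟩

variable [IsLocalRing S]

/-- A list of elements generating an ideal whose radical is the maximal ideal. -/
structure IsParam (xs : List S) : Prop where
  mem : ∀ x ∈ xs, x ∈ maximalIdeal S
  le_radical : maximalIdeal S ≤ (Ideal.span {x | x ∈ xs}).radical

variable {xs : List S}

lemma subsingleton_CH_succ_closedPoint (hxs : IsParam xs) (n : ℕ) (p : PrimeSpectrum S)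
    (hp : p.asIdeal = maximalIdeal S) : Subsingleton (CH xs (n + 1) (S ⧸ p.asIdeal)) := by
  refine subsingleton_CH_succ_of_smul_eq_zero xs (fun x hx a => ?_) n
  obtain ⟨a, rfl⟩ := Submodule.Quotient.mk_surjective _ a
  refine (Submodule.Quotient.mk_eq_zero _).2 (Ideal.mul_mem_right _ _ ?_)
  rw [hp]
  exact hxs.mem x hx

lemma exists_mem_maximalIdeal_notMem (p : PrimeSpectrum S) (hp : p.asIdeal ≠ maximalIdeal S) :
    ∃ x ∈ maximalIdeal S, x ∉ p.asIdeal := by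
  by_contra! h
  exact hp (le_antisymm (le_maximalIdeal p.2.ne_top) h)

lemma IsParam.torsion (hxs : IsParam xs) {x : S} (hx : x ∈ maximalIdeal S) (n : ℕ) (M : Type u)
    [AddCommGroup M] [Module S M] (h : CH xs n M) : ∃ k : ℕ, x ^ k • h = 0 :=
  CH_torsion_of_mem_radical xs n x (hxs.le_radical hx) h

lemma nontrivial_CH_zero_closedPoint (hxs : IsParam xs) (p : PrimeSpectrum S)
    (hp : p.asIdeal = maximalIdeal S) : ¬ Subsingleton (CH xs 0 (S ⧸ p.asIdeal)) := by
  rw [subsingleton_CH_zero_iff]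
  intro h
  have h1 := h (Submodule.Quotient.mk 1) fun x hx => ⟨1, by
    rw [pow_one]
    refine (Submodule.Quotient.mk_eq_zero _).2 (Ideal.mul_mem_right _ _ ?_)
    rw [hp]
    exact hxs.mem x hx⟩
  exact p.2.ne_top ((Ideal.eq_top_iff_one _).2 ((Submodule.Quotient.mk_eq_zero _).1 h1))

lemma isArtinian_CH_closedPoint (hxs : IsParam xs) (n : ℕ) (p : PrimeSpectrum S)
    (hp : p.asIdeal = maximalIdeal S) : IsArtinian S (CH xs n (S ⧸ p.asIdeal)) := by
  cases n with
  | zero =>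
    have : p.asIdeal.IsMaximal := hp ▸ inferInstance
    have : IsSimpleModule S (S ⧸ p.asIdeal) :=
      isSimpleModule_iff_isCoatom.2 (Ideal.isMaximal_def.1 this)
    exact isArtinian_of_injective (CHzero xs _) (CHzero_injective xs)
  | succ n =>
    have := subsingleton_CH_succ_closedPoint hxs n p hp
    infer_instance

variable [IsNoetherianRing S]

/-- Grothendieck vanishing. -/
lemma subsingleton_CH_of_coheight_lt (hxs : IsParam xs) (n : ℕ) (M : Type u) [AddCommGroup M]
    [Module S M] [Module.Finite S M] (h : ∀ p ∈ Module.support S M, coheight p < (n : ℕ∞)) :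
    Subsingleton (CH xs n M) := by
  induction n generalizing M with
  | zero =>
    have : Subsingleton M := by
      rw [← Module.support_eq_empty_iff (R := S)]
      refine Set.eq_empty_of_forall_notMem fun p hp => ?_
      simpa using h p hp
    exact subsingleton_CH_of_subsingleton xs 0 M
  | succ n ih =>
    refine subsingleton_CH_of_support xs (n + 1) _ (fun p hp => ?_) M h
    by_cases hpm : p.asIdeal = maximalIdeal S
    · exact subsingleton_CH_succ_closedPoint hxs n p hpm
    · obtain ⟨x, hxm, hxp⟩ := exists_mem_maximalIdeal_notMem p hpm
      -- All primes containing `p + (x)` have smaller coheight than `p`, so by induction `x` acts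
      -- injectively on the cohomology of `S ⧸ p`, where every element is also killed by a power of
      -- `x`.
      have hs := isSES_quotient_prime p.asIdeal x hxp
      obtain ⟨δ, -, hδ⟩ := exists_CH_δ hs xs n
      have hsub := ih (S ⧸ (p.asIdeal ⊔ Ideal.span {x})) fun q hq => by
        rw [mem_support_quotient_iff] at hq
        have hpq : p < q := by
          refine lt_of_le_of_ne (le_sup_left.trans hq) ?_
          rintro rfl
          exact hxp (hq (Ideal.mem_sup_right (Ideal.mem_span_singleton_self x)))
        exact coheight_lt_of_lt hpq hp
      refine subsingleton_of_torsion_of_injective x (fun z hz => ?_)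
        (hxs.torsion hxm (n + 1) (S ⧸ p.asIdeal))
      rw [CHmap_smul_id] at hδ
      obtain ⟨w, rfl⟩ := (hδ z).1 hz
      rw [Subsingleton.elim w 0, map_zero]

/-- The Čech cohomology of finitely generated modules over a local ring is artinian. -/
lemma isArtinian_CH (hxs : IsParam xs) (n : ℕ) (M : Type u) [AddCommGroup M]
    [Module S M] [hM : Module.Finite S M] : IsArtinian S (CH xs n M) := by
  induction n generalizing M with
  | zero =>
    induction hM using IsNoetherianRing.induction_on_isQuotientEquivQuotientPrime S with
    | subsingleton N =>
      have := subsingleton_CH_of_subsingleton xs 0 N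
      infer_instance
    | quotient N p f =>
      suffices IsArtinian S (CH xs 0 (S ⧸ p.asIdeal)) from
        isArtinian_of_linearEquiv ((cechH xs 0).mapIso f.toModuleIso).toLinearEquiv.symm
      by_cases hpm : p.asIdeal = maximalIdeal S
      · exact isArtinian_CH_closedPoint hxs 0 p hpm
      · obtain ⟨x, hxm, hxp⟩ := exists_mem_maximalIdeal_notMem p hpm
        have hi := CHmap_zero_injective (isSES_quotient_prime p.asIdeal x hxp) xs
        rw [CHmap_smul_id] at hi
        have := subsingleton_of_torsion_of_injective x
          (fun z hz => hi (hz.trans (smul_zero (A := CH xs 0 (S ⧸ p.asIdeal)) x).symm))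
          (hxs.torsion hxm 0 (S ⧸ p.asIdeal))
        infer_instance
    | exact N₁ N₂ N₃ f g hf hg hfg h₁ h₃ =>
      exact isArtinian_of_range_eq_ker _ _
        (CHmap_exact ⟨hf, hfg, hg⟩ xs 0).linearMap_ker_eq.symm
  | succ n ih =>
    induction hM using IsNoetherianRing.induction_on_isQuotientEquivQuotientPrime S with
    | subsingleton N =>
      have := subsingleton_CH_of_subsingleton xs (n + 1) N
      infer_instance
    | quotient N p f =>
      suffices IsArtinian S (CH xs (n + 1) (S ⧸ p.asIdeal)) from
        isArtinian_of_linearEquiv ((cechH xs (n + 1)).mapIso f.toModuleIso).toLinearEquiv.symm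
      by_cases hpm : p.asIdeal = maximalIdeal S
      · exact isArtinian_CH_closedPoint hxs (n + 1) p hpm
      · obtain ⟨x, hxm, hxp⟩ := exists_mem_maximalIdeal_notMem p hpm
        obtain ⟨δ, -, hδ⟩ := exists_CH_δ (isSES_quotient_prime p.asIdeal x hxp) xs n
        rw [CHmap_smul_id] at hδ
        have := ih (S ⧸ (p.asIdeal ⊔ Ideal.span {x}))
        -- The kernel of `x` is the image of the connecting map from degree `n` of `S ⧸ (p + (x))`,
        -- which is artinian by induction.
        have : IsArtinian S (LinearMap.ker
            (x • LinearMap.id : CH xs (n + 1) (S ⧸ p.asIdeal) →ₗ[S] _)) := by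
          rw [hδ.linearMap_ker_eq]
          infer_instance
        exact isArtinian_of_torsion x (hxs.torsion hxm (n + 1) (S ⧸ p.asIdeal))
    | exact N₁ N₂ N₃ f g hf hg hfg h₁ h₃ =>
      exact isArtinian_of_range_eq_ker _ _
        (CHmap_exact ⟨hf, hfg, hg⟩ xs (n + 1)).linearMap_ker_eq.symm

/-- Grothendieck nonvanishing for cyclic modules `S ⧸ p`. -/
lemma nontrivial_CH_quotient_prime (hxs : IsParam xs) (e : ℕ) (p : PrimeSpectrum S)
    (hp : coheight p = (e : ℕ∞)) : ¬ Subsingleton (CH xs e (S ⧸ p.asIdeal)) := by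
  induction e generalizing p with
  | zero =>
    apply nontrivial_CH_zero_closedPoint hxs
    have h1 : IsMax p := coheight_eq_zero.1 (by simpa using hp)
    have h2 : p ≤ closedPoint S := le_maximalIdeal p.2.ne_top
    exact le_antisymm h2 (h1 h2)
  | succ e ih =>
    intro hzero
    -- vanishing above degree `e` for finite modules supported in `V(p)`
    have hvan : ∀ (M : Type u) [AddCommGroup M] [Module S M] [Module.Finite S M],
        (∀ q ∈ Module.support S M, p ≤ q) → Subsingleton (CH xs (e + 1) M) := by
      intro M _ _ _ hM
      refine subsingleton_CH_of_support xs (e + 1) {q | p ≤ q} (fun q hq => ?_) M hM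
      rcases eq_or_lt_of_le (show p ≤ q from hq) with rfl | hlt
      · exact hzero
      · refine subsingleton_CH_of_coheight_lt hxs _ _ fun q' hq' => ?_
        rw [mem_support_quotient_iff] at hq'
        have h1 : p < q' := lt_of_lt_of_le hlt hq'
        have := coheight_lt_of_lt (n := e + 1) h1 (by rw [hp]; exact_mod_cast Nat.lt_succ_self _)
        exact this
    -- The kernel of `S ⧸ p → S ⧸ q` is supported in `V(p)`, so `hvan` removes the obstruction in
    -- degree `e + 1`.
    have hsurj : ∀ q : PrimeSpectrum S, (h : p ≤ q) → Function.Surjective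
        (CHmap xs e (Submodule.factor (show p.asIdeal ≤ q.asIdeal from h))) := by
      intro q h
      refine CHmap_surjective_of_length xs (Submodule.factor_surjective _) e fun K hK => ?_
      refine hvan K fun q' hq' => ?_
      exact (mem_support_quotient_iff _ _).1
        (Module.support_subset_of_injective K.subtype K.injective_subtype hq')
    have hpm : p.asIdeal ≠ maximalIdeal S := by
      intro h
      have h1 : coheight p = 0 := by
        rw [coheight_eq_zero]
        intro q _
        change q.asIdeal ≤ p.asIdeal
        rw [h]
        exact le_maximalIdeal q.2.ne_top
      rw [h1] at hp
      exact absurd (by exact_mod_cast hp) (Nat.succ_ne_zero e).symm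
    -- For `e = 0` the zero module `H^0(S ⧸ p)` would map onto the nonzero `H^0` of the residue
    -- field. The argument for `e ≥ 1` needs a nonmaximal prime avoiding `f`.
    rcases Nat.eq_zero_or_pos e with rfl | he
    · obtain ⟨x, hxm, hxp⟩ := exists_mem_maximalIdeal_notMem p hpm
      have hi := CHmap_zero_injective (isSES_quotient_prime p.asIdeal x hxp) xs
      rw [CHmap_smul_id] at hi
      have := subsingleton_of_torsion_of_injective x
        (fun z hz => hi (hz.trans (smul_zero (A := CH xs 0 (S ⧸ p.asIdeal)) x).symm))
        (hxs.torsion hxm 0 (S ⧸ p.asIdeal))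
      exact nontrivial_CH_zero_closedPoint hxs (closedPoint S) rfl
        (hsurj (closedPoint S) (le_maximalIdeal p.2.ne_top)).subsingleton
    · -- minimal submodule of the form `f N` with `f ∉ p`
      have := isArtinian_CH hxs e (S ⧸ p.asIdeal)
      set N := CH xs e (S ⧸ p.asIdeal)
      obtain ⟨_, ⟨f, hf, rfl⟩, hmin⟩ := IsArtinian.set_has_minimal
        {W : Submodule S N | ∃ f ∉ p.asIdeal, W = LinearMap.range (f • LinearMap.id : N →ₗ[S] N)}
        ⟨_, 1, p.asIdeal.ne_top_iff_one.1 p.2.ne_top, rfl⟩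
      -- For `g ∈ q`, `g ∉ p`, minimality gives `f N = f g N`. Since `N` maps onto `H^e(S ⧸ q)`,
      -- which `g` kills, `f` kills it too. But `f` acts surjectively there because `H^e(S ⧸ (q +
      -- (f))) = 0`, so `H^e(S ⧸ q) = 0`, contrary to the induction hypothesis.
      obtain ⟨q, hpq, hq, hfq⟩ := exists_lt_coheight_eq_notMem p e he hp f hf
      obtain ⟨g, hgq, hgp⟩ : ∃ g ∈ q.asIdeal, g ∉ p.asIdeal := by
        by_contra! h
        exact absurd (show q ≤ p from h) (not_le_of_gt hpq)
      have hdec : ∀ n : N, ∃ n' : N, f • n = (f * g) • n' := by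
        intro n
        have h1 := hmin _ ⟨f * g, fun h => (p.2.mem_or_mem h).elim hf hgp, rfl⟩
        have h2 : LinearMap.range ((f * g) • LinearMap.id : N →ₗ[S] N) ≤
            LinearMap.range (f • LinearMap.id : N →ₗ[S] N) := by
          rintro _ ⟨m, rfl⟩
          exact ⟨g • m, by simp [mul_smul, smul_comm f g]⟩
        have h3 := eq_of_le_of_not_lt h2 h1
        obtain ⟨n', hn'⟩ : f • n ∈ LinearMap.range ((f * g) • LinearMap.id : N →ₗ[S] N) := by
          rw [h3]
          exact ⟨n, rfl⟩
        exact ⟨n', hn'.symm⟩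
      have hg0 : ∀ z : CH xs e (S ⧸ q.asIdeal), g • z = 0 := by
        have h1 : (g • LinearMap.id : (S ⧸ q.asIdeal) →ₗ[S] _) = (0 : S) • LinearMap.id := by
          ext
          simp only [zero_smul]
          exact (Submodule.Quotient.mk_eq_zero _).2 (Ideal.mul_mem_right _ _ hgq)
        have h2 := CHmap_smul_id (A := S ⧸ q.asIdeal) xs e g
        rw [h1, CHmap_smul_id, zero_smul] at h2
        exact fun z => (LinearMap.congr_fun h2 z).symm
      have hf0 : ∀ z : CH xs e (S ⧸ q.asIdeal), f • z = 0 := by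
        intro z
        obtain ⟨n, rfl⟩ := hsurj q hpq.le z
        obtain ⟨n', hn'⟩ := hdec n
        rw [← map_smul, hn', mul_comm, mul_smul, map_smul, hg0]
      apply ih q hq
      have hex := CHmap_exact (isSES_quotient_prime q.asIdeal f hfq) xs e
      rw [CHmap_smul_id] at hex
      have hsub := subsingleton_CH_of_coheight_lt hxs e (S ⧸ (q.asIdeal ⊔ Ideal.span {f}))
        fun q' hq' => by
          rw [mem_support_quotient_iff] at hq'
          have hlt : q < q' := by
            refine lt_of_le_of_ne (le_sup_left.trans hq') ?_
            rintro rfl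
            exact hfq (hq' (Ideal.mem_sup_right (Ideal.mem_span_singleton_self f)))
          refine coheight_lt_of_lt hlt ?_
          rw [hq]
          exact_mod_cast Nat.lt_succ_self _
      have hz : ∀ z : CH xs e (S ⧸ q.asIdeal), z = 0 := by
        intro z
        obtain ⟨w, hw⟩ := (hex z).1 (Subsingleton.elim _ _)
        rw [← hw]
        exact hf0 w
      exact ⟨fun a b => (hz a).trans (hz b).symm⟩

/-- Grothendieck nonvanishing. -/
lemma nontrivial_CH_self (hxs : IsParam xs)
    (h : (maximalIdeal S).height = (xs.length : ℕ∞)) : ¬ Subsingleton (CH xs xs.length S) := by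
  intro hsub
  obtain ⟨l, hl, hlen⟩ := Ideal.exists_ltSeries_length_eq_height (maximalIdeal S)
  have hle : ((xs.length : ℕ) : ℕ∞) ≤ coheight l.head := by
    rw [← h, ← hlen]
    exact length_le_coheight_head
  have hfin : coheight l.head < ⊤ := coheight_lt_top _
  obtain ⟨c, hc⟩ := ENat.ne_top_iff_exists.1 hfin.ne
  have hnt := nontrivial_CH_quotient_prime hxs c l.head hc.symm
  rw [← hc] at hle
  have hle' : xs.length ≤ c := ENat.natCast_le_natCast.1 hle
  -- If equal, the top cohomology of `S` maps onto the nonzero one of the quotient by `l.head`. If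
  -- strict, nonvanishing in degree `c` contradicts the length of the Čech complex.
  rcases hle'.eq_or_lt with heq | hlt
  · subst heq
    refine hnt (CHmap_surjective_of_length xs (A := S) (f := Submodule.mkQ _)
      (Submodule.mkQ_surjective _) _ fun K _ => ?_).subsingleton
    exact subsingleton_CH_of_length_lt xs _ (Nat.lt_succ_self _)
  · exact hnt (subsingleton_CH_of_length_lt xs _ hlt)

end Nonvanishing

/-! ### Localizing the base ring -/

section Semilinear

variable {R S : Type u} [CommRing R] [CommRing S] (f : R →+* S)

lemma exists_away_semilinear (x : R) {M N : Type u} [AddCommGroup M] [Module R M]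
    [AddCommGroup N] [Module S N] (g : M →ₛₗ[f] N) :
    ∃ G : Away x M →ₛₗ[f] Away (f x) N, ∀ m, G (awayMk x M m) = awayMk (f x) N (g m) := by
  let _ : Module R (Away (f x) N) := Module.compHom _ f
  let g' : M →ₗ[R] Away (f x) N :=
    { toFun := fun m => awayMk (f x) N (g m)
      map_add' := fun a b => by simp
      map_smul' := fun r a => by
        rw [LinearMap.map_smulₛₗ, map_smul]
        rfl }
  have hunit : ∀ s : Submonoid.powers x, IsUnit (algebraMap R (Module.End R (Away (f x) N)) s) := by
    rintro ⟨_, k, rfl⟩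
    rw [Module.End.isUnit_iff]
    have := away_pow_smul_bijective (M := N) (f x) k
    rw [← map_pow] at this
    exact this
  let G := IsLocalizedModule.lift (Submonoid.powers x) (awayMk x M) g' hunit
  refine ⟨{ toFun := G, map_add' := fun a b => map_add G a b, map_smul' := fun r a => map_smul G r a },
    fun m => ?_⟩
  exact IsLocalizedModule.lift_apply (Submonoid.powers x) (awayMk x M) g' hunit m

lemma away_semilinear_awayMap (x : R) {M N M' N' : Type u} [AddCommGroup M] [Module R M]
    [AddCommGroup N] [Module S N] [AddCommGroup M'] [Module R M']
    [AddCommGroup N'] [Module S N'] {g : M →ₛₗ[f] N} {g' : M' →ₛₗ[f] N'}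
    {G : Away x M →ₛₗ[f] Away (f x) N} {G' : Away x M' →ₛₗ[f] Away (f x) N'}
    (hG : ∀ m, G (awayMk x M m) = awayMk (f x) N (g m))
    (hG' : ∀ m, G' (awayMk x M' m) = awayMk (f x) N' (g' m)) {a : M →ₗ[R] M'} {b : N →ₗ[S] N'}
    (hab : ∀ m, b (g m) = g' (a m)) (z : Away x M) :
    awayMap (f x) b (G z) = G' (awayMap x a z) := by
  obtain ⟨k, m, hm⟩ := awayMk_surj x z
  apply away_pow_smul_cancel (f x) k
  rw [← map_pow, ← map_smul, ← LinearMap.map_smulₛₗ, ← LinearMap.map_smulₛₗ, ← map_smul, hm, hG,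
    awayMap_mk, awayMap_mk, hG', hab]

/-- A semilinear map of cochain complexes. -/
structure SemiMor (K : CochainComplex (ModuleCat.{u} R) ℕ)
    (L : CochainComplex (ModuleCat.{u} S) ℕ) where
  φ : ∀ n, K.X n →ₛₗ[f] L.X n
  comm : ∀ n z, (L.d n (n + 1)).hom (φ n z) = φ (n + 1) ((K.d n (n + 1)).hom z)

/-- A semilinear map whose image is everything up to denominators in `W`. -/
def IsDense (W : Submonoid R) {M N : Type u} [AddCommGroup M] [Module R M]
    [AddCommGroup N] [Module S N] (g : M →ₛₗ[f] N) : Prop :=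
  ∀ b : N, ∃ s ∈ W, ∃ a : M, f s • b = g a

variable {f}

lemma IsDense.away {W : Submonoid R} {M N : Type u} [AddCommGroup M] [Module R M]
    [AddCommGroup N] [Module S N] {g : M →ₛₗ[f] N} (hg : IsDense f W g) {x : R}
    {G : Away x M →ₛₗ[f] Away (f x) N}
    (hG : ∀ m, G (awayMk x M m) = awayMk (f x) N (g m)) : IsDense f W G := by
  intro z
  obtain ⟨k, b, hb⟩ := awayMk_surj (f x) z
  obtain ⟨s, hs, a, ha⟩ := hg b
  obtain ⟨c, hc⟩ : ∃ c, x ^ k • c = awayMk x M a := (away_pow_smul_bijective x k).2 _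
  refine ⟨s, hs, c, ?_⟩
  apply away_pow_smul_cancel (f x) k
  rw [smul_comm, hb, ← map_smul, ha, ← hG, ← hc, LinearMap.map_smulₛₗ, map_pow]

lemma SemiMor.exists_fibObj (W : Submonoid R) (x : R) {K : CochainComplex (ModuleCat.{u} R) ℕ}
    {L : CochainComplex (ModuleCat.{u} S) ℕ} (φ : SemiMor f K L) (hφ : ∀ n, IsDense f W (φ.φ n)) :
    ∃ ψ : SemiMor f (fibObj x K) (fibObj (f x) L), ∀ n, IsDense f W (ψ.φ n) := by
  choose G hG using fun n => exists_away_semilinear f x (φ.φ n)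
  let ψ : ∀ n, (fibObj x K).X n →ₛₗ[f] (fibObj (f x) L).X n := fun n => match n with
    | 0 => φ.φ 0
    | n + 1 =>
      { toFun := fun z => ((φ.φ (n + 1) z.1, G n z.2) : L.X (n + 1) × Away (f x) (L.X n))
        map_add' := fun a b => Prod.ext (map_add _ _ _) (map_add _ _ _)
        map_smul' := fun r a => Prod.ext (LinearMap.map_smulₛₗ _ _ _) (LinearMap.map_smulₛₗ _ _ _) }
  refine ⟨⟨ψ, fun n z => ?_⟩, fun n b => ?_⟩
  · cases n with
    | zero =>
      change K.X 0 at z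
      change ((fibObj (f x) L).d 0 1).hom (φ.φ 0 z) = ψ 1 (((fibObj x K).d 0 1).hom z)
      rw [fibObj_d_zero, fibObj_d_zero]
      exact Prod.ext (φ.comm 0 z) (hG 0 z).symm
    | succ n =>
      obtain ⟨a, b⟩ := z
      change ((fibObj (f x) L).d (n + 1) (n + 2)).hom (φ.φ (n + 1) a, G n b) =
        ψ (n + 2) (((fibObj x K).d (n + 1) (n + 2)).hom (a, b))
      rw [fibObj_d_succ, fibObj_d_succ]
      refine Prod.ext (φ.comm (n + 1) a) ?_
      change awayMk (f x) _ (φ.φ (n + 1) a) - awayMap (f x) (L.d n (n + 1)).hom (G n b) =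
        G (n + 1) (awayMk x _ a - awayMap x (K.d n (n + 1)).hom b)
      rw [map_sub, hG, away_semilinear_awayMap f x (hG n) (hG (n + 1)) (φ.comm n)]
  · cases n with
    | zero => exact hφ 0 b
    | succ n =>
      obtain ⟨b, c⟩ := b
      obtain ⟨s, hs, a, ha⟩ := hφ (n + 1) b
      obtain ⟨s', hs', a', ha'⟩ := (hφ n).away (hG n) c
      refine ⟨s' * s, W.mul_mem hs' hs, (s' • a, s • a'), ?_⟩
      refine Prod.ext ?_ ?_
      · change f (s' * s) • b = φ.φ (n + 1) (s' • a)
        rw [LinearMap.map_smulₛₗ, ← ha, map_mul, mul_smul]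
      · change f (s' * s) • c = G n (s • a')
        rw [LinearMap.map_smulₛₗ, ← ha', mul_comm, map_mul, mul_smul]

/-- Density replaces an isomorphism between the localized complex and the complex over `S`: only
surjectivity of the last differential has to be transferred. -/
lemma exists_semiMor_cech (W : Submonoid R) (xs : List R) (M N : Type u) [AddCommGroup M]
    [Module R M] [AddCommGroup N] [Module S N] (g : M →ₛₗ[f] N) (hg : IsDense f W g) :
    ∃ φ : SemiMor f ((cech xs).obj (ModuleCat.of R M)) ((cech (xs.map f)).obj (ModuleCat.of S N)),
      ∀ n, IsDense f W (φ.φ n) := by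
  induction xs with
  | nil =>
    have hR : ∀ n, Subsingleton (((cech ([] : List R)).obj (ModuleCat.of R M)).X (n + 1)) :=
      fun n => subsingleton_cech [] _ _ (by simp)
    have hS : ∀ n, Subsingleton (((cech ([] : List S)).obj (ModuleCat.of S N)).X (n + 1)) :=
      fun n => subsingleton_cech [] _ _ (by simp)
    let eM := (cechZero (ModuleCat.of R M) []).toLinearEquiv
    let eN := (cechZero (ModuleCat.of S N) []).toLinearEquiv
    refine ⟨⟨fun n => match n with
      | 0 => (eN.symm.toLinearMap.comp g).comp eM.toLinearMap
      | n + 1 => 0, fun n z => (hS n).elim _ _⟩, fun n b => ?_⟩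
    cases n with
    | zero =>
      obtain ⟨s, hs, a, ha⟩ := hg (eN b)
      refine ⟨s, hs, eM.symm a, eN.injective ?_⟩
      change eN (f s • b) = eN (eN.symm (g (eM (eM.symm a))))
      rw [map_smul, ha, eN.apply_symm_apply, eM.apply_symm_apply]
    | succ n => exact ⟨1, W.one_mem, 0, (hS n).elim _ _⟩
  | cons x xs ih =>
    obtain ⟨φ, hφ⟩ := ih
    exact φ.exists_fibObj W x hφ

/-- Vanishing of the top Čech cohomology passes to localizations. -/
lemma subsingleton_CH_localization (W : Submonoid R) [Algebra R S] [IsLocalization W S]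
    (xs : List R) (n : ℕ) (hn : xs.length = n + 1) (h : Subsingleton (CH xs (n + 1) R)) :
    Subsingleton (CH (xs.map (algebraMap R S)) (n + 1) S) := by
  let g : R →ₛₗ[algebraMap R S] S :=
    { toFun := algebraMap R S
      map_add' := map_add _
      map_smul' := map_mul _ }
  obtain ⟨φ, hφ⟩ := exists_semiMor_cech W xs R S g fun b => by
    obtain ⟨⟨a, s⟩, h⟩ := IsLocalization.surj W b
    exact ⟨s, s.2, a, by rw [smul_eq_mul, mul_comm]; exact h⟩
  rw [← isZero_CH_iff] at h ⊢
  refine (isZero_homology_succ_iff _ n).2 fun b _ => ?_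
  have h1 := (isZero_homology_succ_iff ((cech xs).obj (ModuleCat.of R R)) n).1 h
  obtain ⟨s, hs, a, ha⟩ := hφ (n + 1) b
  -- The list has `n + 1` elements, so the term in degree `n + 2` is zero and every `a` is a cycle,
  -- hence a boundary.
  have := subsingleton_cech xs (ModuleCat.of R R) (n + 2) (by omega)
  obtain ⟨a', rfl⟩ := h1 a (Subsingleton.elim _ _)
  obtain ⟨u, hu⟩ := IsLocalization.map_units S (⟨s, hs⟩ : W)
  refine ⟨((u⁻¹ : Sˣ) : S) • φ.φ n a', ?_⟩
  refine (map_smul (((cech (xs.map (algebraMap R S))).obj (ModuleCat.of S S)).d n (n + 1)).hom _ _).trans ?_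
  rw [φ.comm n a']
  change ((u⁻¹ : Sˣ) : S) • φ.φ (n + 1) (((cech xs).obj (ModuleCat.of R R)).d n (n + 1) a') = b
  rw [← ha]
  change ((u⁻¹ : Sˣ) : S) • (algebraMap R S ((⟨s, hs⟩ : W) : R)) • b = b
  rw [← hu, smul_smul, Units.inv_mul, one_smul]

end Semilinear

/-! ### Nonvanishing from the height -/

section HeightNonvanishing

variable {R : Type u} [CommRing R] [IsNoetherianRing R]

/-- Localizing at a minimal prime of height `n + 1` makes the `n + 1` elements a system of
parameters, where Grothendieck nonvanishing applies. -/
lemma nontrivial_CH_of_height (xs : List R) (n : ℕ) (hn : xs.length = n + 1)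
    (h : (Ideal.span {x | x ∈ xs}).height = ((n + 1 : ℕ) : ℕ∞)) :
    ¬ Subsingleton (CH xs (n + 1) R) := by
  intro hsub
  obtain ⟨m, hm, hmin, hmh⟩ : ∃ m : Ideal R, ∃ _ : m.IsPrime,
      m ∈ (Ideal.span {x | x ∈ xs}).minimalPrimes ∧ m.height = ((n + 1 : ℕ) : ℕ∞) := by
    obtain ⟨p, hp, hle, hph⟩ := Ideal.exists_isPrime_height_eq h
    exact ⟨p, hp, Ideal.mem_minimalPrimes_of_height_le hle (hph.trans h.symm).le, hph⟩
  let S := Localization.AtPrime m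
  have hS := subsingleton_CH_localization (S := S) m.primeCompl xs n hn hsub
  have hlen : (xs.map (algebraMap R S)).length = n + 1 := by simpa using hn
  have hspan : Ideal.span {x | x ∈ xs.map (algebraMap R S)} =
      (Ideal.span {x | x ∈ xs}).map (algebraMap R S) := by
    rw [Ideal.map_span]
    congr 1
    ext y
    simp
  have hparam : IsParam (xs.map (algebraMap R S)) := by
    constructor
    · intro y hy
      obtain ⟨x, hx, rfl⟩ := List.mem_map.1 hy
      exact (IsLocalization.AtPrime.to_map_mem_maximal_iff S m x).2 (hmin.1.2 (Ideal.subset_span hx))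
    · rw [hspan, IsLocalization.AtPrime.radical_map_of_mem_minimalPrimes S m _ hmin,
        IsLocalization.AtPrime.map_eq_maximalIdeal m S]
  refine nontrivial_CH_self hparam ?_ (hlen ▸ hS)
  rw [hlen, ← hmh, ← WithBot.coe_inj, IsLocalRing.maximalIdeal_height_eq_ringKrullDim,
    IsLocalization.AtPrime.ringKrullDim_eq_height m S]

end HeightNonvanishing

/-! ### Dimension shifting -/

section DimensionShift

variable {R : Type u} [CommRing R] {A B C : Type u} [AddCommGroup A] [AddCommGroup B]
  [AddCommGroup C] [Module R A] [Module R B] [Module R C]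

lemma subsingleton_CH_succ_iff {f : A →ₗ[R] B} {g : B →ₗ[R] C} (h : IsSES f g) (xs : List R)
    (n : ℕ) (hB : Subsingleton (CH xs n B)) (hB' : Subsingleton (CH xs (n + 1) B)) :
    Subsingleton (CH xs (n + 1) A) ↔ Subsingleton (CH xs n C) := by
  obtain ⟨δ, h1, h2⟩ := exists_CH_δ h xs n
  constructor
  · intro hA
    refine subsingleton_of_forall_eq 0 fun c => ?_
    obtain ⟨b, rfl⟩ := (h1 c).1 (Subsingleton.elim _ _)
    rw [Subsingleton.elim b 0, map_zero]
  · intro hC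
    refine subsingleton_of_forall_eq 0 fun a => ?_
    obtain ⟨c, rfl⟩ := (h2 a).1 (Subsingleton.elim _ _)
    rw [Subsingleton.elim c 0, map_zero]

/-- If `H^1(B) = 0`, then `H^1(A)` is the cokernel of the map between the torsion parts of `B` and
`C`. -/
lemma subsingleton_CH_one_iff {f : A →ₗ[R] B} {g : B →ₗ[R] C} (h : IsSES f g) (xs : List R)
    (hB : Subsingleton (CH xs 1 B)) : Subsingleton (CH xs 1 A) ↔
      ∀ c : C, (∀ x ∈ xs, ∃ k : ℕ, x ^ k • c = 0) →
        ∃ b : B, (∀ x ∈ xs, ∃ k : ℕ, x ^ k • b = 0) ∧ g b = c := by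
  obtain ⟨δ, h1, h2⟩ := exists_CH_δ h xs 0
  simp only [← mem_range_CHzero]
  constructor
  · rintro hA _ ⟨c, rfl⟩
    obtain ⟨b, rfl⟩ := (h1 c).1 (Subsingleton.elim _ _)
    exact ⟨_, ⟨b, rfl⟩, (CHzero_naturality xs g b).symm⟩
  · intro hs
    refine subsingleton_of_forall_eq 0 fun a => ?_
    obtain ⟨c, rfl⟩ := (h2 a).1 (Subsingleton.elim _ _)
    obtain ⟨_, ⟨b, rfl⟩, hb⟩ := hs _ ⟨c, rfl⟩
    rw [← CHzero_naturality] at hb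
    rw [← CHzero_injective xs hb]
    exact h1.apply_apply_eq_zero b

end DimensionShift

/-! ### Acyclicity of injective modules -/

section Injective

variable {R : Type u} [CommRing R]

/-- The map `R m → E`, `m ↦ e`, is well defined and extends to `M` by injectivity. -/
lemma exists_hom_of_annihilator_le {E M : Type u} [AddCommGroup E] [Module R E] [AddCommGroup M]
    [Module R M] [hE : Module.Injective R E] (m : M) (e : E) (h : ∀ r : R, r • m = 0 → r • e = 0) :
    ∃ g : M →ₗ[R] E, g m = e := by
  let f := LinearMap.toSpanSingleton R M m
  have hle : LinearMap.ker f ≤ LinearMap.ker (LinearMap.toSpanSingleton R E e) := fun r hr => h r hr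
  obtain ⟨g, hg⟩ := hE.out ((LinearMap.ker f).liftQ f le_rfl)
    (LinearMap.ker_eq_bot.1 (Submodule.ker_liftQ_eq_bot _ _ _ le_rfl))
    ((LinearMap.ker f).liftQ (LinearMap.toSpanSingleton R E e) hle)
  refine ⟨g, ?_⟩
  exact (congrArg g (one_smul R m).symm).trans
    ((hg (Submodule.Quotient.mk 1)).trans (one_smul R e))

variable [IsNoetherianRing R]

/-- The annihilators of `x ^ k` in `R ⧸ I` stabilize, so for large `k` the assignment `x ^ (k + 1) ↦
x ^ k • z` is well defined on a submodule of `R ⧸ I`. It extends to `R ⧸ I`, and `w` is the image of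
`1`. -/
lemma exists_smul_eq_pow_succ_smul {E : Type u} [AddCommGroup E] [Module R E]
    [Module.Injective R E] (I : Ideal R) (x : R) (z : E) (hz : ∀ a ∈ I, a • z = 0) :
    ∃ (k : ℕ) (w : E), (∀ a ∈ I, a • w = 0) ∧ x ^ k • z = x ^ (k + 1) • w := by
  let c : ℕ →o Ideal R :=
    { toFun := fun k => LinearMap.ker (x ^ k • LinearMap.toSpanSingleton R (R ⧸ I) 1)
      monotone' := by
        refine monotone_nat_of_le_succ fun k a ha => ?_
        simp only [LinearMap.mem_ker, LinearMap.smul_apply] at ha ⊢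
        rw [pow_succ', mul_smul, ha, smul_zero] }
  obtain ⟨k, hk⟩ := monotone_stabilizes_iff_noetherian.2 ‹IsNoetherianRing R› c
  have hmk : ∀ (j : ℕ) (a : R), a • x ^ j • (1 : R ⧸ I) = 0 ↔ a ∈ c j := by
    intro j a
    change _ ↔ x ^ j • a • (1 : R ⧸ I) = 0
    rw [smul_comm]
  obtain ⟨g, hg⟩ := exists_hom_of_annihilator_le (x ^ (k + 1) • (1 : R ⧸ I)) (x ^ k • z)
    fun r hr => by
      rw [hmk, ← hk (k + 1) k.le_succ, ← hmk, smul_smul] at hr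
      rw [smul_smul]
      refine hz _ ?_
      rwa [Algebra.smul_def, mul_one, Ideal.Quotient.algebraMap_eq,
        Ideal.Quotient.eq_zero_iff_mem] at hr
  refine ⟨k, g 1, fun a ha => ?_, ?_⟩
  · rw [← map_smul, Algebra.smul_def, mul_one, Ideal.Quotient.algebraMap_eq,
      Ideal.Quotient.eq_zero_iff_mem.2 ha, map_zero]
  · rw [← hg, map_smul]

lemma forall_pow_smul_eq_zero_iff {M : Type u} [AddCommGroup M] [Module R M] (xs : List R) (m : M) :
    (∀ x ∈ xs, ∃ k : ℕ, x ^ k • m = 0) ↔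
      ∃ k : ℕ, ∀ a ∈ Ideal.span {x | x ∈ xs} ^ k, a • m = 0 := by
  constructor
  · intro h
    have h1 : Ideal.span {x | x ∈ xs} ≤
        Ideal.radical (LinearMap.ker (LinearMap.toSpanSingleton R M m)) := by
      rw [Ideal.span_le]
      intro x hx
      obtain ⟨k, hk⟩ := h x hx
      exact ⟨k, hk⟩
    obtain ⟨k, hk⟩ := Ideal.exists_pow_le_of_le_radical_of_fg h1 (IsNoetherian.noetherian _)
    exact ⟨k, fun a ha => hk ha⟩
  · rintro ⟨k, hk⟩ x hx
    exact ⟨k, hk _ (Ideal.pow_mem_pow (Ideal.subset_span (s := {x | x ∈ xs}) hx) k)⟩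

lemma mem_torsionSubmodule_span {M : Type u} [AddCommGroup M] [Module R M] (xs : List R) (m : M) :
    m ∈ torsionSubmodule (PrimeSpectrum.zeroLocus (Ideal.span {x : R | x ∈ xs} : Set R)) M ↔
      ∀ x ∈ xs, ∃ k : ℕ, x ^ k • m = 0 := by
  rw [mem_torsionSubmodule_zeroLocus, forall_pow_smul_eq_zero_iff]

/-- Injective modules have no higher Čech cohomology. -/
lemma subsingleton_CH_injective (xs : List R) (E : Type u) [AddCommGroup E] [Module R E]
    [Module.Injective R E] (n : ℕ) : Subsingleton (CH xs (n + 1) E) := by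
  rw [← isZero_CH_iff]
  induction xs generalizing n with
  | nil => exact isZero_cech_homology_of_length_lt [] _ _ (by simp)
  | cons x xs ih =>
    -- Zero-cycles are the torsion elements of `E`; each is killed by one power of the ideal of
    -- `xs`, which serves as the ideal `I` in `exists_smul_eq_pow_succ_smul`.
    refine fibObj_exact_succ x (K := (cech xs).obj (ModuleCat.of R E)) ih (fun z hz => ?_) n
    have hb : Function.Bijective (cechZero (ModuleCat.of R E) xs).hom :=
      ConcreteCategory.bijective_of_isIso (cechZero (ModuleCat.of R E) xs).hom
    have h1 := (cech_d_zero_eq_zero_iff xs (ModuleCat.of R E) z).1 hz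
    obtain ⟨N, hN⟩ := (forall_pow_smul_eq_zero_iff xs ((cechZero (ModuleCat.of R E) xs).hom z)).1 h1
    obtain ⟨k, w, hw, hzw⟩ := exists_smul_eq_pow_succ_smul (E := E) _ x _ hN
    obtain ⟨w, rfl⟩ := hb.2 w
    refine ⟨k, w, (cech_d_zero_eq_zero_iff xs (ModuleCat.of R E) w).2
      ((forall_pow_smul_eq_zero_iff xs _).2 ⟨N, hw⟩), hb.1 ?_⟩
    exact (map_smul (cechZero (ModuleCat.of R E) xs).hom.hom _ _).trans
      (hzw.trans (map_smul (cechZero (ModuleCat.of R E) xs).hom.hom _ _).symm)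

end Injective

/-! ### Čech cohomology and local cohomology -/

section Comparison

variable {R : Type u} [CommRing R]

lemma isZero_localCohomology_succ_iff (Φ : Set (PrimeSpectrum R)) {M : ModuleCat.{u} R}
    (I : InjectiveResolution M) (n : ℕ) :
    Limits.IsZero ((localCohomology Φ (n + 1)).obj M) ↔
      ∀ z ∈ torsionSubmodule Φ (I.cocomplex.X (n + 1)), I.cocomplex.d (n + 1) (n + 2) z = 0 →
        ∃ y ∈ torsionSubmodule Φ (I.cocomplex.X n), I.cocomplex.d n (n + 1) y = z := by
  have e := I.isoRightDerivedObj (torsionFunctor Φ) (n + 1)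
  refine (e.isZero_iff.trans (isZero_homology_succ_iff _ n)).trans ?_
  constructor
  · intro h z hz hdz
    obtain ⟨y, hy⟩ := h (⟨z, hz⟩ : torsionSubmodule Φ (I.cocomplex.X (n + 1))) (Subtype.ext hdz)
    exact ⟨y.1, y.2, congrArg Subtype.val hy⟩
  · rintro h ⟨z, hz⟩ hdz
    obtain ⟨y, hy, h2⟩ := h z hz (congrArg Subtype.val hdz)
    exact ⟨(⟨y, hy⟩ : torsionSubmodule Φ (I.cocomplex.X n)), Subtype.ext h2⟩

variable {M : ModuleCat.{u} R} (I : InjectiveResolution M)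

lemma injectiveResolution_exact (n : ℕ) (z : I.cocomplex.X (n + 1))
    (hz : I.cocomplex.d (n + 1) (n + 2) z = 0) : ∃ y, I.cocomplex.d n (n + 1) y = z :=
  (isZero_homology_succ_iff I.cocomplex n).1
    ((HomologicalComplex.exactAt_iff_isZero_homology _ _).1 (I.cocomplex_exactAt_succ n)) z hz

/-- The syzygies of an injective resolution. -/
abbrev cosyzygy (n : ℕ) : Submodule R (I.cocomplex.X n) :=
  LinearMap.ker (I.cocomplex.d n (n + 1)).hom

/-- The map from a term of an injective resolution to the next syzygy. -/
noncomputable def toCosyzygy (n : ℕ) : I.cocomplex.X n →ₗ[R] cosyzygy I (n + 1) :=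
  (I.cocomplex.d n (n + 1)).hom.codRestrict _ fun z => d_d_apply I.cocomplex n (n + 1) (n + 2) z

lemma isSES_cosyzygy (n : ℕ) : IsSES (cosyzygy I n).subtype (toCosyzygy I n) where
  inj := Subtype.val_injective
  exact := by
    rw [LinearMap.exact_iff, Submodule.range_subtype]
    exact LinearMap.ker_codRestrict _ _ _
  surj := by
    rintro ⟨z, hz⟩
    obtain ⟨y, hy⟩ := injectiveResolution_exact I n z hz
    exact ⟨y, Subtype.ext hy⟩

/-- The augmentation of an injective resolution identifies the module with the zeroth syzygy. -/
lemma exists_equiv_cosyzygy_zero : Nonempty (M ≃ₗ[R] cosyzygy I 0) := by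
  have h := I.exact₀
  have hinj : Function.Injective (I.ι.f 0).hom := (ModuleCat.mono_iff_injective _).1 inferInstance
  have hex : Function.Exact (I.ι.f 0).hom (I.cocomplex.d 0 1).hom :=
    (ShortComplex.ShortExact.moduleCat_exact_iff_function_exact _).1 h
  refine ⟨((HomologicalComplex.singleObjXSelf (ComplexShape.up ℕ) 0 M).symm.toLinearEquiv).trans
    ((LinearEquiv.ofInjective _ hinj).trans (LinearEquiv.ofEq _ _ ?_))⟩
  exact (LinearMap.exact_iff.1 hex).symm

variable [IsNoetherianRing R]

instance (n : ℕ) : Module.Injective R (I.cocomplex.X n) :=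
  (Module.injective_iff_injective_object R _).2 (I.injective n)

/-- Injective modules are acyclic for `CH`, so the degree can be shifted down to one along the
cosyzygies. -/
lemma subsingleton_CH_cosyzygy (xs : List R) (n : ℕ) :
    Subsingleton (CH xs (n + 1) M) ↔ Subsingleton (CH xs 1 (cosyzygy I n)) := by
  suffices ∀ k n, Subsingleton (CH xs (n + 1) (cosyzygy I k)) ↔
      Subsingleton (CH xs 1 (cosyzygy I (k + n))) by
    obtain ⟨e⟩ := exists_equiv_cosyzygy_zero I
    rw [subsingleton_CH_congr xs (n + 1) e, this 0 n, zero_add]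
  intro k n
  induction n generalizing k with
  | zero => rfl
  | succ n ih =>
    rw [subsingleton_CH_succ_iff (isSES_cosyzygy I k) xs (n + 1)
      (subsingleton_CH_injective xs _ n) (subsingleton_CH_injective xs _ (n + 1)), ih (k + 1),
      Nat.add_right_comm k 1 n, add_assoc]

/-- Čech cohomology vanishes together with local cohomology. -/
lemma isZero_localCohomology_iff (xs : List R) (M : ModuleCat.{u} R) (n : ℕ) :
    Limits.IsZero ((localCohomology (PrimeSpectrum.zeroLocus (Ideal.span {x : R | x ∈ xs} : Set R))
      (n + 1)).obj M) ↔ Subsingleton (CH xs (n + 1) M) := by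
  have I := injectiveResolution M
  -- Both sides now say that torsion elements of the next cosyzygy lift to torsion elements of the
  -- `n`-th injective.
  rw [isZero_localCohomology_succ_iff _ I, subsingleton_CH_cosyzygy I,
    subsingleton_CH_one_iff (isSES_cosyzygy I n) xs (subsingleton_CH_injective xs _ 0)]
  simp only [mem_torsionSubmodule_span]
  constructor
  · rintro h ⟨z, hz⟩ ht
    obtain ⟨y, hy, hyz⟩ := h z (fun x hx => (ht x hx).imp fun k hk => congrArg Subtype.val hk) hz
    exact ⟨y, hy, Subtype.ext hyz⟩
  · intro h z ht hz
    obtain ⟨y, hy, hyz⟩ := h ⟨z, hz⟩ fun x hx => (ht x hx).imp fun k hk => Subtype.ext hk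
    exact ⟨y, hy, congrArg Subtype.val hyz⟩

end Comparison

/-! ### Mayer–Vietoris and the cohomological dimension -/

section MayerVietoris

variable {R : Type u} [CommRing R]

lemma torsionSubmodule_mono {Φ Ψ : Set (PrimeSpectrum R)} (h : Φ ⊆ Ψ) (M : Type u) [AddCommGroup M]
    [Module R M] : torsionSubmodule Φ M ≤ torsionSubmodule Ψ M :=
  fun _ hx => hx.trans h

lemma torsionSubmodule_le_inf_left (I J : Ideal R) (M : Type u) [AddCommGroup M] [Module R M] :
    torsionSubmodule (PrimeSpectrum.zeroLocus (I : Set R)) M ≤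
      torsionSubmodule (PrimeSpectrum.zeroLocus ((I ⊓ J : Ideal R) : Set R)) M :=
  torsionSubmodule_mono (PrimeSpectrum.zeroLocus_anti_mono_ideal inf_le_left) M

lemma torsionSubmodule_le_inf_right (I J : Ideal R) (M : Type u) [AddCommGroup M] [Module R M] :
    torsionSubmodule (PrimeSpectrum.zeroLocus (J : Set R)) M ≤
      torsionSubmodule (PrimeSpectrum.zeroLocus ((I ⊓ J : Ideal R) : Set R)) M :=
  torsionSubmodule_mono (PrimeSpectrum.zeroLocus_anti_mono_ideal inf_le_right) M

lemma mem_torsionSubmodule_sup (I J : Ideal R) {M : Type u} [AddCommGroup M] [Module R M] {m : M} :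
    m ∈ torsionSubmodule (PrimeSpectrum.zeroLocus ((I ⊔ J : Ideal R) : Set R)) M ↔
      m ∈ torsionSubmodule (PrimeSpectrum.zeroLocus (I : Set R)) M ∧
        m ∈ torsionSubmodule (PrimeSpectrum.zeroLocus (J : Set R)) M := by
  simp only [mem_torsionSubmodule, PrimeSpectrum.zeroLocus_sup, Set.subset_inter_iff]

lemma span_append (xs ys : List R) : Ideal.span {x : R | x ∈ xs ++ ys} =
    Ideal.span {x : R | x ∈ xs} ⊔ Ideal.span {x : R | x ∈ ys} := by
  rw [← Ideal.span_union]
  congr 1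
  ext x
  simp

variable [IsNoetherianRing R]

/-- Artin–Rees places `I ^ (k + c) ∩ J ^ k` inside `I ^ k * J ^ k`. -/
lemma exists_pow_inf_pow_le (I J : Ideal R) (k : ℕ) : ∃ l, I ^ l ⊓ J ^ k ≤ (I ⊓ J) ^ k := by
  obtain ⟨c, hc⟩ := Ideal.exists_pow_inf_eq_pow_smul (M := R) I (J ^ k)
  refine ⟨k + c, ?_⟩
  have h := hc (k + c) (Nat.le_add_left c k)
  rw [smul_eq_mul, Ideal.mul_top, Nat.add_sub_cancel, smul_eq_mul] at h
  rw [h]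
  calc I ^ k * (I ^ c • ⊤ ⊓ J ^ k) ≤ I ^ k * J ^ k := Ideal.mul_mono_right inf_le_right
    _ = (I * J) ^ k := (mul_pow _ _ _).symm
    _ ≤ (I ⊓ J) ^ k := Ideal.pow_right_mono Ideal.mul_le_inf k

/-- In an injective module, the `I ∩ J`-torsion is the sum of the `I`-torsion and the
`J`-torsion. -/
lemma exists_add_of_mem_torsionSubmodule_inf (I J : Ideal R) {E : Type u} [AddCommGroup E]
    [Module R E] [Module.Injective R E] {z : E}
    (hz : z ∈ torsionSubmodule (PrimeSpectrum.zeroLocus ((I ⊓ J : Ideal R) : Set R)) E) :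
    ∃ v ∈ torsionSubmodule (PrimeSpectrum.zeroLocus (I : Set R)) E,
      ∃ w ∈ torsionSubmodule (PrimeSpectrum.zeroLocus (J : Set R)) E, v + w = z := by
  simp only [mem_torsionSubmodule_zeroLocus] at hz ⊢
  obtain ⟨k, hk⟩ := hz
  obtain ⟨l, hl⟩ := exists_pow_inf_pow_le I J k
  have hmk : ∀ (K : Ideal R) (a : R), a • (1 : R ⧸ K) = 0 ↔ a ∈ K := by
    intro K a
    rw [Algebra.smul_def, mul_one, Ideal.Quotient.algebraMap_eq, Ideal.Quotient.eq_zero_iff_mem]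
  -- The annihilator of `(1, 1)` is `I ^ l ∩ J ^ k`, which kills `z`, so `(1, 1) ↦ z` extends to the
  -- product. The images of the two unit vectors are the summands.
  obtain ⟨g, hg⟩ := exists_hom_of_annihilator_le
    ((1, 1) : (R ⧸ I ^ l) × (R ⧸ J ^ k)) z fun r hr => by
      refine hk r (hl ⟨(hmk _ r).1 (congrArg Prod.fst hr), (hmk _ r).1 (congrArg Prod.snd hr)⟩)
  refine ⟨g (1, 0), ⟨l, fun a ha => ?_⟩, g (0, 1), ⟨k, fun a ha => ?_⟩, ?_⟩
  · rw [← map_smul, Prod.smul_mk, (hmk _ a).2 ha, smul_zero]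
    exact map_zero g
  · rw [← map_smul, Prod.smul_mk, (hmk _ a).2 ha, smul_zero]
    exact map_zero g
  · rw [← map_add, ← hg, Prod.mk_add_mk, add_zero, zero_add]

/-- Vanishing of `H_I^n(M)`. -/
abbrev LCVanish (I : Ideal R) (n : ℕ) (M : ModuleCat.{u} R) : Prop :=
  Limits.IsZero ((localCohomology (PrimeSpectrum.zeroLocus (I : Set R)) n).obj M)

variable {I J : Ideal R} {M : ModuleCat.{u} R} {n : ℕ}

/-- The part `H_I ⊕ H_J → H_{I ∩ J} → H_{I + J}` of the Mayer–Vietoris sequence, chased in an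
injective resolution. On injectives the torsion for `I ∩ J` is the sum, and that for `I + J` the
intersection, of the two torsion submodules. -/
lemma LCVanish.inf (hI : LCVanish I (n + 1) M) (hJ : LCVanish J (n + 1) M)
    (h : LCVanish (I ⊔ J) (n + 2) M) : LCVanish (I ⊓ J) (n + 1) M := by
  have E := injectiveResolution M
  rw [LCVanish, isZero_localCohomology_succ_iff _ E] at hI hJ h ⊢
  intro z hz hdz
  obtain ⟨v, hv, w, hw, rfl⟩ := exists_add_of_mem_torsionSubmodule_inf I J hz
  have hvw : E.cocomplex.d (n + 1) (n + 2) v = - E.cocomplex.d (n + 1) (n + 2) w := by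
    rw [eq_neg_iff_add_eq_zero, ← map_add, hdz]
  obtain ⟨t, ht, htv⟩ := h (E.cocomplex.d (n + 1) (n + 2) v) (mem_torsionSubmodule_sup I J |>.2
    ⟨map_mem_torsionSubmodule _ (E.cocomplex.d _ _).hom v hv, by
      rw [hvw]
      exact Submodule.neg_mem _ (map_mem_torsionSubmodule _ (E.cocomplex.d _ _).hom w hw)⟩)
    (d_d_apply _ _ _ _ v)
  rw [mem_torsionSubmodule_sup] at ht
  obtain ⟨p, hp, hp'⟩ := hI (v - t) (Submodule.sub_mem _ hv ht.1) (by rw [map_sub, htv, sub_self])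
  obtain ⟨q, hq, hq'⟩ := hJ (w + t) (Submodule.add_mem _ hw ht.2) (by
    rw [map_add, htv, hvw, add_neg_cancel])
  refine ⟨p + q, Submodule.add_mem _ (torsionSubmodule_le_inf_left I J _ hp)
    (torsionSubmodule_le_inf_right I J _ hq), ?_⟩
  rw [map_add, hp', hq']
  abel

/-- The part `H_{I ∩ J} → H_{I + J} → H_I ⊕ H_J`. A cocycle bounds an `I`-torsion and a `J`-torsion
element; these differ by a boundary, and splitting its primitive as `a + b` corrects the first
element to be torsion for both. -/
lemma LCVanish.sup (hI : LCVanish I (n + 2) M) (hJ : LCVanish J (n + 2) M)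
    (h : LCVanish (I ⊓ J) (n + 1) M) : LCVanish (I ⊔ J) (n + 2) M := by
  have E := injectiveResolution M
  rw [LCVanish, isZero_localCohomology_succ_iff _ E] at hI hJ h ⊢
  intro z hz hdz
  rw [mem_torsionSubmodule_sup] at hz
  obtain ⟨v, hv, hvz⟩ := hI z hz.1 hdz
  obtain ⟨w, hw, hwz⟩ := hJ z hz.2 hdz
  obtain ⟨p, hp, hp'⟩ := h (v - w) (Submodule.sub_mem _ (torsionSubmodule_le_inf_left I J _ hv)
    (torsionSubmodule_le_inf_right I J _ hw)) (by rw [map_sub, hvz, hwz, sub_self])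
  obtain ⟨a, ha, b, hb, rfl⟩ := exists_add_of_mem_torsionSubmodule_inf I J hp
  refine ⟨v - E.cocomplex.d n (n + 1) a, mem_torsionSubmodule_sup I J |>.2
    ⟨Submodule.sub_mem _ hv (map_mem_torsionSubmodule _ (E.cocomplex.d _ _).hom a ha), ?_⟩, ?_⟩
  · have h1 : v - E.cocomplex.d n (n + 1) a = w + E.cocomplex.d n (n + 1) b := by
      rw [map_add] at hp'
      rw [sub_eq_iff_eq_add, add_assoc, add_comm (E.cocomplex.d n (n + 1) b), hp',
        add_sub_cancel]
    rw [h1]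
    exact Submodule.add_mem _ hw (map_mem_torsionSubmodule _ (E.cocomplex.d _ _).hom b hb)
  · rw [map_sub, d_d_apply, sub_zero, hvz]

lemma lcVanish_of_length_lt (xs : List R) (M : ModuleCat.{u} R) (n : ℕ) (hn : xs.length < n) :
    LCVanish (Ideal.span {x : R | x ∈ xs}) n M := by
  obtain ⟨n, rfl⟩ : ∃ m, n = m + 1 := ⟨n - 1, by omega⟩
  exact (isZero_localCohomology_iff xs M n).2 (subsingleton_CH_of_length_lt xs _ hn)

/-- The cohomological dimension of the intersection of ideals generated by `r` and `s` elements is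
`r + s - 1` if the local cohomology of `R` at their sum is nonzero in degree `r + s`. -/
theorem cdIdeal_inf_eq (xs ys : List R) (hx : 1 ≤ xs.length) (hy : 1 ≤ ys.length)
    (h : ¬ LCVanish (Ideal.span {x : R | x ∈ xs} ⊔ Ideal.span {x : R | x ∈ ys})
      (xs.length + ys.length) (ModuleCat.of R R)) :
    cdIdeal (Ideal.span {x : R | x ∈ xs} ⊓ Ideal.span {x : R | x ∈ ys}) =
      ((xs.length + ys.length - 1 : ℕ) : WithBot ℕ∞) := by
  obtain ⟨n, hn⟩ : ∃ n, xs.length + ys.length = n + 2 := ⟨xs.length + ys.length - 2, by omega⟩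
  rw [hn] at h ⊢
  refine le_antisymm (iSup₂_le fun k ⟨M, hM⟩ => ?_) (le_iSup₂_of_le (n + 1) ⟨ModuleCat.of R R, ?_⟩ le_rfl)
  -- For `k ≥ n + 2` both lists are shorter than `k`, and the concatenated list, of length `n + 2`,
  -- is shorter than `k + 1`.
  · rw [Nat.cast_le]
    by_contra! hk
    obtain ⟨k, rfl⟩ : ∃ m, k = m + 1 := ⟨k - 1, by omega⟩
    refine hM (LCVanish.inf (lcVanish_of_length_lt xs M _ (by omega))
      (lcVanish_of_length_lt ys M _ (by omega)) ?_)
    rw [← span_append]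
    exact lcVanish_of_length_lt _ M _ (by rw [List.length_append]; omega)
  -- As neither list is empty, each has at most `n + 1` elements, so both ideals have no cohomology
  -- in degree `n + 2`.
  · intro h1
    exact h (LCVanish.sup (lcVanish_of_length_lt xs _ _ (by omega))
      (lcVanish_of_length_lt ys _ _ (by omega)) h1)

end MayerVietoris

/-! ### Homology of `A ⊗ Q` as a functor of `A` -/

section TensorComplex

variable {R : Type u} [CommRing R]

lemma rTensor_lTensor_comm {X Y U V : Type*} [AddCommGroup X] [AddCommGroup Y] [AddCommGroup U]
    [AddCommGroup V] [Module R X] [Module R Y] [Module R U] [Module R V] (φ : X →ₗ[R] Y)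
    (ψ : U →ₗ[R] V) (y : TensorProduct R X U) :
    LinearMap.rTensor V φ (LinearMap.lTensor X ψ y) = LinearMap.lTensor Y ψ (LinearMap.rTensor U φ y) :=
  LinearMap.congr_fun ((LinearMap.rTensor_comp_lTensor _ _ _).trans
    (LinearMap.lTensor_comp_rTensor _ _ _).symm) y

/-- The complex `A ⊗ Q`. -/
noncomputable def tensC (Q : ChainComplex (ModuleCat.{u} R) ℕ) (A : Type u) [AddCommGroup A]
    [Module R A] : ChainComplex (ModuleCat.{u} R) ℕ :=
  (((MonoidalCategory.tensoringLeft (ModuleCat.{u} R)).obj (ModuleCat.of R A)).mapHomologicalComplex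
    _).obj Q

variable (Q : ChainComplex (ModuleCat.{u} R) ℕ) {A B C : Type u} [AddCommGroup A] [AddCommGroup B]
  [AddCommGroup C] [Module R A] [Module R B] [Module R C]

/-- The map induced on `A ⊗ Q` by a linear map. -/
noncomputable def tensMap (f : A →ₗ[R] B) : tensC Q A ⟶ tensC Q B where
  f i := ModuleCat.ofHom (LinearMap.rTensor (Q.X i) f)
  comm' _ _ _ := congrArg ModuleCat.ofHom
    ((LinearMap.lTensor_comp_rTensor _ _ _).trans (LinearMap.rTensor_comp_lTensor _ _ _).symm)

/-- Vanishing of the `i`-th homology of `A ⊗ Q`. -/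
def TorV (Q : ChainComplex (ModuleCat.{u} R) ℕ) (i : ℕ) (A : Type u) [AddCommGroup A]
    [Module R A] : Prop :=
  Limits.IsZero ((tensC Q A).homology i)

lemma torV_zero_iff : TorV Q 0 A ↔ Function.Surjective (LinearMap.lTensor A (Q.d 1 0).hom) := by
  rw [TorV, isZero_homology_iff (tensC Q A) 1 0 0 (by simp) (by simp)]
  have h0 : (tensC Q A).d 0 0 = 0 := HomologicalComplex.shape _ _ _ (by simp)
  refine forall_congr' fun z => ?_
  rw [h0]
  exact ⟨fun h => h rfl, fun h _ => h⟩

lemma torV_succ_iff (i : ℕ) : TorV Q (i + 1) A ↔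
    Function.Exact (LinearMap.lTensor A (Q.d (i + 2) (i + 1)).hom)
      (LinearMap.lTensor A (Q.d (i + 1) i).hom) := by
  rw [TorV, isZero_homology_iff (tensC Q A) (i + 2) (i + 1) i (by simp) (by simp)]
  refine forall_congr' fun z => ⟨fun h => ⟨h, ?_⟩, fun h => h.1⟩
  rintro ⟨y, rfl⟩
  exact d_d_apply (tensC Q A) (i + 2) (i + 1) i y

variable {Q}

/-- Only flatness of the terms of `Q` matters for the long exact homology sequence in the other
variable. -/
lemma shortExact_tensC [∀ i, Module.Flat R (Q.X i)] {f : A →ₗ[R] B} {g : B →ₗ[R] C}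
    (h : IsSES f g) : ∃ h0 : tensMap Q f ≫ tensMap Q g = 0,
      (ShortComplex.mk (tensMap Q f) (tensMap Q g) h0).ShortExact := by
  have h0 : tensMap Q f ≫ tensMap Q g = 0 := by
    ext i : 1
    change ModuleCat.ofHom _ ≫ ModuleCat.ofHom _ = 0
    rw [← ModuleCat.ofHom_comp, ← LinearMap.rTensor_comp, h.exact.linearMap_comp_eq_zero,
      LinearMap.rTensor_zero]
    rfl
  refine ⟨h0, HomologicalComplex.shortExact_of_degreewise_shortExact _ fun i => ?_⟩
  apply shortExact_of_isSES
  exact ⟨Module.Flat.rTensor_preserves_injective_linearMap f h.inj, rTensor_exact _ h.exact h.surj,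
    LinearMap.rTensor_surjective _ h.surj⟩

section LES

variable {f : A →ₗ[R] B} {g : B →ₗ[R] C} {i : ℕ}

lemma TorV.middle [∀ i, Module.Flat R (Q.X i)] (h : IsSES f g)
    (hA : TorV Q i A) (hC : TorV Q i C) : TorV Q i B := by
  obtain ⟨h0, hS⟩ := shortExact_tensC (Q := Q) h
  exact (hS.homology_exact₂ i).isZero_of_both_zeros (hA.eq_of_src _ _) (hC.eq_of_tgt _ _)

lemma TorV.left [∀ i, Module.Flat R (Q.X i)] (h : IsSES f g)
    (hB : TorV Q i B) (hC : TorV Q (i + 1) C) : TorV Q i A := by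
  obtain ⟨h0, hS⟩ := shortExact_tensC (Q := Q) h
  exact (hS.homology_exact₁ (i + 1) i (by simp)).isZero_of_both_zeros (hC.eq_of_src _ _)
    (hB.eq_of_tgt _ _)

lemma TorV.right [∀ i, Module.Flat R (Q.X i)] (h : IsSES f g)
    (hA : TorV Q i A) (hB : TorV Q (i + 1) B) : TorV Q (i + 1) C := by
  obtain ⟨h0, hS⟩ := shortExact_tensC (Q := Q) h
  exact (hS.homology_exact₃ (i + 1) i (by simp)).isZero_of_both_zeros (hB.eq_of_src _ _)
    (hA.eq_of_tgt _ _)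

end LES

lemma TorV.of_equiv {i : ℕ} (e : A ≃ₗ[R] B) (h : TorV Q i A) : TorV Q i B := by
  have e' := ((MonoidalCategory.tensoringLeft (ModuleCat.{u} R)).mapIso e.toModuleIso)
  let φ : tensC Q A ≅ tensC Q B := HomologicalComplex.Hom.isoOfComponents
    (fun i => (LinearEquiv.rTensor (Q.X i) e).toModuleIso) fun i j _ => (tensMap Q e.toLinearMap).comm i j
  exact h.of_iso ((HomologicalComplex.homologyFunctor _ _ i).mapIso φ).symm

lemma TorV.of_subsingleton {i : ℕ} [Subsingleton A] : TorV Q i A := by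
  have h : ∀ i, Subsingleton (TensorProduct R A (Q.X i)) := fun i => inferInstance
  cases i with
  | zero => exact (torV_zero_iff Q).2 fun z => ⟨0, (h 0).elim _ _⟩
  | succ i =>
    exact (torV_succ_iff Q i).2 fun z => ⟨fun _ => ⟨0, (h (i + 1)).elim _ _⟩, fun _ => (h i).elim _ _⟩

/-- If every finitely generated submodule of `A` has no `i`-th Tor, then neither has `A`. -/
lemma TorV.of_forall_fg [∀ i, Module.Flat R (Q.X i)] {i : ℕ}
    (h : ∀ N : Submodule R A, N.FG → TorV Q i N) : TorV Q i A := by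
  have hrep : ∀ (i : ℕ) (z : TensorProduct R A (Q.X i)), ∃ N : Submodule R A, N.FG ∧
      ∃ w, LinearMap.rTensor (Q.X i) N.subtype w = z := by
    intro i z
    obtain ⟨N, hN, hz⟩ := TensorProduct.exists_finite_submodule_left_of_setFinite {z}
      (Set.finite_singleton z)
    obtain ⟨w, hw⟩ := hz rfl
    exact ⟨N, Module.Finite.iff_fg.1 hN, w, hw⟩
  cases i with
  | zero =>
    refine (torV_zero_iff Q).2 fun z => ?_
    obtain ⟨N, hN, w, rfl⟩ := hrep 0 z
    obtain ⟨y, rfl⟩ := (torV_zero_iff Q).1 (h N hN) w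
    exact ⟨_, (rTensor_lTensor_comm N.subtype (Q.d 1 0).hom y).symm⟩
  | succ i =>
    refine (torV_succ_iff Q i).2 fun z => ⟨fun hz => ?_, ?_⟩
    · obtain ⟨N, hN, w, rfl⟩ := hrep (i + 1) z
      have hw : LinearMap.lTensor N (Q.d (i + 1) i).hom w = 0 := by
        apply Module.Flat.rTensor_preserves_injective_linearMap (M := Q.X i) N.subtype
          Subtype.val_injective
        rw [rTensor_lTensor_comm, hz, map_zero]
      obtain ⟨y, rfl⟩ := ((torV_succ_iff Q i).1 (h N hN) w).1 hw
      exact ⟨_, (rTensor_lTensor_comm N.subtype (Q.d (i + 2) (i + 1)).hom y).symm⟩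
    · rintro ⟨y, rfl⟩
      exact d_d_apply (tensC Q A) (i + 2) (i + 1) i y

end TensorComplex

/-! ### Tor from flat resolutions -/

section Resolution

variable {R : Type u} [CommRing R]

/-- `Q` is a flat resolution of `M` with augmentation `ε`. -/
structure IsFlatRes (Q : ChainComplex (ModuleCat.{u} R) ℕ) {M : Type u} [AddCommGroup M]
    [Module R M] (ε : Q.X 0 →ₗ[R] M) : Prop where
  flat : ∀ i, Module.Flat R (Q.X i)
  surj : Function.Surjective ε
  exact_zero : Function.Exact (Q.d 1 0).hom ε
  exact : ∀ i, Function.Exact (Q.d (i + 2) (i + 1)).hom (Q.d (i + 1) i).hom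

lemma exists_isFlatRes {M : ModuleCat.{u} R} (P : ProjectiveResolution M) :
    ∃ ε : P.complex.X 0 →ₗ[R] M, IsFlatRes P.complex ε := by
  let e : ((ChainComplex.single₀ (ModuleCat.{u} R)).obj M).X 0 ≅ M :=
    HomologicalComplex.singleObjXSelf (ComplexShape.down ℕ) 0 M
  have he : Function.Bijective e.hom := ConcreteCategory.bijective_of_isIso e.hom
  refine ⟨(P.π.f 0 ≫ e.hom).hom, fun i => ?_, ?_, fun z => ?_, fun i => ?_⟩
  · have := ModuleCat.projective_of_module_projective (P.complex.X i)
    exact Module.Flat.of_projective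
  · exact (ModuleCat.epi_iff_surjective (P.π.f 0 ≫ e.hom)).1 inferInstance
  · have h1 := (ShortComplex.ShortExact.moduleCat_exact_iff_function_exact _).1 P.exact₀ z
    refine Iff.trans ⟨fun h => he.1 ?_, fun h => ?_⟩ h1
    · rw [map_zero]; exact h
    · exact (congrArg e.hom h).trans (map_zero e.hom.hom)
  · exact (ShortComplex.ShortExact.moduleCat_exact_iff_function_exact _).1 (P.exact_succ i)

variable {Q : ChainComplex (ModuleCat.{u} R) ℕ} {M : Type u} [AddCommGroup M] [Module R M]
  {ε : Q.X 0 →ₗ[R] M} {A B C : Type u} [AddCommGroup A] [AddCommGroup B]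
  [AddCommGroup C] [Module R A] [Module R B] [Module R C] {f : A →ₗ[R] B} {g : B →ₗ[R] C}

lemma IsFlatRes.torV_of_flat (hQ : IsFlatRes Q ε) [Module.Flat R A] (i : ℕ) : TorV Q (i + 1) A :=
  (torV_succ_iff Q i).2 (Module.Flat.lTensor_exact A (hQ.exact i))

lemma IsFlatRes.torV_zero_iff (hQ : IsFlatRes Q ε) :
    TorV Q 0 A ↔ Subsingleton (TensorProduct R A M) := by
  have h1 := lTensor_exact A hQ.exact_zero hQ.surj
  have h2 := LinearMap.lTensor_surjective A hQ.surj
  rw [SpClosed.torV_zero_iff]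
  constructor
  · intro h
    refine subsingleton_of_forall_eq 0 fun z => ?_
    obtain ⟨y, rfl⟩ := h2 z
    obtain ⟨w, rfl⟩ := h y
    exact h1.apply_apply_eq_zero w
  · intro h z
    exact (h1 z).1 (Subsingleton.elim _ _)

/-- Injectivity on tensor products with `M` from the vanishing of the first Tor. -/
lemma IsFlatRes.injective_rTensor (hQ : IsFlatRes Q ε) (h : IsSES f g) (hC : TorV Q 1 C) :
    Function.Injective (LinearMap.rTensor M f) := by
  have := hQ.flat
  have exε : ∀ {X : Type u} [AddCommGroup X] [Module R X],
      Function.Exact (LinearMap.lTensor X (Q.d 1 0).hom) (LinearMap.lTensor X ε) :=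
    lTensor_exact _ hQ.exact_zero hQ.surj
  have hinj := fun i => Module.Flat.rTensor_preserves_injective_linearMap (M := Q.X i) f h.inj
  rw [injective_iff_map_eq_zero]
  intro a ha
  obtain ⟨a0, rfl⟩ := LinearMap.lTensor_surjective A hQ.surj a
  rw [rTensor_lTensor_comm] at ha
  obtain ⟨b1, hb1⟩ := (exε _).1 ha
  have hc : LinearMap.lTensor C (Q.d 1 0).hom (LinearMap.rTensor _ g b1) = 0 := by
    rw [← rTensor_lTensor_comm, hb1]
    exact (rTensor_exact _ h.exact h.surj).apply_apply_eq_zero _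
  obtain ⟨c2, hc2⟩ := ((torV_succ_iff Q 0).1 hC _).1 hc
  obtain ⟨b2, rfl⟩ := LinearMap.rTensor_surjective (Q.X 2) h.surj c2
  rw [← rTensor_lTensor_comm] at hc2
  obtain ⟨a1, ha1⟩ := ((rTensor_exact _ h.exact h.surj) (b1 - LinearMap.lTensor B (Q.d 2 1).hom b2)).1
    (by rw [map_sub, hc2, sub_self])
  have h0 : a0 = LinearMap.lTensor A (Q.d 1 0).hom a1 := by
    apply hinj 0
    rw [rTensor_lTensor_comm, ha1, map_sub, hb1]
    exact (sub_eq_self.2 (d_d_apply (tensC Q B) 2 1 0 b2)).symm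
  rw [h0]
  exact exε.apply_apply_eq_zero _

/-- When `B` has no first Tor with `M`, that of `C` is the kernel of `A ⊗ M → B ⊗ M`. -/
lemma IsFlatRes.torV_one_of_injective (hQ : IsFlatRes Q ε) (h : IsSES f g) (hB : TorV Q 1 B)
    (hi : Function.Injective (LinearMap.rTensor M f)) : TorV Q 1 C := by
  have exε : ∀ {X : Type u} [AddCommGroup X] [Module R X],
      Function.Exact (LinearMap.lTensor X (Q.d 1 0).hom) (LinearMap.lTensor X ε) :=
    lTensor_exact _ hQ.exact_zero hQ.surj
  refine (torV_succ_iff Q 0).2 fun c1 => ⟨fun hc1 => ?_, ?_⟩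
  · obtain ⟨b1, rfl⟩ := LinearMap.rTensor_surjective (Q.X 1) h.surj c1
    rw [← rTensor_lTensor_comm] at hc1
    obtain ⟨a0, ha0⟩ := ((rTensor_exact _ h.exact h.surj) _).1 hc1
    have ha : LinearMap.lTensor A ε a0 = 0 := by
      apply hi
      rw [map_zero, rTensor_lTensor_comm, ha0]
      exact exε.apply_apply_eq_zero _
    obtain ⟨a1, rfl⟩ := (exε _).1 ha
    rw [rTensor_lTensor_comm] at ha0
    obtain ⟨b2, hb2⟩ := ((torV_succ_iff Q 0).1 hB (b1 - LinearMap.rTensor _ f a1)).1 (by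
      rw [map_sub, ha0, sub_self])
    refine ⟨LinearMap.rTensor _ g b2, ?_⟩
    rw [← rTensor_lTensor_comm, hb2, map_sub, (rTensor_exact _ h.exact h.surj).apply_apply_eq_zero, sub_zero]
  · rintro ⟨y, rfl⟩
    exact d_d_apply (tensC Q C) 2 1 0 y

end Resolution

/-! ### Balancing Tor -/

section Balance

variable {R : Type u} [CommRing R] {P Q : ChainComplex (ModuleCat.{u} R) ℕ} {L M : Type u}
  [AddCommGroup L] [Module R L] [AddCommGroup M] [Module R M] {εL : P.X 0 →ₗ[R] L}
  {ε : Q.X 0 →ₗ[R] M}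

lemma TorV.succ_iff {A B C : Type u} [AddCommGroup A] [AddCommGroup B] [AddCommGroup C]
    [Module R A] [Module R B] [Module R C] {f : A →ₗ[R] B} {g : B →ₗ[R] C} (h : IsSES f g)
    (hP : IsFlatRes P εL) [Module.Flat R B] (i : ℕ) : TorV P (i + 2) C ↔ TorV P (i + 1) A := by
  have := hP.flat
  exact ⟨fun hC => TorV.left h (hP.torV_of_flat i) hC,
    fun hA => TorV.right h hA (hP.torV_of_flat (i + 1))⟩

/-- The syzygies of a resolution. -/
noncomputable def syzygy (ε : Q.X 0 →ₗ[R] M) : ∀ i, Submodule R (Q.X i)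
  | 0 => LinearMap.ker ε
  | i + 1 => LinearMap.ker (Q.d (i + 1) i).hom

lemma d_mem_syzygy (hQ : IsFlatRes Q ε) (i : ℕ) (z : Q.X (i + 1)) :
    (Q.d (i + 1) i).hom z ∈ syzygy ε i := by
  cases i with
  | zero => exact hQ.exact_zero.apply_apply_eq_zero z
  | succ i => exact d_d_apply Q (i + 2) (i + 1) i z

/-- The map from a term of a resolution to the previous syzygy. -/
noncomputable def toSyzygy (hQ : IsFlatRes Q ε) (i : ℕ) : Q.X (i + 1) →ₗ[R] syzygy ε i :=
  (Q.d (i + 1) i).hom.codRestrict _ (d_mem_syzygy hQ i)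

lemma toSyzygy_surjective (hQ : IsFlatRes Q ε) (i : ℕ) : Function.Surjective (toSyzygy hQ i) := by
  rintro ⟨z, hz⟩
  have : ∃ y, (Q.d (i + 1) i).hom y = z := by
    cases i with
    | zero => exact (hQ.exact_zero z).1 hz
    | succ i => exact (hQ.exact i z).1 hz
  obtain ⟨y, rfl⟩ := this
  exact ⟨y, rfl⟩

lemma isSES_syzygy_zero (hQ : IsFlatRes Q ε) : IsSES (syzygy ε 0).subtype ε :=
  ⟨Subtype.val_injective, LinearMap.exact_subtype_ker_map ε, hQ.surj⟩

lemma isSES_syzygy (hQ : IsFlatRes Q ε) (i : ℕ) :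
    IsSES (syzygy ε (i + 1)).subtype (toSyzygy hQ i) where
  inj := Subtype.val_injective
  exact := by
    rw [LinearMap.exact_iff, Submodule.range_subtype]
    exact LinearMap.ker_codRestrict _ _ _
  surj := toSyzygy_surjective hQ i

/-- Shifting along the flat resolution `Q` of `M` reduces the Tor computed from `P` to a first Tor,
which is the kernel of the syzygy inclusion tensored with `L`. -/
lemma torV_succ_iff_injective_syzygy (hP : IsFlatRes P εL) (hQ : IsFlatRes Q ε) (n : ℕ) :
    TorV P (n + 1) M ↔ Function.Injective (LinearMap.rTensor L (syzygy ε n).subtype) := by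
  have := hQ.flat
  have key : ∀ {A B C : Type u} [AddCommGroup A] [AddCommGroup B] [AddCommGroup C]
    [Module R A] [Module R B] [Module R C] {f : A →ₗ[R] B} {g : B →ₗ[R] C}, IsSES f g →
      Module.Flat R B → (TorV P 1 C ↔ Function.Injective (LinearMap.rTensor L f)) := fun h _ =>
    ⟨hP.injective_rTensor h, hP.torV_one_of_injective h (hP.torV_of_flat 0)⟩
  have shift : ∀ j i, TorV P (j + 1) (syzygy ε i) ↔ TorV P 1 (syzygy ε (i + j)) := by
    intro j
    induction j with
    | zero => exact fun i => Iff.rfl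
    | succ j ih =>
      intro i
      rw [TorV.succ_iff (isSES_syzygy hQ i) hP j, ih (i + 1), Nat.add_right_comm i 1 j, add_assoc]
  cases n with
  | zero => exact key (isSES_syzygy_zero hQ) inferInstance
  | succ n =>
    rw [TorV.succ_iff (isSES_syzygy_zero hQ) hP n, shift n 0, zero_add]
    exact key (isSES_syzygy hQ n) inferInstance

/-- The same criterion for the Tor computed from `Q`: the differential factors through the syzygy,
and after tensoring only injectivity of the second factor is at stake. -/
lemma torV_succ_iff_injective_rTensor_syzygy (hQ : IsFlatRes Q ε) (n : ℕ) :
    TorV Q (n + 1) L ↔ Function.Injective (LinearMap.rTensor L (syzygy ε n).subtype) := by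
  rw [← LinearMap.lTensor_inj_iff_rTensor_inj, torV_succ_iff]
  have hs := LinearMap.lTensor_surjective L (toSyzygy_surjective hQ n)
  have he : Function.Exact (LinearMap.lTensor L (Q.d (n + 2) (n + 1)).hom)
      (LinearMap.lTensor L (toSyzygy hQ n)) := by
    refine lTensor_exact L ?_ (toSyzygy_surjective hQ n)
    rw [LinearMap.exact_iff]
    exact (LinearMap.ker_codRestrict _ _ _).trans (LinearMap.exact_iff.1 (hQ.exact n))
  have hd : LinearMap.lTensor L (Q.d (n + 1) n).hom =
      LinearMap.lTensor L (syzygy ε n).subtype ∘ₗ LinearMap.lTensor L (toSyzygy hQ n) := by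
    rw [← LinearMap.lTensor_comp]
    rfl
  rw [hd]
  constructor
  · intro h
    rw [injective_iff_map_eq_zero]
    intro a ha
    obtain ⟨b, rfl⟩ := hs a
    obtain ⟨c, rfl⟩ := (h b).1 ha
    exact he.apply_apply_eq_zero c
  · intro h z
    rw [← he z, LinearMap.comp_apply]
    exact ⟨fun h1 => (injective_iff_map_eq_zero _).1 h _ h1, fun h1 => by rw [h1, map_zero]⟩

/-- Tor is balanced, as far as vanishing is concerned. -/
lemma torV_balance (hP : IsFlatRes P εL) (hQ : IsFlatRes Q ε) (n : ℕ) :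
    TorV P n M ↔ TorV Q n L := by
  cases n with
  | zero =>
    rw [hP.torV_zero_iff, hQ.torV_zero_iff]
    exact (TensorProduct.comm R M L).toEquiv.subsingleton_congr
  | succ n => rw [torV_succ_iff_injective_syzygy hP hQ, torV_succ_iff_injective_rTensor_syzygy hQ]

end Balance

/-! ### From residue fields to torsion modules -/

section TorDevissage

variable {R : Type u} [CommRing R] [IsNoetherianRing R] {Q : ChainComplex (ModuleCat.{u} R) ℕ}
  [∀ i, Module.Flat R (Q.X i)]

lemma torV_of_support (Z : Set (PrimeSpectrum R))
    (hZ : ∀ p ∈ Z, ∀ i, TorV Q i (R ⧸ p.asIdeal)) (M : Type u) [AddCommGroup M]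
    [Module R M] [hM : Module.Finite R M] (h : Module.support R M ⊆ Z) (i : ℕ) : TorV Q i M := by
  induction hM using IsNoetherianRing.induction_on_isQuotientEquivQuotientPrime R with
  | subsingleton N => exact TorV.of_subsingleton
  | quotient N p f =>
    refine TorV.of_equiv f.symm (hZ p (h ?_) i)
    rw [f.support_eq, mem_support_quotient_iff]
  | exact N₁ N₂ N₃ f g hf hg hfg h₁ h₃ =>
    exact TorV.middle ⟨hf, hfg, hg⟩
      (h₁ ((Module.support_subset_of_injective f hf).trans h))
      (h₃ ((Module.support_subset_of_surjective g hg).trans h))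

/-- Noetherian induction from larger primes: `R ⧸ p` embeds in `κ(p)`, and finitely generated
submodules of the cokernel are supported at primes strictly containing `p`. -/
lemma torV_quotient_of_residueField (J : Ideal R)
    (h : ∀ p : PrimeSpectrum R, J ≤ p.asIdeal → ∀ i, TorV Q i p.asIdeal.ResidueField)
    (p : PrimeSpectrum R) (hp : J ≤ p.asIdeal) (i : ℕ) : TorV Q i (R ⧸ p.asIdeal) := by
  have : WellFoundedGT (PrimeSpectrum R) :=
    ⟨InvImage.wf PrimeSpectrum.asIdeal (wellFounded_gt (α := Ideal R))⟩
  induction p using WellFoundedGT.induction generalizing i with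
  | ind p ih =>
  let φ : (R ⧸ p.asIdeal) →ₗ[R] p.asIdeal.ResidueField :=
    (IsScalarTower.toAlgHom R (R ⧸ p.asIdeal) p.asIdeal.ResidueField).toLinearMap
  have hφ : IsSES φ (LinearMap.range φ).mkQ :=
    ⟨Ideal.injective_algebraMap_quotient_residueField p.asIdeal,
      LinearMap.exact_map_mkQ_range φ, Submodule.mkQ_surjective _⟩
  have hW : ∀ i, TorV Q i (p.asIdeal.ResidueField ⧸ LinearMap.range φ) := by
    intro i
    refine TorV.of_forall_fg fun N hN => ?_
    have := Module.Finite.iff_fg.2 hN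
    refine torV_of_support {q | p < q} (fun q hq i => ih q hq (hp.trans hq.le) i) N ?_ i
    intro q hq
    obtain ⟨⟨w, hw⟩, hwq⟩ := Module.mem_support_iff_exists_annihilator.1 hq
    obtain ⟨w, rfl⟩ := Submodule.mkQ_surjective _ w
    -- A denominator `s ∉ p` of `w` kills its class in the cokernel, so it lies in `q`; this makes
    -- `p ≤ q` strict.
    obtain ⟨a, s, hs, has⟩ : ∃ a s : R, s ∉ p.asIdeal ∧ s • w = algebraMap R _ a := by
      obtain ⟨a, s, hs, rfl⟩ := IsFractionRing.div_surjective (A := R ⧸ p.asIdeal) w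
      obtain ⟨a, rfl⟩ := Ideal.Quotient.mk_surjective a
      obtain ⟨s, rfl⟩ := Ideal.Quotient.mk_surjective s
      have hs' : s ∉ p.asIdeal := fun h =>
        nonZeroDivisors.ne_zero hs (Ideal.Quotient.eq_zero_iff_mem.2 h)
      refine ⟨a, s, hs', ?_⟩
      rw [Algebra.smul_def]
      exact mul_div_cancel₀ _ fun h => hs' (Ideal.algebraMap_residueField_eq_zero.1 h)
    have h1 : ∀ r : R, r • w ∈ LinearMap.range φ → r ∈ q.asIdeal := by
      intro r hr
      refine hwq ((Submodule.mem_annihilator_span_singleton _ _).2 (Subtype.ext ?_))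
      exact (Submodule.Quotient.mk_eq_zero _).2 hr
    have hs' : s ∈ q.asIdeal := h1 s ⟨Ideal.Quotient.mk _ a, has.symm⟩
    have hle : p ≤ q := fun r hr => h1 r (by
      have h2 : r • w = 0 := by
        rw [Algebra.smul_def, Ideal.algebraMap_residueField_eq_zero.2 hr, zero_mul]
      rw [h2]
      exact Submodule.zero_mem _)
    exact lt_of_le_of_ne hle fun hpq => hs (by rwa [hpq])
  exact TorV.left hφ (h p hp i) (hW (i + 1))

/-- Vanishing of Tor against the residue fields over `V(J)` implies vanishing of Tor against
all `J`-torsion modules. -/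
lemma torV_of_torsion (xs : List R)
    (h : ∀ p : PrimeSpectrum R, Ideal.span {x : R | x ∈ xs} ≤ p.asIdeal →
      ∀ i, TorV Q i p.asIdeal.ResidueField)
    (L : Type u) [AddCommGroup L] [Module R L] (hL : ∀ l : L, ∀ x ∈ xs, ∃ k : ℕ, x ^ k • l = 0)
    (i : ℕ) : TorV Q i L := by
  refine TorV.of_forall_fg fun N hN => ?_
  have := Module.Finite.iff_fg.2 hN
  refine torV_of_support {q | Ideal.span {x : R | x ∈ xs} ≤ q.asIdeal}
    (torV_quotient_of_residueField _ h) N ?_ i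
  intro q hq
  obtain ⟨w, hwq⟩ := Module.mem_support_iff_exists_annihilator.1 hq
  refine Ideal.span_le.2 fun x hx => ?_
  obtain ⟨k, hk⟩ := hL w x hx
  refine q.2.mem_of_pow_mem k (hwq ((Submodule.mem_annihilator_span_singleton _ _).2 ?_))
  exact Subtype.ext hk

end TorDevissage

/-! ### An element acting invertibly and as zero -/

section Invertible

variable {R : Type u} [CommRing R]

/-- Tor of two modules vanishes if some element acts invertibly on one and as zero on the other. -/
lemma torV_of_bijective {κ : ModuleCat.{u} R} (P : ProjectiveResolution κ) (x : R)
    (hκ : ∀ z : κ, x • z = 0) (N : Type u) [AddCommGroup N] [Module R N]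
    (hN : Function.Bijective (fun z : N => x • z)) (i : ℕ) : TorV P.complex i N := by
  -- As `x` kills `κ`, multiplication by `x` on the resolution lifts the zero map and is
  -- null-homotopic. On `N ⊗ P` it is also bijective, so the homology vanishes.
  have hπ : (x • 𝟙 P.complex) ≫ P.π = 0 := by
    refine HomologicalComplex.to_single_hom_ext ?_
    ext z
    let e : ((ChainComplex.single₀ (ModuleCat.{u} R)).obj κ).X 0 ≅ κ :=
      HomologicalComplex.singleObjXSelf (ComplexShape.down ℕ) 0 κ
    have he : Function.Bijective e.hom := ConcreteCategory.bijective_of_isIso e.hom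
    apply he.1
    change e.hom (P.π.f 0 (x • z)) = e.hom 0
    have h1 : P.π.f 0 (x • z) = x • P.π.f 0 z := map_smul (P.π.f 0).hom x z
    have h2 : e.hom (x • P.π.f 0 z) = x • e.hom (P.π.f 0 z) := map_smul e.hom.hom x _
    rw [h1, h2, hκ]
    exact (map_zero e.hom.hom).symm
  have H := ProjectiveResolution.liftHomotopyZero _ hπ
  have hx : ∀ i, Function.Bijective (fun z : TensorProduct R N (P.complex.X i) => x • z) := by
    intro i
    let e : N ≃ₗ[R] N := LinearEquiv.ofBijective (x • LinearMap.id) hN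
    have : ⇑(LinearEquiv.rTensor (P.complex.X i) e) =
        fun z : TensorProduct R N (P.complex.X i) => x • z := by
      ext z
      induction z with
      | zero => simp
      | add a b ha hb => rw [map_add, ha, hb, smul_add]
      | tmul a b => rfl
    rw [← this]
    exact LinearEquiv.bijective _
  cases i with
  | zero =>
    have h0 : (x • LinearMap.id : P.complex.X 0 →ₗ[R] P.complex.X 0) =
        (P.complex.d 1 0).hom ∘ₗ (H.hom 0 1).hom := by
      have := H.comm 0
      rw [Homotopy.dNext_zero_chainComplex, Homotopy.prevD_chainComplex, zero_add] at this
      exact (congrArg ModuleCat.Hom.hom this).trans (add_zero _)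
    refine (torV_zero_iff _).2 fun z => ?_
    obtain ⟨w, rfl⟩ := (hx 0).2 z
    refine ⟨LinearMap.lTensor N (H.hom 0 1).hom w, ?_⟩
    rw [← LinearMap.lTensor_comp_apply, ← h0, LinearMap.lTensor_smul, LinearMap.lTensor_id]
    rfl
  | succ i =>
    have h0 : (x • LinearMap.id : P.complex.X (i + 1) →ₗ[R] P.complex.X (i + 1)) =
        (H.hom i (i + 1)).hom ∘ₗ (P.complex.d (i + 1) i).hom +
          (P.complex.d (i + 2) (i + 1)).hom ∘ₗ (H.hom (i + 1) (i + 2)).hom := by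
      have := H.comm (i + 1)
      rw [Homotopy.dNext_succ_chainComplex, Homotopy.prevD_chainComplex] at this
      exact (congrArg ModuleCat.Hom.hom this).trans (add_zero _)
    refine (torV_succ_iff _ i).2 fun z => ⟨fun hz => ?_, ?_⟩
    · obtain ⟨w, rfl⟩ := (hx (i + 1)).2 z
      have hw : LinearMap.lTensor N (P.complex.d (i + 1) i).hom w = 0 :=
        (hx i).1 ((map_smul _ x w).symm.trans (hz.trans (smul_zero x).symm))
      refine ⟨LinearMap.lTensor N (H.hom (i + 1) (i + 2)).hom w, ?_⟩
      have h1 : LinearMap.lTensor N (x • LinearMap.id) w = x • w := by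
        rw [LinearMap.lTensor_smul, LinearMap.lTensor_id]
        rfl
      rw [h0, LinearMap.lTensor_add, LinearMap.add_apply, LinearMap.lTensor_comp_apply, hw, map_zero,
        zero_add, LinearMap.lTensor_comp_apply] at h1
      exact h1
    · rintro ⟨y, rfl⟩
      exact d_d_apply (tensC P.complex N) (i + 2) (i + 1) i y

end Invertible

open scoped TensorProduct

/-! ### Tor and bounded cochain complexes -/

section CochainCycles

variable {R : Type u} [CommRing R] (K : CochainComplex (ModuleCat.{u} R) ℕ)

/-- The cycles of a cochain complex. -/
abbrev cyc (n : ℕ) : Submodule R (K.X n) := LinearMap.ker (K.d n (n + 1)).hom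

/-- The boundaries of a cochain complex in positive degrees. -/
abbrev bdry (n : ℕ) : Submodule R (K.X (n + 1)) := LinearMap.range (K.d n (n + 1)).hom

lemma bdry_le_cyc (n : ℕ) : bdry K n ≤ cyc K (n + 1) := by
  rintro _ ⟨y, rfl⟩
  exact d_d_apply K n (n + 1) (n + 2) y

lemma isSES_bdry (n : ℕ) : IsSES (cyc K n).subtype (K.d n (n + 1)).hom.rangeRestrict where
  inj := Subtype.val_injective
  exact := by
    rw [LinearMap.exact_iff, Submodule.range_subtype]
    exact LinearMap.ker_rangeRestrict _
  surj := LinearMap.surjective_rangeRestrict _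

lemma isSES_cyc_quotient (n : ℕ) : IsSES (Submodule.inclusion (bdry_le_cyc K n))
    ((bdry K n).submoduleOf (cyc K (n + 1))).mkQ where
  inj := Submodule.inclusion_injective _
  exact := by
    rw [LinearMap.exact_iff, Submodule.ker_mkQ, Submodule.range_inclusion]
    rfl
  surj := Submodule.mkQ_surjective _

variable {K} {Q : ChainComplex (ModuleCat.{u} R) ℕ}

lemma cyc_eq_bdry (hK : ∀ n, Limits.IsZero (K.homology n)) (n : ℕ) :
    cyc K (n + 1) = bdry K n :=
  le_antisymm (fun z hz => (isZero_homology_succ_iff K n).1 (hK _) z hz) (bdry_le_cyc K n)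

/-- A bounded exact complex whose terms in positive degrees have no Tor has no Tor in degree zero
either. -/
lemma torV_of_exact [∀ i, Module.Flat R (Q.X i)] (r : ℕ) (hr : ∀ n, r < n → Subsingleton (K.X n))
    (hK : ∀ n, Limits.IsZero (K.homology n)) (h : ∀ n i, TorV Q i (K.X (n + 1))) (i : ℕ) :
    TorV Q i (K.X 0) := by
  -- Descending induction from the end of the complex, where exactness identifies boundaries with
  -- cycles.
  have key : ∀ m n, r ≤ n + m → ∀ i, TorV Q i (bdry K n) := by
    intro m
    induction m with
    | zero =>
      intro n hn i
      have := hr (n + 1) (by omega)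
      exact TorV.of_subsingleton
    | succ m ih =>
      intro n hn i
      rw [← cyc_eq_bdry hK n]
      exact TorV.left (isSES_bdry K (n + 1)) (h n i) (ih (n + 1) (by omega) (i + 1))
  refine TorV.middle (isSES_bdry K 0) ?_ (key r 0 (by omega) i)
  have : Subsingleton (cyc K 0) := subsingleton_of_forall_eq 0 fun z =>
    Subtype.ext ((isZero_homology_zero_iff K).1 (hK 0) z.1 z.2)
  exact TorV.of_subsingleton

variable {M : Type u} [AddCommGroup M] [Module R M] {ε : Q.X 0 →ₗ[R] M}

/-- Exactness of `K ⊗ M` for a bounded complex `K` of flat modules whose cohomology has no Tor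
with `M`. -/
lemma exact_rTensor_of_torV (hQ : IsFlatRes Q ε) (hflat : ∀ n, Module.Flat R (K.X n)) (r : ℕ)
    (hr : ∀ n, r < n → Subsingleton (K.X n)) (h0 : ∀ i, TorV Q i (cyc K 0))
    (h : ∀ n i, TorV Q i (cyc K (n + 1) ⧸ (bdry K n).submoduleOf (cyc K (n + 1)))) :
    Function.Injective (LinearMap.rTensor M (K.d 0 1).hom) ∧
      ∀ n, Function.Exact (LinearMap.rTensor M (K.d n (n + 1)).hom)
        (LinearMap.rTensor M (K.d (n + 1) (n + 2)).hom) := by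
  have := hQ.flat
  -- Descending induction: flatness of the terms passes the vanishing of higher Tor from the next
  -- boundaries to the cycles, and the hypothesis on cohomology passes it on to the boundaries.
  have hB : ∀ m n, r ≤ n + m → ∀ i, TorV Q (i + 1) (bdry K n) := by
    intro m
    induction m with
    | zero =>
      intro n hn i
      have := hr (n + 1) (by omega)
      exact TorV.of_subsingleton
    | succ m ih =>
      intro n hn i
      have h1 := ih (n + 1) (by omega) (i + 1)
      have h2 : TorV Q (i + 1) (cyc K (n + 1)) :=
        TorV.left (isSES_bdry K (n + 1)) (hQ.torV_of_flat i) h1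
      exact TorV.left (isSES_cyc_quotient K n) h2 (h n (i + 2))
  have hB' : ∀ n i, TorV Q (i + 1) (bdry K n) := fun n => hB r n (by omega)
  -- Both inclusions, of boundaries in cycles and of cycles in the term, stay injective after
  -- tensoring, since their cokernels have no first Tor.
  have hinj : ∀ n, Function.Injective (LinearMap.rTensor M (bdry K n).subtype) := by
    intro n
    have : (bdry K n).subtype =
      (cyc K (n + 1)).subtype ∘ₗ Submodule.inclusion (bdry_le_cyc K n) := rfl
    rw [this, LinearMap.rTensor_comp, LinearMap.coe_comp]
    exact (hQ.injective_rTensor (isSES_bdry K (n + 1)) (hB' (n + 1) 0)).comp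
      (hQ.injective_rTensor (isSES_cyc_quotient K n) (h n 1))
  have hker : ∀ n (w : TensorProduct R (K.X n) M), LinearMap.rTensor M (K.d n (n + 1)).hom w = 0 →
      ∃ v, LinearMap.rTensor M (cyc K n).subtype v = w := by
    intro n w hw
    refine ((rTensor_exact M (isSES_bdry K n).exact (isSES_bdry K n).surj) w).1 (hinj n ?_)
    rw [← LinearMap.rTensor_comp_apply, map_zero]
    exact hw
  refine ⟨?_, fun n w => ⟨fun hw => ?_, ?_⟩⟩
  · rw [injective_iff_map_eq_zero]
    intro w hw
    obtain ⟨v, rfl⟩ := hker 0 w hw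
    have := hQ.torV_zero_iff.1 (h0 0)
    rw [Subsingleton.elim v 0, map_zero]
  · obtain ⟨v, rfl⟩ := hker (n + 1) w hw
    have := hQ.torV_zero_iff.1 (h n 0)
    have hS := isSES_cyc_quotient K n
    obtain ⟨b, rfl⟩ := ((rTensor_exact M hS.exact hS.surj) v).1 (Subsingleton.elim _ _)
    obtain ⟨a, rfl⟩ := LinearMap.rTensor_surjective M
      (LinearMap.surjective_rangeRestrict (K.d n (n + 1)).hom) b
    refine ⟨a, ?_⟩
    rw [← LinearMap.rTensor_comp_apply, ← LinearMap.rTensor_comp_apply]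
    rfl
  · rintro ⟨a, rfl⟩
    rw [← LinearMap.rTensor_comp_apply, ← ModuleCat.hom_comp, K.d_comp_d, ModuleCat.hom_zero,
      LinearMap.rTensor_zero]
    rfl

end CochainCycles

/-! ### Tor and the Čech complex -/

section CechTor

variable {R : Type u} [CommRing R]

lemma TorV.prod {Q : ChainComplex (ModuleCat.{u} R) ℕ} [∀ i, Module.Flat R (Q.X i)] {A B : Type u}
    [AddCommGroup A] [AddCommGroup B] [Module R A] [Module R B] {i : ℕ} (hA : TorV Q i A)
    (hB : TorV Q i B) : TorV Q i (A × B) :=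
  TorV.middle (f := LinearMap.inl R A B) (g := LinearMap.snd R A B)
    ⟨LinearMap.inl_injective, Function.Exact.inl_snd, LinearMap.snd_surjective⟩ hA hB

/-- The terms of the Čech complex in positive degrees have no Tor with a residue field at which the
elements vanish. -/
lemma torV_cech_succ {κ : ModuleCat.{u} R} (P : ProjectiveResolution κ) (xs : List R)
    (hκ : ∀ x ∈ xs, ∀ z : κ, x • z = 0) (M : ModuleCat.{u} R) (n i : ℕ) :
    TorV P.complex i (((cech xs).obj M).X (n + 1)) := by
  obtain ⟨ε, hP⟩ := exists_isFlatRes P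
  have := hP.flat
  induction xs with
  | nil =>
    have := subsingleton_cech [] M (n + 1) (by simp)
    exact TorV.of_subsingleton
  | cons x xs ih =>
    refine TorV.prod (ih fun y hy => hκ y (List.mem_cons_of_mem _ hy)) ?_
    refine torV_of_bijective P x (hκ x List.mem_cons_self) _ ?_ i
    simpa using away_pow_smul_bijective (M := ((cech xs).obj M).X n) x 1

/-- `M` is the degree-zero term of its Čech complex, which is exact here, so it inherits the
vanishing of Tor from the other terms. -/
lemma torV_of_subsingleton_CH {κ : ModuleCat.{u} R} (P : ProjectiveResolution κ) (xs : List R)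
    (hκ : ∀ x ∈ xs, ∀ z : κ, x • z = 0) (M : ModuleCat.{u} R)
    (hM : ∀ n, Subsingleton (CH xs n M)) (i : ℕ) : TorV P.complex i M := by
  obtain ⟨ε, hP⟩ := exists_isFlatRes P
  have := hP.flat
  refine TorV.of_equiv (cechZero M xs).toLinearEquiv ?_
  exact torV_of_exact xs.length (fun n hn => subsingleton_cech xs M n hn)
    (fun n => (isZero_CH_iff xs n).2 (hM n)) (fun n i => torV_cech_succ P xs hκ M n i) i

lemma flat_away (x : R) (M : Type u) [AddCommGroup M] [Module R M] [Module.Flat R M] :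
    Module.Flat R (Away x M) := by
  have := IsLocalization.flat (Localization (Submonoid.powers x)) (Submonoid.powers x)
  exact Module.Flat.of_linearEquiv ((LocalizedModule.equivTensorProduct (Submonoid.powers x) M).restrictScalars R)

lemma flat_prod {A B : Type u} [AddCommGroup A] [AddCommGroup B] [Module R A] [Module R B]
    (hA : Module.Flat R A) (hB : Module.Flat R B) : Module.Flat R (A × B) := by
  rw [Module.Flat.iff_lTensor_preserves_injective_linearMap]
  intro X Y _ _ _ _ f hf
  rw [injective_iff_map_eq_zero]
  intro z hz
  have hfst : LinearMap.rTensor X (LinearMap.fst R A B) z = 0 := by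
    apply Module.Flat.lTensor_preserves_injective_linearMap (M := A) f hf
    rw [← rTensor_lTensor_comm, hz, map_zero, map_zero]
  have hsnd : LinearMap.rTensor X (LinearMap.snd R A B) z = 0 := by
    apply Module.Flat.lTensor_preserves_injective_linearMap (M := B) f hf
    rw [← rTensor_lTensor_comm, hz, map_zero, map_zero]
  have hid : (LinearMap.id : (A × B) →ₗ[R] A × B) = LinearMap.inl R A B ∘ₗ LinearMap.fst R A B +
      LinearMap.inr R A B ∘ₗ LinearMap.snd R A B := by
    ext <;> simp
  have h := LinearMap.congr_fun (LinearMap.rTensor_id X (A × B)) z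
  rw [hid, LinearMap.rTensor_add, LinearMap.add_apply, LinearMap.rTensor_comp_apply,
    LinearMap.rTensor_comp_apply, hfst, hsnd, map_zero, map_zero, add_zero] at h
  exact h.symm

lemma flat_cech (xs : List R) (n : ℕ) :
    Module.Flat R (((cech xs).obj (ModuleCat.of R R)).X n) := by
  induction xs generalizing n with
  | nil =>
    cases n with
    | zero => exact Module.Flat.of_linearEquiv (cechZero (ModuleCat.of R R) []).toLinearEquiv
    | succ n =>
      have := subsingleton_cech [] (ModuleCat.of R R) (n + 1) (by simp)
      infer_instance
  | cons x xs ih =>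
    cases n with
    | zero => exact ih 0
    | succ n =>
      have h1 := ih n
      exact flat_prod (ih (n + 1)) (flat_away x (((cech xs).obj (ModuleCat.of R R)).X n))

lemma exists_away_tensor_equiv (x : R) {K L M : Type u} [AddCommGroup K] [AddCommGroup L]
    [AddCommGroup M] [Module R K] [Module R L] [Module R M] (θ : TensorProduct R K M ≃ₗ[R] L) :
    ∃ Θ : TensorProduct R (Away x K) M ≃ₗ[R] Away x L,
      ∀ z, Θ (LinearMap.rTensor M (awayMk x K) z) = awayMk x L (θ z) := by
  have : IsLocalizedModule (Submonoid.powers x) (LinearMap.rTensor M (awayMk x K)) := by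
    have := IsLocalizedModule.rTensor (A := R) (N := M) (R := R) (Submonoid.powers x) (awayMk x K)
    exact this
  have h2 : IsLocalizedModule (Submonoid.powers x) (awayMk x L ∘ₗ θ.toLinearMap) :=
    IsLocalizedModule.of_linearEquiv_right _ _ _
  refine ⟨IsLocalizedModule.linearEquiv (Submonoid.powers x) (LinearMap.rTensor M (awayMk x K))
    (awayMk x L ∘ₗ θ.toLinearMap), fun z => ?_⟩
  exact IsLocalizedModule.linearEquiv_apply _ _ _ _

/-- An isomorphism of `K ⊗ M` with `L`. -/
structure TensorIso (M : Type u) [AddCommGroup M] [Module R M]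
    (K L : CochainComplex (ModuleCat.{u} R) ℕ) where
  θ : ∀ n, TensorProduct R (K.X n) M ≃ₗ[R] L.X n
  comm : ∀ n z, (L.d n (n + 1)).hom (θ n z) =
    θ (n + 1) (LinearMap.rTensor M (K.d n (n + 1)).hom z)

lemma TensorIso.exists_fibObj {M : Type u} [AddCommGroup M] [Module R M]
    {K L : CochainComplex (ModuleCat.{u} R) ℕ} (T : TensorIso M K L) (x : R) :
    Nonempty (TensorIso M (fibObj x K) (fibObj x L)) := by
  choose Θ hΘ using fun n => exists_away_tensor_equiv x (T.θ n)
  have hΘd : ∀ n (b : TensorProduct R (Away x (K.X n)) M),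
      awayMap x (L.d n (n + 1)).hom (Θ n b) =
        Θ (n + 1) (LinearMap.rTensor M (awayMap x (K.d n (n + 1)).hom) b) := by
    intro n b
    induction b with
    | zero => simp
    | add a b ha hb => simp only [map_add, ha, hb]
    | tmul b m =>
      obtain ⟨k, a, ha⟩ := awayMk_surj x b
      apply away_pow_smul_cancel x k
      rw [← map_smul, ← map_smul, ← map_smul, ← map_smul, TensorProduct.smul_tmul', ha,
        LinearMap.rTensor_tmul, awayMap_mk]
      have h1 := hΘ n (a ⊗ₜ[R] m)
      have h2 := hΘ (n + 1) ((K.d n (n + 1)).hom a ⊗ₜ[R] m)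
      rw [LinearMap.rTensor_tmul] at h1 h2
      rw [h1, h2, awayMap_mk, T.comm, LinearMap.rTensor_tmul]
  let ψ : ∀ n, TensorProduct R ((fibObj x K).X n) M ≃ₗ[R] (fibObj x L).X n := fun n => match n with
    | 0 => T.θ 0
    | n + 1 => (TensorProduct.prodLeft R R (K.X (n + 1)) (Away x (K.X n)) M).trans
        ((T.θ (n + 1)).prodCongr (Θ n))
  refine ⟨⟨ψ, fun n z => ?_⟩⟩
  suffices h : ((fibObj x L).d n (n + 1)).hom ∘ₗ (ψ n).toLinearMap =
      (ψ (n + 1)).toLinearMap ∘ₗ LinearMap.rTensor M ((fibObj x K).d n (n + 1)).hom from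
    LinearMap.congr_fun h z
  refine TensorProduct.ext' fun a m => ?_
  cases n with
  | zero =>
    change K.X 0 at a
    refine (fibObj_d_zero x L (T.θ 0 (a ⊗ₜ m))).trans ?_
    refine Eq.trans ?_ (congrArg (fun t => ψ 1 (t ⊗ₜ[R] m)) (fibObj_d_zero x K a)).symm
    exact Prod.ext (T.comm 0 (a ⊗ₜ m)) (hΘ 0 (a ⊗ₜ m)).symm
  | succ n =>
    obtain ⟨a, b⟩ := a
    refine (fibObj_d_succ x L n (T.θ (n + 1) (a ⊗ₜ m)) (Θ n (b ⊗ₜ m))).trans ?_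
    refine Eq.trans ?_ (congrArg (fun t => ψ (n + 2) (t ⊗ₜ[R] m)) (fibObj_d_succ x K n a b)).symm
    refine Prod.ext (T.comm (n + 1) (a ⊗ₜ m)) ?_
    change awayMk x _ (T.θ (n + 1) (a ⊗ₜ m)) - awayMap x (L.d n (n + 1)).hom (Θ n (b ⊗ₜ m)) =
      Θ (n + 1) ((awayMk x _ a - awayMap x (K.d n (n + 1)).hom b) ⊗ₜ m)
    rw [TensorProduct.sub_tmul, map_sub, hΘd, ← hΘ]
    rfl

/-- Allows the Čech complex of `M` to be studied through the flat Čech complex of `R`. -/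
lemma exists_tensorIso_cech (xs : List R) (M : Type u) [AddCommGroup M] [Module R M] :
    Nonempty (TensorIso M ((cech xs).obj (ModuleCat.of R R)) ((cech xs).obj (ModuleCat.of R M))) := by
  induction xs with
  | nil =>
    have h : ∀ (N : ModuleCat.{u} R) n, Subsingleton (((cech ([] : List R)).obj N).X (n + 1)) :=
      fun N n => subsingleton_cech [] _ _ (by simp)
    let eR := (cechZero (ModuleCat.of R R) []).toLinearEquiv
    let eM := (cechZero (ModuleCat.of R M) []).toLinearEquiv
    have h1 := h (ModuleCat.of R R)
    have h2 := h (ModuleCat.of R M)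
    exact ⟨⟨fun n => match n with
      | 0 => ((TensorProduct.congr eR (LinearEquiv.refl R M)).trans (TensorProduct.lid R M)).trans
          eM.symm
      | n + 1 => 0, fun n z => Subsingleton.elim _ _⟩⟩
  | cons x xs ih =>
    obtain ⟨T⟩ := ih
    exact T.exists_fibObj x

end CechTor

/-! ### Small support and Čech cohomology -/

section Characterization

variable {R : Type u} [CommRing R]

lemma isZero_Tor_iff {M κ : ModuleCat.{u} R} (P : ProjectiveResolution κ) (i : ℕ) :
    Limits.IsZero (((Tor (ModuleCat.{u} R) i).obj M).obj κ) ↔ TorV P.complex i M :=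
  (P.isoLeftDerivedObj ((MonoidalCategory.tensoringLeft (ModuleCat.{u} R)).obj M) i).isZero_iff

variable [IsNoetherianRing R]

/-- The Čech complex of `R` is bounded and flat with torsion cohomology. By dévissage `M` has no Tor
with torsion modules, so tensoring with `M` leaves an exact complex. -/
lemma subsingleton_CH_of_torV (xs : List R) (M : ModuleCat.{u} R) (Q : ProjectiveResolution M)
    (h : ∀ p : PrimeSpectrum R, Ideal.span {x : R | x ∈ xs} ≤ p.asIdeal →
      ∀ i, TorV Q.complex i p.asIdeal.ResidueField) (n : ℕ) : Subsingleton (CH xs n M) := by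
  obtain ⟨ε, hQ⟩ := exists_isFlatRes Q
  have := hQ.flat
  have htor : ∀ (L : Type u) [AddCommGroup L] [Module R L],
      (∀ l : L, ∀ x ∈ xs, ∃ k : ℕ, x ^ k • l = 0) → ∀ i, TorV Q.complex i L :=
    fun L _ _ hL i => torV_of_torsion xs h L hL i
  obtain ⟨hinj, hex⟩ := exact_rTensor_of_torV hQ (flat_cech xs) xs.length
    (fun n hn => subsingleton_cech xs _ n hn)
    (htor _ fun l x hx => by
      obtain ⟨k, hk⟩ := (cyclesTorsion_cech xs (ModuleCat.of R R) x hx).1 l.1 l.2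
      exact ⟨k, Subtype.ext hk⟩)
    (fun n => htor _ fun l x hx => by
      obtain ⟨l, rfl⟩ := Submodule.mkQ_surjective _ l
      obtain ⟨k, w, hk⟩ := (cyclesTorsion_cech xs (ModuleCat.of R R) x hx).2 n l.1 l.2
      refine ⟨k, ?_⟩
      rw [← map_smul]
      exact (Submodule.Quotient.mk_eq_zero _).2 ⟨w, hk.symm⟩)
  obtain ⟨T⟩ := exists_tensorIso_cech xs M
  rw [← isZero_CH_iff]
  cases n with
  | zero =>
    refine (isZero_homology_zero_iff ((cech xs).obj (ModuleCat.of R M))).2 fun z hz => ?_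
    obtain ⟨w, rfl⟩ := (T.θ 0).surjective z
    have h1 := (T.comm 0 w).symm.trans hz
    rw [(injective_iff_map_eq_zero _).1 hinj w
      ((T.θ 1).injective (h1.trans (map_zero (T.θ 1)).symm)), map_zero]
  | succ n =>
    refine (isZero_homology_succ_iff ((cech xs).obj (ModuleCat.of R M)) n).2 fun z hz => ?_
    obtain ⟨w, rfl⟩ := (T.θ (n + 1)).surjective z
    have h1 := (T.comm (n + 1) w).symm.trans hz
    obtain ⟨v, rfl⟩ := (hex n w).1 ((T.θ (n + 2)).injective (h1.trans (map_zero (T.θ (n + 2))).symm))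
    exact ⟨T.θ n v, T.comm n v⟩

/-- The modules with small support in `D(J)` are those without Čech cohomology along generators
of `J`. -/
theorem suppInv_D_iff (xs : List R) (M : ModuleCat.{u} R) :
    suppInv (D (Ideal.span {x : R | x ∈ xs})) M ↔ ∀ n, Subsingleton (CH xs n M) := by
  constructor
  · intro h
    have Q := projectiveResolution M
    refine subsingleton_CH_of_torV xs M Q fun p hp i => ?_
    by_contra hi
    have P := projectiveResolution (ModuleCat.of R p.asIdeal.ResidueField)
    obtain ⟨ε, hQ⟩ := exists_isFlatRes Q
    obtain ⟨εκ, hP⟩ := exists_isFlatRes P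
    -- Small support is computed from a resolution of `κ(p)`, the dévissage from one of `M`.
    rw [← torV_balance hP hQ, ← isZero_Tor_iff P] at hi
    exact h (show p ∈ smallSupport M from ⟨i, hi⟩) hp
  · rintro h p ⟨i, hi⟩ hp
    have P := projectiveResolution (ModuleCat.of R p.asIdeal.ResidueField)
    refine hi ((isZero_Tor_iff P i).2 (torV_of_subsingleton_CH P xs (fun x hx z => ?_) M h i))
    have : algebraMap R p.asIdeal.ResidueField x = 0 :=
      Ideal.algebraMap_residueField_eq_zero.2 (hp (Ideal.subset_span hx))
    change x • (z : p.asIdeal.ResidueField) = 0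
    rw [Algebra.smul_def, this, zero_mul]

end Characterization

/-! ### Wideness and ideals of given height -/

section Wide

variable {R : Type u} [CommRing R]

lemma D_inf (I J : Ideal R) : D (I ⊓ J) = D I ∩ D J := by
  ext p
  simp only [D, Set.mem_ofPred_eq, Set.mem_inter_iff, p.2.inf_le, not_or]

lemma suppInv_inter (Φ Ψ : Set (PrimeSpectrum R)) (M : ModuleCat.{u} R) :
    suppInv (Φ ∩ Ψ) M ↔ suppInv Φ M ∧ suppInv Ψ M :=
  Set.subset_inter_iff

lemma compl_zeroLocus (I : Ideal R) : (PrimeSpectrum.zeroLocus (I : Set R))ᶜ = D I := rfl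

lemma isSES_of_shortExact {S : ShortComplex (ModuleCat.{u} R)} (hS : S.ShortExact) :
    IsSES S.f.hom S.g.hom where
  inj := hS.moduleCat_injective_f
  exact := (ShortComplex.ShortExact.moduleCat_exact_iff_function_exact _).1 hS.exact
  surj := hS.moduleCat_surjective_g

section Through

variable {n : ℕ} (S : ComposableArrows (ModuleCat.{u} R) (n + 2))

/-- The image of the `i`-th map of a sequence. -/
abbrev imageAt (i : ℕ) (hi : i ≤ n + 1) : Submodule R (S.obj' (i + 1)) :=
  LinearMap.range (S.map' i (i + 1)).hom

variable {S}

lemma isSES_imageAt (hS : S.Exact) (i : ℕ) (hi : i ≤ n) :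
    IsSES (imageAt S i (by omega)).subtype (S.map' (i + 1) (i + 2)).hom.rangeRestrict where
  inj := Subtype.val_injective
  exact := by
    have h := (ShortComplex.ShortExact.moduleCat_exact_iff_function_exact _).1 (hS.exact i)
    rw [LinearMap.exact_iff, Submodule.range_subtype]
    exact (LinearMap.ker_rangeRestrict _).trans (LinearMap.exact_iff.1 h)
  surj := LinearMap.surjective_rangeRestrict _

variable (xs : List R)

/-- Dimension shifting through the acyclic middle terms; `imageAt S 0` stands for the left end and
`imageAt S (n + 1)` for the right end. -/
lemma subsingleton_CH_imageAt (hS : S.Exact)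
    (h : ∀ i (hi : i ≤ n) k, Subsingleton (CH xs k (S.obj' (i + 1)))) (j : ℕ) (hj : j ≤ n + 1)
    (k : ℕ) : Subsingleton (CH xs (k + j) (imageAt S 0 (by omega))) ↔
      Subsingleton (CH xs k (imageAt S j hj)) := by
  induction j generalizing k with
  | zero => rfl
  | succ j ih =>
    rw [← subsingleton_CH_succ_iff (isSES_imageAt hS j (by omega)) xs k (h j (by omega) k)
      (h j (by omega) (k + 1)), ← ih (by omega) (k + 1), Nat.add_right_comm k 1 j, add_assoc]

lemma subsingleton_CH_zero_imageAt (hS : S.Exact) (i : ℕ) (hi : i ≤ n)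
    (h : Subsingleton (CH xs 0 (S.obj' (i + 1)))) :
    Subsingleton (CH xs 0 (imageAt S i (by omega))) :=
  (CHmap_zero_injective (isSES_imageAt hS i hi) xs).subsingleton

/-- For `k ≤ n`, degree `k` at the left end shifts to degree zero of the image inside the `k`-th
middle term, where it vanishes by left exactness. Above `n` the list is too short. The right end in
degree `k` corresponds to the left end in degree `k + n + 1`. -/
lemma subsingleton_CH_ends (hxs : xs.length ≤ n) {P : ObjectProperty (ModuleCat.{u} R)}
    (hP : ∀ M, P M → ∀ k, Subsingleton (CH xs k M)) (hS : IsExactThrough P n S) (k : ℕ) :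
    Subsingleton (CH xs k (S.obj' 0)) ∧ Subsingleton (CH xs k (S.obj' (n + 2))) := by
  have h : ∀ i (hi : i ≤ n) k, Subsingleton (CH xs k (S.obj' (i + 1))) :=
    fun i hi k => hP _ (hS.mem i hi) k
  have h0 : ∀ k, Subsingleton (CH xs k (imageAt S 0 (by omega))) := by
    intro k
    by_cases hk : k ≤ n
    · have := (subsingleton_CH_imageAt xs hS.exact h k (by omega) 0).2
        (subsingleton_CH_zero_imageAt xs hS.exact k hk (h k hk 0))
      rwa [zero_add] at this
    · exact subsingleton_CH_of_length_lt xs k (by omega)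
  constructor
  · have hinj : Function.Injective (S.map' 0 1).hom := (ModuleCat.mono_iff_injective _).1 hS.mono
    exact (subsingleton_CH_congr xs k (LinearEquiv.ofInjective _ hinj)).2 (h0 k)
  · have hsurj : Function.Surjective (S.map' (n + 1) (n + 2)).hom :=
      (ModuleCat.epi_iff_surjective _).1 hS.epi
    refine (subsingleton_CH_congr xs k (LinearEquiv.ofTop _ (LinearMap.range_eq_top.2 hsurj))).1 ?_
    exact (subsingleton_CH_imageAt xs hS.exact h (n + 1) le_rfl k).1 (h0 _)

end Through

variable [IsNoetherianRing R]

lemma suppInv_inf_iff (xs ys : List R) (M : ModuleCat.{u} R) :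
    suppInv (D (Ideal.span {x : R | x ∈ xs} ⊓ Ideal.span {x : R | x ∈ ys})) M ↔
      (∀ n, Subsingleton (CH xs n M)) ∧ ∀ n, Subsingleton (CH ys n M) := by
  rw [D_inf, suppInv_inter, suppInv_D_iff, suppInv_D_iff]

/-- If `I` is the intersection of two ideals generated by at most `n` elements, then
`supp⁻¹ D(I)` is `n`-wide. -/
theorem isNWide_suppInv_inf (xs ys : List R) (n : ℕ) (hx : xs.length ≤ n) (hy : ys.length ≤ n) :
    IsNWide n (suppInv (D (Ideal.span {x : R | x ∈ xs} ⊓ Ideal.span {x : R | x ∈ ys}))) := by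
  have hX := fun M h => ((suppInv_inf_iff xs ys M).1 h).1
  have hY := fun M h => ((suppInv_inf_iff xs ys M).1 h).2
  refine ⟨⟨fun hS h₁ h₃ => ?_⟩, fun S hS => ?_, fun S hS => ?_⟩
  · have h := isSES_of_shortExact hS
    exact (suppInv_inf_iff xs ys _).2
      ⟨fun k => CH_subsingleton_middle xs k h (hX _ h₁ k) (hX _ h₃ k),
        fun k => CH_subsingleton_middle ys k h (hY _ h₁ k) (hY _ h₃ k)⟩
  · exact (suppInv_inf_iff xs ys _).2 ⟨fun k => (subsingleton_CH_ends xs hx hX hS k).1,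
      fun k => (subsingleton_CH_ends ys hy hY hS k).1⟩
  · exact (suppInv_inf_iff xs ys _).2 ⟨fun k => (subsingleton_CH_ends xs hx hX hS k).2,
      fun k => (subsingleton_CH_ends ys hy hY hS k).2⟩

/-- The cohomological dimension of the intersection of ideals generated by complementary parts of a
sequence of `t` elements generating an ideal of height `t`. -/
theorem cdIdeal_inf_eq_of_height (xs ys : List R) (hx : 1 ≤ xs.length) (hy : 1 ≤ ys.length)
    (h : (Ideal.span {x : R | x ∈ xs ++ ys}).height = ((xs.length + ys.length : ℕ) : ℕ∞)) :
    cdIdeal (Ideal.span {x : R | x ∈ xs} ⊓ Ideal.span {x : R | x ∈ ys}) =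
      ((xs.length + ys.length - 1 : ℕ) : WithBot ℕ∞) := by
  refine cdIdeal_inf_eq xs ys hx hy ?_
  obtain ⟨n, hn⟩ : ∃ n, xs.length + ys.length = n + 1 := ⟨xs.length + ys.length - 1, by omega⟩
  rw [hn] at h ⊢
  rw [← span_append]
  intro h0
  exact nontrivial_CH_of_height (xs ++ ys) n (by rw [List.length_append, hn]) h
    ((isZero_localCohomology_iff (xs ++ ys) _ n).1 h0)

/-- Noetherian rings of dimension at least `n` have an ideal of height `n` generated by `n`
elements. -/
lemma exists_list_height_eq (n : ℕ) (h : (n : WithBot ℕ∞) ≤ ringKrullDim R) :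
    ∃ zs : List R, zs.length = n ∧ (Ideal.span {x : R | x ∈ zs}).height = (n : ℕ∞) := by
  obtain ⟨l, hl⟩ := Order.le_krullDim_iff.1 h
  obtain ⟨l', hlast, hlen⟩ := Ideal.exists_ltSeries_length_eq_height l.last.asIdeal
  rw [PrimeSpectrum.height_eq_orderHeight] at hlen
  have hlen' : (l'.length : ℕ∞) = Order.height l'.last := by
    rw [hlen]
    congr 1
    exact hlast.symm
  have hle : n ≤ l'.length := by
    have := Order.length_le_height_last (p := l)
    rw [hl, ← hlen] at this
    exact_mod_cast this
  -- In a chain realizing the height of its last prime, the member at place `n` has height exactly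
  -- `n`.
  have hp := Order.height_eq_index_of_length_eq_height_last hlen' ⟨n, by omega⟩
  set p := l' ⟨n, by omega⟩
  have hph : p.asIdeal.height = n := (PrimeSpectrum.height_eq_orderHeight p).trans hp
  -- The converse of Krull's height theorem: a prime of height `n` contains an ideal of height `n`
  -- with `n` generators.
  obtain ⟨J, -, hJ, hJh⟩ := Ideal.exists_spanRank_eq_and_height_eq p.asIdeal p.2.ne_top
  have hfg : J.FG := IsNoetherian.noetherian J
  have hs : J.generators.Finite := Submodule.FG.finite_generators hfg
  refine ⟨hs.toFinset.toList, ?_, ?_⟩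
  · rw [Finset.length_toList, ← Set.ncard_eq_toFinset_card (hs := hs), Submodule.FG.generators_ncard hfg]
    rw [Submodule.fg_iff_spanRank_eq_spanFinrank.mpr hfg, hph] at hJ
    exact_mod_cast hJ
  · rw [← hph, ← hJh]
    congr 1
    simp only [Finset.mem_toList, Set.Finite.mem_toFinset, Set.ofPred_mem_eq]
    exact J.span_generators

end Wide

end SpClosed

/-! ### The three assertions -/

theorem mainTheorem6 (R : Type u) [CommRing R] [IsNoetherianRing R] :
    -- the proposition
    (∀ (r s : ℕ), 1 ≤ r → r ≤ s → ∀ (x : Fin r → R) (y : Fin s → R) (𝔞 𝔟 I J : Ideal R),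
      𝔞 = Ideal.span (Set.range x) → 𝔟 = Ideal.span (Set.range y) → I = 𝔞 ⊓ 𝔟 → J = 𝔞 ⊔ 𝔟 →
      ¬ Limits.IsZero ((SpClosed.localCohomology (PrimeSpectrum.zeroLocus (J : Set R)) (r + s)).obj
          (ModuleCat.of R R)) →
      SpClosed.cdIdeal I = ((r + s - 1 : ℕ) : WithBot ℕ∞) ∧
        SpClosed.IsNWide s (SpClosed.suppInv (SpClosed.D I))) ∧
    -- the example
    (∀ (t s : ℕ) (x : Fin t → R), 4 ≤ t → (Ideal.span (Set.range x)).height = (t : ℕ∞) →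
      t ≤ 2 * s → s + 2 ≤ t → ∀ I : Ideal R,
      I = Ideal.span (x '' {i | (i : ℕ) < t - s}) ⊓ Ideal.span (x '' {i | t - s ≤ (i : ℕ)}) →
      SpClosed.IsNWide s (SpClosed.suppInv (SpClosed.D I)) ∧
        SpClosed.cdIdeal I = ((t - 1 : ℕ) : WithBot ℕ∞) ∧ (s : WithBot ℕ∞) < SpClosed.cdIdeal I) ∧
    -- the converse of `cd Φ ≤ n → supp⁻¹(Φᶜ) is n-wide` fails for `2 ≤ n ≤ dim R - 2`
    (∀ n : ℕ, 2 ≤ n → (n : WithBot ℕ∞) + 2 ≤ ringKrullDim R →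
      ∃ Φ : Set (PrimeSpectrum R), StableUnderSpecialization Φ ∧ IsClosed Φ ∧
        SpClosed.IsNWide n (SpClosed.suppInv Φᶜ) ∧ ¬ SpClosed.cd Φ ≤ (n : WithBot ℕ∞)) := by
  open SpClosed in
  refine ⟨fun r s hr hrs x y 𝔞 𝔟 I J ha hb hI hJ h => ?_, fun t s x ht hh hts hst I hI => ?_,
    fun n hn hdim => ?_⟩
  · have hx : 𝔞 = Ideal.span {z : R | z ∈ List.ofFn x} := by
      rw [ha]; congr 1; ext z; simp [List.mem_ofFn]
    have hy : 𝔟 = Ideal.span {z : R | z ∈ List.ofFn y} := by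
      rw [hb]; congr 1; ext z; simp [List.mem_ofFn]
    subst hI hJ
    rw [hx, hy] at h ⊢
    refine ⟨?_, isNWide_suppInv_inf _ _ s (by simpa using hrs) (by simp)⟩
    have := cdIdeal_inf_eq (List.ofFn x) (List.ofFn y) (by simpa using hr)
      (by simpa using hr.trans hrs) (by simpa using h)
    simpa using this
  · have hx : Ideal.span (x '' {i | (i : ℕ) < t - s}) =
        Ideal.span {z : R | z ∈ (List.ofFn x).take (t - s)} := by
      congr 1; ext z
      simp only [Set.mem_image, Set.mem_ofPred_eq, List.mem_take_iff_getElem, List.getElem_ofFn]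
      constructor
      · rintro ⟨i, hi, rfl⟩
        exact ⟨i, by simp; omega, rfl⟩
      · rintro ⟨j, hj, rfl⟩
        exact ⟨_, (lt_min_iff.1 hj).1, rfl⟩
    have hy : Ideal.span (x '' {i | t - s ≤ (i : ℕ)}) =
        Ideal.span {z : R | z ∈ (List.ofFn x).drop (t - s)} := by
      congr 1; ext z
      simp only [Set.mem_image, Set.mem_ofPred_eq, List.mem_drop_iff_getElem, List.getElem_ofFn]
      constructor
      · rintro ⟨i, hi, rfl⟩
        exact ⟨i - (t - s), by simp; omega, by congr 1; ext; simp; omega⟩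
      · rintro ⟨j, hj, rfl⟩
        exact ⟨_, Nat.le_add_right _ _, rfl⟩
    have hlx : ((List.ofFn x).take (t - s)).length = t - s := by simp
    have hly : ((List.ofFn x).drop (t - s)).length = s := by simp; omega
    have hcd := cdIdeal_inf_eq_of_height ((List.ofFn x).take (t - s)) ((List.ofFn x).drop (t - s))
      (by omega) (by omega) (by
        rw [List.take_append_drop, hlx, hly, Nat.sub_add_cancel (by omega), ← hh]
        congr 2; ext z; simp [List.mem_ofFn])
    rw [hlx, hly, Nat.sub_add_cancel (by omega)] at hcd
    rw [hI, hx, hy, hcd]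
    -- The two parts have `t - s` and `s` elements, and `t ≤ 2 * s` means `t - s ≤ s`.
    refine ⟨isNWide_suppInv_inf _ _ s (by omega) (by omega), rfl, ?_⟩
    exact_mod_cast (by omega : s < t - 1)
  -- Split `n + 2` elements into `2` and `n`: both numbers are at most `n` because `n ≥ 2`, while
  -- the cohomological dimension is `n + 1`.
  · obtain ⟨zs, hlen, hz⟩ := exists_list_height_eq (R := R) (n + 2) (by exact_mod_cast hdim)
    have hlx : (zs.take 2).length = 2 := by simp; omega
    have hly : (zs.drop 2).length = n := by simp; omega
    have hcd := cdIdeal_inf_eq_of_height (zs.take 2) (zs.drop 2) (by omega) (by omega) (by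
      rw [List.take_append_drop, hlx, hly, hz, add_comm])
    refine ⟨PrimeSpectrum.zeroLocus ((Ideal.span {x : R | x ∈ zs.take 2} ⊓
      Ideal.span {x : R | x ∈ zs.drop 2} : Ideal R) : Set R),
      (PrimeSpectrum.isClosed_zeroLocus _).stableUnderSpecialization,
      PrimeSpectrum.isClosed_zeroLocus _, ?_, ?_⟩
    · rw [compl_zeroLocus]
      exact isNWide_suppInv_inf _ _ n (by omega) (by omega)
    · rw [cdIdeal, hlx, hly] at hcd
      rw [hcd, not_le]
      exact_mod_cast (by omega : n < 2 + n - 1)
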